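/- **Theorem 1.5 (h-embedding).** Let $\lambda\in\mathbb R$. A *gradient Ricci flow spacetime* $(\mathcal M, g, \phi, t, \partial_t,\lambda)$ consists of a smooth $(n+1)$-manifold with boundary $\mathcal M$; a smooth submersion $t:\mathcal M\to I$ to a time interval $I\subset\mathbb R$ with $\partial\mathcal M=t^{-1}(\partial I)$; a smooth vector field $\partial_t$ with $\partial_t t\equiv 1$; a smooth inner product $g$ on the spatial bundle $\ker dt\subset T\mathcal M$; and $\phi\in C^\infty(\mathcal M)$, such that $$\mathcal L_{\partial_t}g=-2(\mathrm{Ric}+\nabla^2\phi-\lambda g),\qquad \mathcal L_{\partial_t}\phi=-(R+\Delta\phi-n\lambda),$$ where $\mathrm{Ric},\nabla^2\phi,R,\Delta\phi$ are those of the time slices. (For $\lambda=0$ this is $\mathcal L_{\partial_t}g=-2(\mathrm{Ric}+\nabla^2\phi)$, $\mathcal L_{\partial_t}\phi=-(R+\Delta\phi)$.) Let $R_\phi=R+2\Delta\phi-|\nabla\phi|^2+2\lambda(\phi-n)$ be the weighted scalar curvature of the slices. Fix $t_0\in\mathbb R$ and let $u$ be the function of $t$ with $du/dt=-(1-\lambda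 u)$ (i.e. $\partial_t=-(1-\lambda u)\partial_u$) and $u=0$ at $t=t_0$; let $v$ be the coordinate on $\mathbb R$. Extend $g$ to a form on $T\mathcal M$, written $g_u$, by $g(\partial_t,\cdot)=0$, and write $\phi_u$ for $\phi$. On $\mathcal M\times\mathbb R$ put $$\widetilde g=2\,du\,dv+g_u-(1-\lambda u)^{-2}R_\phi\,du^2,\qquad \widetilde\phi=\phi_u-v+\lambda uv.$$ Then $(\mathcal M\times\mathbb R,\widetilde g,\widetilde\phi,\lambda)$ is a global weighted ambient half-space over the slice $t=t_0$. That is: $u\le 0$ exactly where $t\ge t_0$; $\widetilde g$ is a smooth metric of signature $(n+1,1)$ and $\widetilde\phi$ is smooth; $\widetilde g$ is invariant under the translations in $v$, and $\delta_s^*\widetilde\phi=\widetilde\phi+s$ for the dilations $\delta_s(m,v)=(m,v+(\lambda u-1)^{-1}s)$ (which for $\lambda=0$ are the translations $v\mapsto v-s$); on the hypersurface $u=0$ one has $\widetilde g=g$ on vectors tangent to it, $\widetilde\phi=\phi-v$, and $\nabla_{\partial_v}\partial_v=0$; and everywhere on $\mathcal M\times\mathbb R$ $$\widetilde P_\phi:=\mathrm{Ric}_{\widetilde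 g}+\widetilde\nabla^2\widetilde\phi-\lambda\widetilde g=0,\qquad \widetilde F_\phi:=\widetilde\Delta\widetilde\phi-|\widetilde\nabla\widetilde\phi|^2+2\lambda\widetilde\phi-(n+2)\lambda=0 .$$ -/

import Mathlib

open scoped Manifold ContDiff Topology
open VectorField

noncomputable section

namespace RicciAmbient

section Frames

variable {E : Type*} [NormedAddCommGroup E] [NormedSpace ℝ E]
  {H : Type*} [TopologicalSpace H] (I : ModelWithCorners ℝ E H)
  {N : Type*} [TopologicalSpace N] [ChartedSpace H N]

/-- A (not necessarily smooth) vector field on `N`. -/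
abbrev VField (I : ModelWithCorners ℝ E H) (N : Type*) [TopologicalSpace N] [ChartedSpace H N] :=
  (x : N) → TangentSpace I x

/-- A field of bilinear forms on the tangent spaces of `N`. -/
abbrev FormField (I : ModelWithCorners ℝ E H) (N : Type*) [TopologicalSpace N]
    [ChartedSpace H N] :=
  (x : N) → LinearMap.BilinForm ℝ (TangentSpace I x)

/-- `X` is a smooth vector field on the set `U`. -/
def SmoothFieldOn [IsManifold I ∞ N] (X : VField I N) (U : Set N) : Prop :=
  ContMDiffOn I I.tangent ∞ (fun x => (⟨x, X x⟩ : TangentBundle I N)) U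

/-- Smoothness of a field of bilinear forms: it takes smooth local vector fields to smooth
functions. -/
def SmoothForm [IsManifold I ∞ N] (g : FormField I N) : Prop :=
  ∀ (U : Set N) (X Y : VField I N), IsOpen U → SmoothFieldOn I X U → SmoothFieldOn I Y U →
    ContMDiffOn I 𝓘(ℝ, ℝ) ∞ (fun x => g x (X x) (Y x)) U

/-- The derivative `X f` of a function along a vector field. -/
def along (X : VField I N) (f : N → ℝ) (x : N) : ℝ := mvfderiv I f x (X x)

/-- The Lie derivative `(L_V g)(X, Y)`. -/
def lieDerivForm (V : VField I N) (g : FormField I N) (X Y : VField I N) (x : N) : ℝ :=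
  along I V (fun y => g y (X y) (Y y)) x - g x (mlieBracket I V X x) (Y x)
    - g x (X x) (mlieBracket I V Y x)

/-- The right-hand side of the Koszul formula, i.e. `g(∇_X Y, Z)` for the Levi-Civita
connection of `g`. -/
def koszul (g : FormField I N) (X Y Z : VField I N) (x : N) : ℝ :=
  (1 / 2) * (along I X (fun y => g y (Y y) (Z y)) x + along I Y (fun y => g y (X y) (Z y)) x
    - along I Z (fun y => g y (X y) (Y y)) x
    + g x (mlieBracket I X Y x) (Z x) - g x (mlieBracket I X Z x) (Y x)
    - g x (mlieBracket I Y Z x) (X x))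

/-- `e` is a smooth local frame, on the open set `U`, of the distribution `D ⊆ TN`. -/
structure IsFrameOn [IsManifold I ∞ N] {ι : Type*} (D : (x : N) → Submodule ℝ (TangentSpace I x))
    (e : ι → VField I N) (U : Set N) : Prop where
  isOpen : IsOpen U
  smooth : ∀ a, SmoothFieldOn I (e a) U
  linearIndependent : ∀ x ∈ U, LinearIndependent ℝ (fun a => e a x)
  span_eq : ∀ x ∈ U, Submodule.span ℝ (Set.range fun a => e a x) = D x

variable {ι : Type*} [Fintype ι] [DecidableEq ι]

/-! Components, in a local frame `e` of an involutive distribution `D`, of the leafwise geometry of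
a field of forms `g` that is non-degenerate on `D`. For `D = ⊤` this is the usual
pseudo-Riemannian geometry of `(N, g)`. -/

/-- `g_{ab}`. -/
def gram (g : FormField I N) (e : ι → VField I N) (x : N) : Matrix ι ι ℝ :=
  Matrix.of fun a b => g x (e a x) (e b x)

/-- `g^{ab}`. -/
def gramInv (g : FormField I N) (e : ι → VField I N) (x : N) : Matrix ι ι ℝ := (gram I g e x)⁻¹

/-- The connection coefficients: `∇_{e_a} e_b = Γ_{ab}^d e_d`. -/
def connCoeff (g : FormField I N) (e : ι → VField I N) (a b d : ι) (x : N) : ℝ :=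
  ∑ c, koszul I g (e a) (e b) (e c) x * gramInv I g e x c d

/-- The structure functions: `[e_a, e_b] = C_{ab}^d e_d`. -/
def structFun (g : FormField I N) (e : ι → VField I N) (a b d : ι) (x : N) : ℝ :=
  ∑ c, g x (mlieBracket I (e a) (e b) x) (e c x) * gramInv I g e x c d

/-- The curvature: `R(e_a, e_b) e_c = Riem_{abc}^d e_d`, where
`R(X, Y) Z = ∇_X ∇_Y Z - ∇_Y ∇_X Z - ∇_{[X, Y]} Z`. -/
def riem (g : FormField I N) (e : ι → VField I N) (a b c d : ι) (x : N) : ℝ :=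
  along I (e a) (connCoeff I g e b c d) x - along I (e b) (connCoeff I g e a c d) x
    + ∑ k, (connCoeff I g e b c k x * connCoeff I g e a k d x
      - connCoeff I g e a c k x * connCoeff I g e b k d x
      - structFun I g e a b k x * connCoeff I g e k c d x)

/-- The Ricci tensor: `Ric(Y, Z)` is the trace of `X ↦ R(X, Y) Z`. -/
def ric (g : FormField I N) (e : ι → VField I N) (b c : ι) (x : N) : ℝ :=
  ∑ a, riem I g e a b c a x

/-- The scalar curvature. -/
def scal (g : FormField I N) (e : ι → VField I N) (x : N) : ℝ :=
  ∑ a, ∑ b, gramInv I g e x a b * ric I g e a b x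

/-- The Hessian `∇²φ`. -/
def hess (g : FormField I N) (e : ι → VField I N) (φ : N → ℝ) (a b : ι) (x : N) : ℝ :=
  along I (e a) (along I (e b) φ) x - ∑ c, connCoeff I g e a b c x * along I (e c) φ x

/-- The Laplacian `Δφ`, the trace of the Hessian. -/
def lap (g : FormField I N) (e : ι → VField I N) (φ : N → ℝ) (x : N) : ℝ :=
  ∑ a, ∑ b, gramInv I g e x a b * hess I g e φ a b x

/-- The squared norm `|∇φ|²` of the gradient. -/
def gradSq (g : FormField I N) (e : ι → VField I N) (φ : N → ℝ) (x : N) : ℝ :=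
  ∑ a, ∑ b, gramInv I g e x a b * along I (e a) φ x * along I (e b) φ x

/-- `P_φ = Ric + ∇²φ - lam g`. -/
def wP (g : FormField I N) (e : ι → VField I N) (φ : N → ℝ) (lam : ℝ) (a b : ι) (x : N) : ℝ :=
  ric I g e a b x + hess I g e φ a b x - lam * g x (e a x) (e b x)

/-- `F_φ = Δφ - |∇φ|² + 2 lam φ - dim · lam`. -/
def wF (g : FormField I N) (e : ι → VField I N) (φ : N → ℝ) (lam : ℝ) (x : N) : ℝ :=
  lap I g e φ x - gradSq I g e φ x + 2 * lam * φ x - (Fintype.card ι : ℝ) * lam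

/-- `R_φ = R + 2Δφ - |∇φ|² + 2 lam (φ - dim)`. -/
def wR (g : FormField I N) (e : ι → VField I N) (φ : N → ℝ) (lam : ℝ) (x : N) : ℝ :=
  scal I g e x + 2 * lap I g e φ x - gradSq I g e φ x + 2 * lam * (φ x - Fintype.card ι)

end Frames

section Spacetime

variable {n : ℕ} {M : Type*} [TopologicalSpace M] [ChartedSpace (EuclideanHalfSpace (n + 1)) M]
  [IsManifold (𝓡∂ (n + 1)) ∞ M]

/-- The spatial distribution `ker dt`. -/
def spatial (t : M → ℝ) (x : M) : Submodule ℝ (TangentSpace (𝓡∂ (n + 1)) x) :=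
  LinearMap.ker (mvfderiv (𝓡∂ (n + 1)) t x).toLinearMap

/-- A gradient Ricci flow spacetime with parameter `lam`, on the `(n+1)`-manifold with boundary
`M`. The inner product on `ker dt` is extended to `TM` by `g(∂_t, ·) = 0`. That the time function is
a submersion follows from `∂_t t = 1`. The Ricci tensor, Hessian, scalar curvature and Laplacian are
those of the time slices; the flow equations are required in every local frame of `ker dt`. -/
structure GradientRicciFlowSpacetime (n : ℕ) (M : Type*) [TopologicalSpace M]
    [ChartedSpace (EuclideanHalfSpace (n + 1)) M] [IsManifold (𝓡∂ (n + 1)) ∞ M] (lam : ℝ) where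
  /-- the time interval -/
  interval : Set ℝ
  interval_ordConnected : interval.OrdConnected
  /-- the time function -/
  time : M → ℝ
  time_smooth : ContMDiff (𝓡∂ (n + 1)) 𝓘(ℝ, ℝ) ∞ time
  time_mem : ∀ x, time x ∈ interval
  boundary_eq : (𝓡∂ (n + 1)).boundary M = time ⁻¹' (frontier interval)
  /-- the time vector field -/
  dt : VField (𝓡∂ (n + 1)) M
  dt_smooth : SmoothFieldOn (𝓡∂ (n + 1)) dt Set.univ
  dt_time : ∀ x, along (𝓡∂ (n + 1)) dt time x = 1
  /-- the spatial metric -/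
  g : FormField (𝓡∂ (n + 1)) M
  g_smooth : SmoothForm (𝓡∂ (n + 1)) g
  g_symm : ∀ x X Y, g x X Y = g x Y X
  g_dt : ∀ x X, g x (dt x) X = 0
  g_pos : ∀ x, ∀ X ∈ spatial time x, X ≠ 0 → 0 < g x X X
  /-- the potential -/
  φ : M → ℝ
  φ_smooth : ContMDiff (𝓡∂ (n + 1)) 𝓘(ℝ, ℝ) ∞ φ
  flow_g : ∀ (e : Fin n → VField (𝓡∂ (n + 1)) M) (U : Set M),
    IsFrameOn (𝓡∂ (n + 1)) (spatial time) e U → ∀ x ∈ U, ∀ a b,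
      lieDerivForm (𝓡∂ (n + 1)) dt g (e a) (e b) x =
        -2 * (ric (𝓡∂ (n + 1)) g e a b x + hess (𝓡∂ (n + 1)) g e φ a b x
          - lam * g x (e a x) (e b x))
  flow_φ : ∀ (e : Fin n → VField (𝓡∂ (n + 1)) M) (U : Set M),
    IsFrameOn (𝓡∂ (n + 1)) (spatial time) e U → ∀ x ∈ U,
      along (𝓡∂ (n + 1)) dt φ x =
        -(scal (𝓡∂ (n + 1)) g e x + lap (𝓡∂ (n + 1)) g e φ x - n * lam)

namespace GradientRicciFlowSpacetime

variable {lam : ℝ} (S : GradientRicciFlowSpacetime n M lam)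

open Classical in
/-- The weighted scalar curvature `R_φ` of the time slices, a function on `M`: its value at `x` is
computed in any local frame of `ker dt` around `x`. -/
def weightedScal (x : M) : ℝ :=
  if h : ∃ (e : Fin n → VField (𝓡∂ (n + 1)) M) (U : Set M),
      IsFrameOn (𝓡∂ (n + 1)) (spatial S.time) e U ∧ x ∈ U then
    wR (𝓡∂ (n + 1)) S.g h.choose S.φ lam x
  else 0

end GradientRicciFlowSpacetime

end Spacetime

/-- The coordinate `u` as a function of time: the solution of `du/dt = -(1 - lam u)`
(i.e. `∂_t = -(1 - lam u) ∂_u`) with `u(t₀) = 0`. -/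
def uCoord (lam t₀ t : ℝ) : ℝ :=
  if lam = 0 then t₀ - t else (1 - Real.exp (lam * (t - t₀))) / lam

theorem uCoord_self (lam t₀ : ℝ) : uCoord lam t₀ t₀ = 0 := by
  simp [uCoord]

theorem hasDerivAt_uCoord (lam t₀ t : ℝ) :
    HasDerivAt (uCoord lam t₀) (-(1 - lam * uCoord lam t₀ t)) t := by
  by_cases h : lam = 0
  · have : uCoord lam t₀ = fun s => t₀ - s := by funext s; simp [uCoord, h]
    rw [this]
    simpa [h] using (hasDerivAt_id t).const_sub t₀
  · have h1 : uCoord lam t₀ = fun s => (1 - Real.exp (lam * (s - t₀))) / lam := by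
      funext s; simp [uCoord, h]
    rw [h1]
    have h2 := (((((hasDerivAt_id t).sub_const t₀).const_mul lam).exp).const_sub 1).div_const lam
    have h3 : -(1 - lam * ((1 - Real.exp (lam * (t - t₀))) / lam)) =
        -(Real.exp (lam * (t - t₀)) * (lam * 1)) / lam := by
      field_simp
      ring
    rw [h3]
    exact h2

section HalfSpace

variable {n : ℕ} {M : Type*} [TopologicalSpace M] [ChartedSpace (EuclideanHalfSpace (n + 1)) M]

/-- The model with corners of `M × ℝ`. -/
abbrev prodModel (n : ℕ) := (𝓡∂ (n + 1)).prod 𝓘(ℝ, ℝ)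

/-- The coordinate vector field `∂_v` of the factor `ℝ`. -/
def vertField : VField (prodModel n) (M × ℝ) := fun p =>
  mfderiv 𝓘(ℝ, ℝ) (prodModel n) (fun s : ℝ => ((p.1, s) : M × ℝ)) p.2 (1 : ℝ)

/-- The translation `v ↦ v + s` of `M × ℝ`. -/
def vertShift (s : ℝ) (p : M × ℝ) : M × ℝ := (p.1, p.2 + s)

/-- A symmetric bilinear form has signature `(k, 1)`. -/
def HasLorentzSignature (k : ℕ) {V : Type*} [AddCommGroup V] [Module ℝ V]
    (B : LinearMap.BilinForm ℝ V) : Prop :=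
  ∃ b : Module.Basis (Fin k ⊕ Fin 1) ℝ V, ∀ i j,
    B (b i) (b j) = (Matrix.fromBlocks 1 0 0 (-1) : Matrix (Fin k ⊕ Fin 1) (Fin k ⊕ Fin 1) ℝ) i j

variable [IsManifold (𝓡∂ (n + 1)) ∞ M]

namespace GradientRicciFlowSpacetime

variable {lam : ℝ} (S : GradientRicciFlowSpacetime n M lam) (t₀ : ℝ)

/-- The function `u` on `M × ℝ`; it vanishes on the time slice `t = t₀`. -/
def u (p : M × ℝ) : ℝ := uCoord lam t₀ (S.time p.1)

/-- The one-form `du`. -/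
def du (p : M × ℝ) : TangentSpace (prodModel n) p →ₗ[ℝ] ℝ :=
  (mvfderiv (prodModel n) (S.u t₀) p).toLinearMap

/-- The one-form `dv`. -/
def dv (p : M × ℝ) : TangentSpace (prodModel n) p →ₗ[ℝ] ℝ :=
  (mvfderiv (prodModel n) (Prod.snd : M × ℝ → ℝ) p).toLinearMap

/-- The differential of the projection `M × ℝ → M`. -/
def dπ (p : M × ℝ) : TangentSpace (prodModel n) p →ₗ[ℝ] TangentSpace (𝓡∂ (n + 1)) p.1 :=
  (mfderiv (prodModel n) (𝓡∂ (n + 1)) (Prod.fst : M × ℝ → M) p).toLinearMap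

/-- The dilation `δ_s`: `v ↦ v + (lam u - 1)⁻¹ s`. -/
def dilation (s : ℝ) (p : M × ℝ) : M × ℝ := (p.1, p.2 + (lam * S.u t₀ p - 1)⁻¹ * s)

/-- `(M × ℝ, G, Φ, lam)` is a global weighted ambient half-space over the time slice `t = t₀` of
the spacetime `S`. -/
structure IsGlobalAmbientHalfSpace (G : FormField (prodModel n) (M × ℝ)) (Φ : M × ℝ → ℝ) :
    Prop where
  /-- the half-space `u ≤ 0` is the part of the spacetime from time `t₀` on -/
  half_space : ∀ p, S.u t₀ p ≤ 0 ↔ t₀ ≤ S.time p.1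
  metric_smooth : SmoothForm (prodModel n) G
  metric_symm : ∀ p X Y, G p X Y = G p Y X
  signature : ∀ p, HasLorentzSignature (n + 1) (G p)
  potential_smooth : ContMDiff (prodModel n) 𝓘(ℝ, ℝ) ∞ Φ
  /-- `G` is independent of `v` -/
  metric_invariant : ∀ (s : ℝ) (p : M × ℝ) (X Y : TangentSpace (prodModel n) p),
    G (vertShift s p) (mfderiv (prodModel n) (prodModel n) (vertShift (M := M) s) p X)
      (mfderiv (prodModel n) (prodModel n) (vertShift (M := M) s) p Y) = G p X Y
  /-- `δ_s^* Φ = Φ + s` -/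
  potential_homogeneous : ∀ (s : ℝ) (p : M × ℝ), Φ (S.dilation t₀ s p) = Φ p + s
  /-- the initial condition `ι^* G = g`, on vectors tangent to the hypersurface `u = 0` -/
  metric_initial : ∀ p, S.time p.1 = t₀ → ∀ X Y : TangentSpace (prodModel n) p,
    S.du t₀ p X = 0 → S.du t₀ p Y = 0 → G p X Y = S.g p.1 (dπ p X) (dπ p Y)
  /-- the initial condition `ι^* Φ = φ - v` -/
  potential_initial : ∀ p, S.time p.1 = t₀ → Φ p = S.φ p.1 - p.2
  /-- `∇_{∂_v} ∂_v = 0` where `u = 0` -/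
  straight : ∀ p, S.time p.1 = t₀ → ∀ (U : Set (M × ℝ)) (Z : VField (prodModel n) (M × ℝ)),
    IsOpen U → p ∈ U → SmoothFieldOn (prodModel n) Z U →
      koszul (prodModel n) G vertField vertField Z p = 0
  /-- `P_Φ = 0`, in every local frame of `T(M × ℝ)` -/
  wP_eq_zero : ∀ (e : Fin (n + 2) → VField (prodModel n) (M × ℝ)) (U : Set (M × ℝ)),
    IsFrameOn (prodModel n) (fun _ => ⊤) e U → ∀ p ∈ U, ∀ a b,
      wP (prodModel n) G e Φ lam a b p = 0
  /-- `F_Φ = 0`, in every local frame of `T(M × ℝ)` -/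
  wF_eq_zero : ∀ (e : Fin (n + 2) → VField (prodModel n) (M × ℝ)) (U : Set (M × ℝ)),
    IsFrameOn (prodModel n) (fun _ => ⊤) e U → ∀ p ∈ U,
      wF (prodModel n) G e Φ lam p = 0

/-- `2 du dv + g_u - (1 - lam u)⁻² R_φ du²`. -/
def ambientMetric : FormField (prodModel n) (M × ℝ) := fun p =>
  LinearMap.BilinForm.linMulLin (S.du t₀ p) (dv p)
    + LinearMap.BilinForm.linMulLin (dv p) (S.du t₀ p)
    + LinearMap.BilinForm.comp (S.g p.1) (dπ p) (dπ p)
    - ((1 - lam * S.u t₀ p) ^ 2)⁻¹ • S.weightedScal p.1 •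
      LinearMap.BilinForm.linMulLin (S.du t₀ p) (S.du t₀ p)

/-- `φ_u - v + lam u v`. -/
def ambientPotential (p : M × ℝ) : ℝ := S.φ p.1 - p.2 + lam * S.u t₀ p * p.2

end GradientRicciFlowSpacetime

end HalfSpace

end RicciAmbient

end

/-! Write `V` for `∂_v`, `T` for the lift of `∂_t`, `e` for the lift of a local frame of `ker dt`,
and `Φ` for the ambient potential. The metric gives `g(V, ·) = du`, so `V` is null with closed dual
form; nothing in the metric depends on `v`, so `V` is Killing. A Killing field with closed dual form
is parallel (`nab_V`). Hence the curvature annihilates `V`, and since `VΦ = -(1 - lam u)` also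
`∇²Φ(·, V) = lam g(·, V)`. This gives `P(·, V) = 0`.

In spatial directions, `∇_{e_a} e_b` is the derivative in the slice plus a multiple of `V`. As `V`
is parallel and orthogonal to `e`, this multiple does not affect the spatial curvature, and the
ambient Ricci form restricts to that of the slice. The multiple is governed by `g(∇_{e_a} e_b, T) =
-(1/2) (L_T g)(e_a, e_b)`, which the flow equation turns into `Ric + ∇²φ - lam g`; so `∇²Φ(e_a, e_b)
= lam g - Ric`, and `P(e_a, e_b) = 0`. Writing `g(T, T) = -ρ`, the flow equation for `φ` reduces `F`
to `R_φ - ρ`: the coefficient of `du²` is the one for which `F` vanishes (`wF_eq_zero`).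

The components `P(e_a, T)` and `P(T, T)` are not computed from the curvature. The weighted
contracted Bianchi identity (`weighted_bianchi`) equates `2 (div P - P(·, ∇Φ))` with the
differential of `R + 2ΔΦ - |∇Φ|² + 2 lam Φ`. The components already known give `tr P = 0`, and with
`F = 0` this function is constant. The divergence at `Z` vanishes as well, because `∇_V P = 0` and
the other terms involve only known components. Since `∇Φ` has `T`-component `1`, what remains is
`P(Z, T) = 0`, for `Z` in `ker du` and then for `Z = T` (`wPForm_eq_zero`).

All of this is algebra over a Lie–Rinehart pair: a ring of functions and a module of fields with a
bracket. It is applied to the smooth functions and fields on an open subset of `M × ℝ`. The link to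
pointwise frame formulas is evaluation at points, together with independence of the frame; the link
between slices and ambient space is that horizontal lifts preserve derivatives, brackets and the
spatial form (`LiftsForm`, `exists_isAmbient`). -/

open scoped Manifold ContDiff Topology
open VectorField

noncomputable section

namespace RicciAmbient

/-! ### Levi-Civita connection and curvature identities over a Lie–Rinehart algebra. -/

section Algebra

set_option linter.unusedSectionVars false

variable {A L : Type*} [CommRing A] [LieRing L] [Module A L] [LieRingModule L A]
  [LieRinehartRing A L]

@[simp] lemma lie_one_coeff (X : L) : ⁅X, (1 : A)⁆ = 0 := by
  have h := LieRinehartRing.leibniz_mul_right X (1 : A) 1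
  simpa using h

lemma lie_mul_coeff (X : L) (a b : A) : ⁅X, a * b⁆ = a * ⁅X, b⁆ + ⁅X, a⁆ * b := by
  simp

lemma lie_sum_coeff {κ : Type*} (s : Finset κ) (X : L) (a : κ → A) :
    ⁅X, ∑ i ∈ s, a i⁆ = ∑ i ∈ s, ⁅X, a i⁆ := by
  classical
  induction s using Finset.induction_on with
  | empty => simp
  | insert i s hi ih => rw [Finset.sum_insert hi, Finset.sum_insert hi, lie_add, ih]

lemma sum_lie_coeff {κ : Type*} (s : Finset κ) (X : κ → L) (a : A) :
    ⁅∑ i ∈ s, X i, a⁆ = ∑ i ∈ s, ⁅X i, a⁆ := by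
  classical
  induction s using Finset.induction_on with
  | empty => simp
  | insert i s hi ih => rw [Finset.sum_insert hi, Finset.sum_insert hi, add_lie, ih]

lemma smul_lie_field (a : A) (X Y : L) : ⁅a • X, Y⁆ = a • ⁅X, Y⁆ - ⁅Y, a⁆ • X := by
  rw [← lie_skew, LieRinehartRing.leibniz_smul_right, ← lie_skew X Y]
  simp only [smul_neg]; abel

variable [Invertible (2 : A)]

/-- The right-hand side of the Koszul formula in a Lie–Rinehart algebra. -/
def koszulForm (g : LinearMap.BilinForm A L) (X Y Z : L) : A :=
  ⅟2 * (⁅X, g Y Z⁆ + ⁅Y, g X Z⁆ - ⁅Z, g X Y⁆ + g ⁅X, Y⁆ Z - g ⁅X, Z⁆ Y - g ⁅Y, Z⁆ X)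

lemma eq_of_two_mul_eq {a b : A} (h : 2 * a = 2 * b) : a = b := by
  have := congrArg (⅟(2 : A) * ·) h
  simpa using this

lemma two_mul_koszulForm (g : LinearMap.BilinForm A L) (X Y Z : L) :
    2 * koszulForm g X Y Z =
      ⁅X, g Y Z⁆ + ⁅Y, g X Z⁆ - ⁅Z, g X Y⁆ + g ⁅X, Y⁆ Z - g ⁅X, Z⁆ Y - g ⁅Y, Z⁆ X := by
  simp [koszulForm]

lemma koszulForm_add_right (g : LinearMap.BilinForm A L) (X Y Z W : L) :
    koszulForm g X Y (Z + W) = koszulForm g X Y Z + koszulForm g X Y W := by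
  simp only [koszulForm, map_add, lie_add, add_lie, LinearMap.add_apply]; ring

lemma koszulForm_smul_right (g : LinearMap.BilinForm A L) (hg : ∀ X Y, g X Y = g Y X) (a : A)
    (X Y Z : L) : koszulForm g X Y (a • Z) = a * koszulForm g X Y Z := by
  simp only [koszulForm, map_smul, map_add, smul_eq_mul, lie_mul_coeff, LinearMap.add_apply,
    LieRinehartRing.leibniz_smul_right, LieRinehartRing.lie_smul_eq_mul, LinearMap.smul_apply,
    hg Z X, hg Z Y]
  ring

lemma koszulForm_smul_left (g : LinearMap.BilinForm A L) (a : A)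
    (X Y Z : L) : koszulForm g (a • X) Y Z = a * koszulForm g X Y Z := by
  simp only [koszulForm, map_smul, map_sub, smul_eq_mul, lie_mul_coeff, LinearMap.sub_apply,
    smul_lie_field, LieRinehartRing.lie_smul_eq_mul, LinearMap.smul_apply]
  ring

lemma koszulForm_add_left (g : LinearMap.BilinForm A L) (X X' Y Z : L) :
    koszulForm g (X + X') Y Z = koszulForm g X Y Z + koszulForm g X' Y Z := by
  simp only [koszulForm, map_add, lie_add, add_lie, LinearMap.add_apply]; ring

/-- `nab` is the Levi-Civita connection of the non-degenerate symmetric form `g`. -/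
structure IsLeviCivita (g : LinearMap.BilinForm A L) (nab : L → L → L) : Prop where
  symm : ∀ X Y, g X Y = g Y X
  ext : ∀ X Y, (∀ Z, g X Z = g Y Z) → X = Y
  koszul : ∀ X Y Z, g (nab X Y) Z = koszulForm g X Y Z

namespace IsLeviCivita

variable {g : LinearMap.BilinForm A L} {nab : L → L → L} (h : IsLeviCivita g nab)
include h

lemma torsion (X Y : L) : nab X Y - nab Y X = ⁅X, Y⁆ := by
  refine h.ext _ _ fun Z => eq_of_two_mul_eq ?_
  simp only [map_sub, LinearMap.sub_apply, h.koszul, mul_sub, two_mul_koszulForm, h.symm Y X]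
  rw [← lie_skew X Y]
  simp only [map_neg, LinearMap.neg_apply]; ring

lemma metric (X Y Z : L) : ⁅X, g Y Z⁆ = g (nab X Y) Z + g Y (nab X Z) := by
  refine eq_of_two_mul_eq ?_
  rw [h.symm Y (nab X Z), h.koszul, h.koszul, mul_add, two_mul_koszulForm, two_mul_koszulForm,
    h.symm Z Y, ← lie_skew Y Z]
  simp only [map_neg, LinearMap.neg_apply]; ring

lemma add_left (X X' Y : L) : nab (X + X') Y = nab X Y + nab X' Y :=
  h.ext _ _ fun Z => by simp only [map_add, LinearMap.add_apply, h.koszul, koszulForm_add_left]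

lemma smul_left (a : A) (X Y : L) : nab (a • X) Y = a • nab X Y :=
  h.ext _ _ fun Z => by
    simp only [map_smul, LinearMap.smul_apply, h.koszul, koszulForm_smul_left, smul_eq_mul]

/-- Torsion-freeness transports additivity, and below the Leibniz rule, from the first slot to the
second, where the Koszul expression need not be expanded again. -/
lemma add_right (X Y Y' : L) : nab X (Y + Y') = nab X Y + nab X Y' := by
  have h1 := h.torsion X (Y + Y')
  rw [h.add_left, lie_add, ← h.torsion, ← h.torsion] at h1
  rw [← sub_eq_zero] at h1 ⊢
  rw [← h1]; abel

lemma smul_right (a : A) (X Y : L) : nab X (a • Y) = a • nab X Y + ⁅X, a⁆ • Y := by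
  have h1 := h.torsion X (a • Y)
  rw [h.smul_left, LieRinehartRing.leibniz_smul_right, ← h.torsion, smul_sub] at h1
  rw [← sub_eq_zero] at h1 ⊢
  rw [← h1]; abel

lemma zero_right (X : L) : nab X 0 = 0 := by
  simpa using h.smul_right (0 : A) X 0

lemma zero_left (X : L) : nab 0 X = 0 := by
  simpa using h.smul_left (0 : A) 0 X

lemma neg_right (X Y : L) : nab X (-Y) = -nab X Y := by
  have := h.add_right X Y (-Y)
  rw [add_neg_cancel, h.zero_right] at this
  exact (neg_eq_of_add_eq_zero_right this.symm).symm

lemma neg_left (X Y : L) : nab (-X) Y = -nab X Y := by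
  have := h.add_left X (-X) Y
  rw [add_neg_cancel, h.zero_left] at this
  exact (neg_eq_of_add_eq_zero_right this.symm).symm

lemma sub_right (X Y Z : L) : nab X (Y - Z) = nab X Y - nab X Z := by
  rw [sub_eq_add_neg, h.add_right, h.neg_right, sub_eq_add_neg]

lemma sub_left (X Y Z : L) : nab (X - Y) Z = nab X Z - nab Y Z := by
  rw [sub_eq_add_neg, h.add_left, h.neg_left, sub_eq_add_neg]

lemma sum_right {κ : Type*} (s : Finset κ) (X : L) (Y : κ → L) :
    nab X (∑ i ∈ s, Y i) = ∑ i ∈ s, nab X (Y i) := by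
  classical
  induction s using Finset.induction_on with
  | empty => simp [h.zero_right]
  | insert i s hi ih => rw [Finset.sum_insert hi, Finset.sum_insert hi, h.add_right, ih]

lemma sum_left {κ : Type*} (s : Finset κ) (X : κ → L) (Y : L) :
    nab (∑ i ∈ s, X i) Y = ∑ i ∈ s, nab (X i) Y := by
  classical
  induction s using Finset.induction_on with
  | empty => simp [h.zero_left]
  | insert i s hi ih => rw [Finset.sum_insert hi, Finset.sum_insert hi, h.add_left, ih]

end IsLeviCivita

/-- The curvature `R(X, Y) Z` of a connection. -/
def curv (nab : L → L → L) (X Y Z : L) : L :=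
  nab X (nab Y Z) - nab Y (nab X Z) - nab ⁅X, Y⁆ Z

/-- The covariant derivative of the curvature. -/
def nabCurv (nab : L → L → L) (X Y Z W : L) : L :=
  nab X (curv nab Y Z W) - curv nab (nab X Y) Z W - curv nab Y (nab X Z) W
    - curv nab Y Z (nab X W)

namespace IsLeviCivita

variable {g : LinearMap.BilinForm A L} {nab : L → L → L} (h : IsLeviCivita g nab)
include h

lemma curv_skew (X Y Z : L) : curv nab X Y Z = -curv nab Y X Z := by
  unfold curv
  rw [← lie_skew X Y, h.neg_left]; abel

lemma curv_add_right (X Y Z W : L) :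
    curv nab X Y (Z + W) = curv nab X Y Z + curv nab X Y W := by
  simp only [curv, h.add_right]; abel

lemma curv_add_left (X X' Y Z : L) :
    curv nab (X + X') Y Z = curv nab X Y Z + curv nab X' Y Z := by
  simp only [curv, h.add_right, h.add_left, add_lie]; abel

lemma curv_add_mid (X Y Y' Z : L) :
    curv nab X (Y + Y') Z = curv nab X Y Z + curv nab X Y' Z := by
  simp only [curv, h.add_right, h.add_left, lie_add]; abel

lemma curv_smul_left (a : A) (X Y Z : L) : curv nab (a • X) Y Z = a • curv nab X Y Z := by
  simp only [curv, h.smul_right, h.smul_left, smul_lie_field, h.sub_left, smul_sub]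
  abel

lemma curv_smul_mid (a : A) (X Y Z : L) : curv nab X (a • Y) Z = a • curv nab X Y Z := by
  rw [h.curv_skew, h.curv_smul_left, h.curv_skew X Y, smul_neg]

lemma curv_smul_right (a : A) (X Y Z : L) : curv nab X Y (a • Z) = a • curv nab X Y Z := by
  simp only [curv, h.smul_right, h.add_right, lie_lie, smul_sub, sub_smul]
  abel

lemma curv_zero_left (X Y : L) : curv nab 0 X Y = 0 := by
  simpa using h.curv_smul_left (0 : A) 0 X Y

/-- This is the Jacobi identity with every bracket but those inside `∇_{[X, Y]}` written as a
difference of covariant derivatives. -/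
lemma bianchi_first (X Y Z : L) : curv nab X Y Z + curv nab Y Z X + curv nab Z X Y = 0 := by
  have j : ⁅X, ⁅Y, Z⁆⁆ + ⁅Y, ⁅Z, X⁆⁆ + ⁅Z, ⁅X, Y⁆⁆ = 0 := lie_jacobi X Y Z
  rw [← h.torsion X ⁅Y, Z⁆, ← h.torsion Y ⁅Z, X⁆, ← h.torsion Z ⁅X, Y⁆] at j
  nth_rw 1 [← h.torsion Y Z] at j
  nth_rw 1 [← h.torsion Z X] at j
  nth_rw 1 [← h.torsion X Y] at j
  simp only [h.sub_right] at j
  rw [← j]; unfold curv; abel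

/-- Metric compatibility turns the commutator action of `[X, Y]` on the function `g(Z, W)` into the
skew-symmetry. -/
lemma curv_skew_right (X Y Z W : L) : g (curv nab X Y Z) W = -g (curv nab X Y W) Z := by
  have h1 : ⁅⁅X, Y⁆, g Z W⁆ = ⁅X, ⁅Y, g Z W⁆⁆ - ⁅Y, ⁅X, g Z W⁆⁆ := lie_lie _ _ _
  simp only [h.metric, lie_add] at h1
  simp only [curv, map_sub, LinearMap.sub_apply]
  simp only [h.symm Z] at h1 ⊢
  linear_combination (-1 : A) * h1

/-- A signed sum of the first Bianchi identity for the four cyclic arrangements of the arguments: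
all terms but twice the claimed one cancel by the two skew-symmetries. -/
lemma curv_pair_symm (X Y Z W : L) : g (curv nab X Y Z) W = g (curv nab Z W X) Y := by
  have b (X Y Z W : L) :
      g (curv nab X Y Z) W + g (curv nab Y Z X) W + g (curv nab Z X Y) W = 0 := by
    rw [← LinearMap.add_apply, ← LinearMap.add_apply, ← map_add, ← map_add, h.bianchi_first]
    simp
  have s (X Y Z W : L) : g (curv nab X Y Z) W = -g (curv nab Y X Z) W := by
    rw [h.curv_skew]; simp
  have t := h.curv_skew_right
  apply eq_of_two_mul_eq
  have b1 := b X Y Z W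
  have b2 := b Y Z W X
  have b3 := b Z W X Y
  have b4 := b W X Y Z
  rw [t Y Z W X, t Z W Y X, s W Y Z X, t Y W Z X] at b2
  rw [t W X Z Y, s X Z W Y, t Z X W Y] at b3
  rw [t X Y W Z] at b4
  linear_combination b1 + b2 - b3 - b4

/-- In the cyclic sum the terms with `∇_X Y` and `∇_Y X` combine to curvatures at brackets. Once
those are expanded, only the connection along the Jacobi sum is left. -/
lemma bianchi_second (X Y Z W : L) :
    nabCurv nab X Y Z W + nabCurv nab Y Z X W + nabCurv nab Z X Y W = 0 := by
  have j : ⁅X, ⁅Y, Z⁆⁆ + ⁅Y, ⁅Z, X⁆⁆ + ⁅Z, ⁅X, Y⁆⁆ = 0 := lie_jacobi X Y Z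
  have j' : nab ⁅X, ⁅Y, Z⁆⁆ W + nab ⁅Y, ⁅Z, X⁆⁆ W + nab ⁅Z, ⁅X, Y⁆⁆ W = 0 := by
    rw [← h.add_left, ← h.add_left, j, h.zero_left]
  have t (X Y Z : L) : curv nab (nab X Y) Z W - curv nab (nab Y X) Z W = curv nab ⁅X, Y⁆ Z W := by
    rw [← h.torsion, sub_eq_add_neg (nab X Y), h.curv_add_left, ← sub_eq_zero,
      ← neg_one_smul A, h.curv_smul_left]
    simp only [neg_smul, one_smul]; abel
  have e : nabCurv nab X Y Z W + nabCurv nab Y Z X W + nabCurv nab Z X Y W =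
      (nab X (curv nab Y Z W) + nab Y (curv nab Z X W) + nab Z (curv nab X Y W))
      - (curv nab Y Z (nab X W) + curv nab Z X (nab Y W) + curv nab X Y (nab Z W))
      - (curv nab ⁅X, Y⁆ Z W + curv nab ⁅Y, Z⁆ X W + curv nab ⁅Z, X⁆ Y W) := by
    rw [← t X Y Z, ← t Y Z X, ← t Z X Y]
    unfold nabCurv
    rw [h.curv_skew Y (nab X Z), h.curv_skew Z (nab Y X), h.curv_skew X (nab Z Y)]
    abel
  rw [e]
  have l (X Y Z : L) : nab ⁅⁅X, Y⁆, Z⁆ W = -nab ⁅Z, ⁅X, Y⁆⁆ W := by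
    rw [← lie_skew, h.neg_left]
  simp only [curv, h.sub_right, l]
  refine Eq.trans ?_ (neg_eq_zero.mpr j')
  abel

lemma nabCurv_skew_right (X Y Z W U : L) :
    g (nabCurv nab X Y Z W) U = -g (nabCurv nab X Y Z U) W := by
  have h1 := h.metric X (curv nab Y Z W) U
  have h2 := h.metric X (curv nab Y Z U) W
  have h3 := h.curv_skew_right Y Z W U
  have h4 := congrArg (fun a : A => ⁅X, a⁆) h3
  simp only [lie_neg] at h4
  simp only [nabCurv, map_sub, LinearMap.sub_apply]
  have e1 := h.curv_skew_right (nab X Y) Z W U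
  have e2 := h.curv_skew_right Y (nab X Z) W U
  have e3 := h.curv_skew_right Y Z (nab X W) U
  have e4 := h.curv_skew_right Y Z W (nab X U)
  linear_combination -h1 - h2 + h4 - e1 - e2 - e3 - e4

lemma nabCurv_skew (X Y Z W : L) : nabCurv nab X Y Z W = -nabCurv nab X Z Y W := by
  unfold nabCurv
  rw [h.curv_skew Y Z W, h.curv_skew (nab X Y) Z, h.curv_skew Y (nab X Z), h.curv_skew Y Z,
    h.neg_right]
  abel

end IsLeviCivita

end Algebra

/-! ### Traces, Ricci and Hessian forms, and the weighted contracted Bianchi identity. -/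

section Traces

set_option linter.unusedSectionVars false

variable {A L : Type*} [CommRing A] [LieRing L] [Module A L] [LieRingModule L A]
  [LieRinehartRing A L] [Invertible (2 : A)] {ι : Type*} [Fintype ι] [DecidableEq ι]

/-- `e` and `f` are frames of `L` that are dual to each other with respect to `g`. -/
structure IsDualFrames (g : LinearMap.BilinForm A L) (e f : ι → L) : Prop where
  symm : ∀ X Y, g X Y = g Y X
  left : ∀ X, ∑ a, g X (f a) • e a = X
  right : ∀ X, ∑ a, g X (e a) • f a = X
  dual : ∀ a b, g (e a) (f b) = if a = b then 1 else 0

/-- The trace of a bilinear form in a pair of dual frames. -/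
def trForm (e f : ι → L) (B : LinearMap.BilinForm A L) : A := ∑ a, B (e a) (f a)

/-- The Levi-Civita connection, in a pair of dual frames. -/
def leviCivita (g : LinearMap.BilinForm A L) (e f : ι → L) (X Y : L) : L :=
  ∑ a, koszulForm g X Y (e a) • f a

/-- The gradient of a function, in a pair of dual frames. -/
def gradField (e f : ι → L) (φ : A) : L := ∑ a, ⁅e a, φ⁆ • f a

/-- The covariant derivative of a bilinear form. -/
def nabForm (nab : L → L → L) (B : LinearMap.BilinForm A L) (X Y Z : L) : A :=
  ⁅X, B Y Z⁆ - B (nab X Y) Z - B Y (nab X Z)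

namespace IsDualFrames

variable {g : LinearMap.BilinForm A L} {e f : ι → L} (F : IsDualFrames g e f)
include F

lemma swap : IsDualFrames g f e where
  symm := F.symm
  left := F.right
  right := F.left
  dual a b := by rw [F.symm, F.dual]; simp [eq_comm]

/-- Both traces equal the double sum of `g(e_a, f'_j) B(e'_j, f_a)`. The two index types may differ,
so any adapted frame can replace a given one. -/
lemma trForm_eq {κ : Type*} [Fintype κ] [DecidableEq κ] {e' f' : κ → L}
    (F' : IsDualFrames g e' f') (B : LinearMap.BilinForm A L) :
    trForm e f B = trForm e' f' B := by
  have h1 (a : ι) : B (e a) (f a) = ∑ j, g (e a) (f' j) * B (e' j) (f a) := by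
    conv_lhs => rw [← F'.left (e a)]
    simp
  have h2 (j : κ) : B (e' j) (f' j) = ∑ a, g (e a) (f' j) * B (e' j) (f a) := by
    conv_lhs => rw [← F.right (f' j)]
    simp [F.symm (f' j)]
  simp only [trForm, h1, h2]
  exact Finset.sum_comm

lemma isLeviCivita : IsLeviCivita g (leviCivita g e f) where
  symm := F.symm
  ext X Y h := by rw [← F.left X, ← F.left Y]; simp only [h]
  koszul X Y Z := by
    have hs (s : Finset ι) (c : ι → A) (W : ι → L) :
        koszulForm g X Y (∑ a ∈ s, c a • W a) = ∑ a ∈ s, c a * koszulForm g X Y (W a) := by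
      classical
      induction s using Finset.induction_on with
      | empty => simpa using koszulForm_smul_right g F.symm 0 X Y 0
      | insert i s hi ih =>
        rw [Finset.sum_insert hi, Finset.sum_insert hi, koszulForm_add_right, ih,
          koszulForm_smul_right g F.symm]
    conv_rhs => rw [← F.left Z]
    rw [hs]
    simp [leviCivita, F.symm (f _), mul_comm]

lemma g_gradField (φ : A) (Z : L) : g (gradField e f φ) Z = ⁅Z, φ⁆ := by
  conv_rhs => rw [← F.left Z]
  rw [sum_lie_coeff]
  simp [gradField, F.symm (f _), mul_comm]

lemma trForm_metric : trForm e f g = Fintype.card ι := by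
  simp [trForm, F.dual]

end IsDualFrames

namespace IsLeviCivita

variable {g : LinearMap.BilinForm A L} {nab : L → L → L} (h : IsLeviCivita g nab)

/-- The bilinear form `(X, W) ↦ g(R(X, Y) Z, W)`. -/
def curvForm (Y Z : L) : LinearMap.BilinForm A L :=
  LinearMap.mk₂ A (fun X W => g (curv nab X Y Z) W)
    (fun X X' W => by simp [h.curv_add_left]) (fun a X W => by simp [h.curv_smul_left])
    (fun X W W' => by simp) (fun a X W => by simp)

@[simp] lemma curvForm_apply (X Y Z W : L) : h.curvForm Y Z X W = g (curv nab X Y Z) W := rfl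

/-- The Ricci form, in a pair of dual frames. -/
def ricci (e f : ι → L) : LinearMap.BilinForm A L :=
  LinearMap.mk₂ A (fun Y Z => trForm e f (h.curvForm Y Z))
    (fun Y Y' Z => by simp [trForm, h.curv_add_mid, Finset.sum_add_distrib])
    (fun a Y Z => by simp [trForm, h.curv_smul_mid, Finset.mul_sum])
    (fun Y Z Z' => by simp [trForm, h.curv_add_right, Finset.sum_add_distrib])
    (fun a Y Z => by simp [trForm, h.curv_smul_right, Finset.mul_sum])

lemma ricci_apply (e f : ι → L) (Y Z : L) :
    h.ricci e f Y Z = trForm e f (h.curvForm Y Z) := rfl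

/-- The Hessian of a function. -/
def hessian (φ : A) : LinearMap.BilinForm A L :=
  LinearMap.mk₂ A (fun X Y => ⁅X, ⁅Y, φ⁆⁆ - ⁅nab X Y, φ⁆)
    (fun X X' Y => by simp only [h.add_left, add_lie]; ring)
    (fun a X Y => by
      simp only [h.smul_left, LieRinehartRing.lie_smul_eq_mul, smul_eq_mul]; ring)
    (fun X Y Y' => by simp only [h.add_right, add_lie, lie_add]; ring)
    (fun a X Y => by
      simp only [h.smul_right, add_lie, LieRinehartRing.lie_smul_eq_mul, smul_eq_mul,
        lie_mul_coeff]; ring)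

lemma hessian_apply (φ : A) (X Y : L) : h.hessian φ X Y = ⁅X, ⁅Y, φ⁆⁆ - ⁅nab X Y, φ⁆ := rfl

lemma hessian_symm (φ : A) (X Y : L) : h.hessian φ X Y = h.hessian φ Y X := by
  have h1 : ⁅⁅X, Y⁆, φ⁆ = ⁅X, ⁅Y, φ⁆⁆ - ⁅Y, ⁅X, φ⁆⁆ := lie_lie _ _ _
  rw [← h.torsion, sub_lie] at h1
  rw [hessian_apply, hessian_apply]
  linear_combination -h1

lemma hessian_eq {φ : A} {V : L} (hV : ∀ Z, g V Z = ⁅Z, φ⁆) (X Y : L) :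
    h.hessian φ X Y = g (nab X V) Y := by
  rw [hessian_apply, ← hV, ← hV, h.metric]; ring

/-- The commutation formula for third covariant derivatives. -/
lemma nabForm_hessian_sub {φ : A} {V : L} (hV : ∀ Z, g V Z = ⁅Z, φ⁆) (X Y Z : L) :
    nabForm nab (h.hessian φ) X Y Z - nabForm nab (h.hessian φ) Y X Z =
      g (curv nab X Y V) Z := by
  have t : g (nab ⁅X, Y⁆ V) Z = g (nab (nab X Y) V) Z - g (nab (nab Y X) V) Z := by
    rw [← h.torsion, h.sub_left, map_sub, LinearMap.sub_apply]
  simp only [nabForm, h.hessian_eq hV, h.metric, curv, map_sub, LinearMap.sub_apply, t]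
  ring

/-- The form `P = Ric + ∇²φ - lam g`. -/
def wPForm (e f : ι → L) (φ lam : A) : LinearMap.BilinForm A L :=
  h.ricci e f + h.hessian φ - lam • g

lemma wPForm_apply (e f : ι → L) (φ lam : A) (X Y : L) : h.wPForm e f φ lam X Y =
    h.ricci e f X Y + h.hessian φ X Y - lam * g X Y := by
  simp [wPForm]

lemma nabForm_wPForm (e f : ι → L) (φ lam : A) (hlam : ∀ X : L, ⁅X, lam⁆ = 0) (X Y Z : L) :
    nabForm nab (h.wPForm e f φ lam) X Y Z =
      nabForm nab (h.ricci e f) X Y Z + nabForm nab (h.hessian φ) X Y Z := by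
  simp only [nabForm, wPForm_apply, lie_sub, lie_add, lie_mul_coeff, hlam, h.metric]
  ring

section Frames

variable {e f : ι → L} (F : IsDualFrames g e f)
include h F

lemma ricci_symm (Y Z : L) : h.ricci e f Y Z = h.ricci e f Z Y := by
  rw [ricci_apply, F.trForm_eq F.swap, ricci_apply]
  refine Finset.sum_congr rfl fun a _ => ?_
  simp only [curvForm_apply]
  rw [h.curv_pair_symm, h.curv_skew, map_neg, LinearMap.neg_apply, h.curv_skew_right, neg_neg]

/-- The inverse metric `∑ e_a ⊗ f_a` is parallel, because the pairings `g(e_b, f_a)` are constant.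
This is what lets traces commute with covariant derivatives. -/
lemma sum_nab_eq_zero (B : LinearMap.BilinForm A L) (X : L) :
    ∑ a, (B (nab X (e a)) (f a) + B (e a) (nab X (f a))) = 0 := by
  have h1 (a : ι) : B (nab X (e a)) (f a) = ∑ b, g (nab X (e a)) (f b) * B (e b) (f a) := by
    conv_lhs => rw [← F.left (nab X (e a))]
    simp
  have h2 (a : ι) : B (e a) (nab X (f a)) = ∑ b, g (nab X (f a)) (e b) * B (e a) (f b) := by
    conv_lhs => rw [← F.right (nab X (f a))]
    simp
  rw [Finset.sum_add_distrib]
  simp only [h1, h2]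
  rw [Finset.sum_comm, ← Finset.sum_add_distrib]
  refine Finset.sum_eq_zero fun a _ => ?_
  rw [← Finset.sum_add_distrib]
  refine Finset.sum_eq_zero fun b _ => ?_
  have h3 := h.metric X (e b) (f a)
  rw [F.dual] at h3
  have h4 : ⁅X, (if b = a then (1 : A) else 0)⁆ = 0 := by split_ifs <;> simp
  rw [h4, h.symm (e b)] at h3
  rw [← add_mul, ← h3, zero_mul]

lemma trForm_nabForm (B : LinearMap.BilinForm A L) (X : L) :
    ∑ a, nabForm nab B X (e a) (f a) = ⁅X, trForm e f B⁆ := by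
  have h1 := h.sum_nab_eq_zero F B X
  simp only [nabForm, trForm, lie_sum_coeff, Finset.sum_sub_distrib, Finset.sum_add_distrib] at *
  linear_combination -h1

/-- The covariant derivative of the Ricci form is the trace of that of the curvature. -/
lemma sum_nabCurv (X Y Z : L) :
    ∑ a, g (nabCurv nab X (e a) Y Z) (f a) = nabForm nab (h.ricci e f) X Y Z := by
  have h1 := h.sum_nab_eq_zero F (h.curvForm Y Z) X
  have h2 (a : ι) : g (nab X (curv nab (e a) Y Z)) (f a) =
      ⁅X, g (curv nab (e a) Y Z) (f a)⁆ - g (curv nab (e a) Y Z) (nab X (f a)) := by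
    rw [h.metric]; ring
  simp only [nabCurv, nabForm, map_sub, LinearMap.sub_apply, h2, ricci_apply, trForm,
    lie_sum_coeff, Finset.sum_sub_distrib, Finset.sum_add_distrib, curvForm_apply] at *
  linear_combination -h1

/-- The divergence of the Ricci form is half the differential of the scalar curvature. -/
theorem two_mul_div_ricci (Z : L) :
    2 * ∑ a, nabForm nab (h.ricci e f) (e a) Z (f a) = ⁅Z, trForm e f (h.ricci e f)⁆ := by
  have b (a b : ι) : g (nabCurv nab (e a) (e b) Z (f b)) (f a)
      + g (nabCurv nab (e b) Z (e a) (f b)) (f a)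
      + g (nabCurv nab Z (e a) (e b) (f b)) (f a) = 0 := by
    rw [← LinearMap.add_apply, ← LinearMap.add_apply, ← map_add, ← map_add, h.bianchi_second]
    simp
  have s : ∑ a, ∑ b, (g (nabCurv nab (e a) (e b) Z (f b)) (f a)
      + g (nabCurv nab (e b) Z (e a) (f b)) (f a)
      + g (nabCurv nab Z (e a) (e b) (f b)) (f a)) = 0 :=
    Finset.sum_eq_zero fun a _ => Finset.sum_eq_zero fun c _ => b a c
  -- The double trace of the second Bianchi identity: two of its three sums are minus the divergence
  -- of the Ricci form, the third is the differential of the scalar curvature.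
  simp only [Finset.sum_add_distrib] at s
  have s1 : ∑ a, ∑ b, g (nabCurv nab (e a) (e b) Z (f b)) (f a) =
      -∑ a, nabForm nab (h.ricci e f) (e a) Z (f a) := by
    rw [← Finset.sum_neg_distrib]
    refine Finset.sum_congr rfl fun a _ => ?_
    rw [← h.sum_nabCurv F, ← Finset.sum_neg_distrib]
    exact Finset.sum_congr rfl fun b _ => h.nabCurv_skew_right _ _ _ _ _
  have s2 : ∑ a, ∑ b, g (nabCurv nab (e b) Z (e a) (f b)) (f a) =
      -∑ a, nabForm nab (h.ricci e f) (e a) Z (f a) := by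
    rw [Finset.sum_comm, ← Finset.sum_neg_distrib]
    refine Finset.sum_congr rfl fun a _ => ?_
    rw [← h.sum_nabCurv F, ← Finset.sum_neg_distrib]
    refine Finset.sum_congr rfl fun b _ => ?_
    rw [h.nabCurv_skew]; simp
  have s3 : ∑ a, ∑ b, g (nabCurv nab Z (e a) (e b) (f b)) (f a) =
      ⁅Z, trForm e f (h.ricci e f)⁆ := by
    rw [Finset.sum_comm, ← h.trForm_nabForm F]
    exact Finset.sum_congr rfl fun b _ => h.sum_nabCurv F _ _ _
  rw [s1, s2, s3] at s
  linear_combination -s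

/-- `div ∇²φ = dΔφ + Ric(∇φ, ·)`. -/
theorem div_hessian (φ : A) (Z : L) :
    ∑ a, nabForm nab (h.hessian φ) (e a) Z (f a) =
      ⁅Z, trForm e f (h.hessian φ)⁆ + h.ricci e f Z (gradField e f φ) := by
  rw [← h.trForm_nabForm F, ricci_apply, trForm, ← Finset.sum_add_distrib]
  refine Finset.sum_congr rfl fun a _ => ?_
  rw [curvForm_apply, ← h.nabForm_hessian_sub (F.g_gradField φ)]
  ring

/-- The weighted contracted Bianchi identity. -/
theorem weighted_bianchi (φ lam : A) (hlam : ∀ X : L, ⁅X, lam⁆ = 0) (Z : L) :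
    2 * (∑ a, nabForm nab (h.wPForm e f φ lam) (e a) Z (f a)
      - h.wPForm e f φ lam Z (gradField e f φ)) =
    ⁅Z, trForm e f (h.ricci e f) + 2 * trForm e f (h.hessian φ)
      - g (gradField e f φ) (gradField e f φ) + 2 * (lam * φ)⁆ := by
  have two : ⁅Z, (2 : A)⁆ = 0 := by
    rw [← one_add_one_eq_two, lie_add, lie_one_coeff, add_zero]
  -- The curvature term `Ric(Z, ∇φ)` of the divergence of `∇²φ` cancels that of `P(Z, ∇φ)`, whose
  -- Hessian term gives the differential of `|∇φ|²`.
  simp only [h.nabForm_wPForm e f φ lam hlam, Finset.sum_add_distrib, lie_sub, lie_add,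
    lie_mul_coeff, hlam, two,
    ← h.two_mul_div_ricci F Z, h.div_hessian F, wPForm_apply, h.metric Z,
    h.hessian_eq (F.g_gradField φ)]
  rw [h.symm (gradField e f φ) (nab Z _), h.symm Z, F.g_gradField]
  ring

end Frames

end IsLeviCivita

end Traces

/-! ### Geometric quantities in a frame compared with their invariant forms. -/

section FrameFormulas

set_option linter.unusedSectionVars false

variable {A L : Type*} [CommRing A] [LieRing L] [Module A L] [LieRingModule L A]
  [LieRinehartRing A L] [Invertible (2 : A)] {ι : Type*} [Fintype ι] [DecidableEq ι]

/-- The expansion in `e` reads off coefficients by duality; it also makes `g` non-degenerate, so the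
expansion in `f` can be tested by pairing. -/
lemma IsDualFrames.of_span {g : LinearMap.BilinForm A L} {e f : ι → L}
    (symm : ∀ X Y, g X Y = g Y X) (dual : ∀ a b, g (e a) (f b) = if a = b then 1 else 0)
    (span : ∀ X, X ∈ Submodule.span A (Set.range e)) : IsDualFrames g e f := by
  have left (X : L) : ∑ a, g X (f a) • e a = X := by
    obtain ⟨c, rfl⟩ := (Submodule.mem_span_range_iff_exists_fun A).1 (span X)
    simp [dual]
  refine ⟨symm, left, fun X => ?_, dual⟩
  have key (Z : L) : g (∑ a, g X (e a) • f a) Z = g X Z := by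
    conv_rhs => rw [← left Z]
    simp [symm (f _), mul_comm]
  rw [← left (∑ a, g X (e a) • f a)]
  simp only [key, left]

/-- `gi` is the inverse of the Gram matrix of `e`. -/
structure IsGramInv (g : LinearMap.BilinForm A L) (e : ι → L) (gi : Matrix ι ι A) : Prop where
  symm : ∀ a b, gi a b = gi b a
  mul : ∀ a b, ∑ c, g (e a) (e c) * gi c b = if a = b then 1 else 0

/-- The dual family of `e`. -/
def dualFamily (e : ι → L) (gi : Matrix ι ι A) (a : ι) : L := ∑ b, gi b a • e b

lemma g_dualFamily (g : LinearMap.BilinForm A L) (e : ι → L) (gi : Matrix ι ι A) (X : L) (a : ι) :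
    g X (dualFamily e gi a) = ∑ c, g X (e c) * gi c a := by
  simp [dualFamily, mul_comm]

lemma IsGramInv.isDualFrames {g : LinearMap.BilinForm A L} {e : ι → L} {gi : Matrix ι ι A}
    (hgi : IsGramInv g e gi) (symm : ∀ X Y, g X Y = g Y X)
    (span : ∀ X, X ∈ Submodule.span A (Set.range e)) : IsDualFrames g e (dualFamily e gi) :=
  .of_span symm (fun a b => by rw [g_dualFamily, hgi.mul]) span

/-! The geometric quantities of `g` in a frame `e` of a Lie–Rinehart algebra. -/

section Defs

variable (g : LinearMap.BilinForm A L) (gi : Matrix ι ι A) (e : ι → L)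

/-- The connection coefficients. -/
def frameConn (a b d : ι) : A := ∑ c, koszulForm g (e a) (e b) (e c) * gi c d

/-- The structure functions. -/
def frameStruct (a b d : ι) : A := ∑ c, g ⁅e a, e b⁆ (e c) * gi c d

/-- The components of the curvature. -/
def frameRiem (a b c d : ι) : A :=
  ⁅e a, frameConn g gi e b c d⁆ - ⁅e b, frameConn g gi e a c d⁆
    + ∑ k, (frameConn g gi e b c k * frameConn g gi e a k d
      - frameConn g gi e a c k * frameConn g gi e b k d
      - frameStruct g gi e a b k * frameConn g gi e k c d)

/-- The components of the Ricci form. -/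
def frameRic (b c : ι) : A := ∑ a, frameRiem g gi e a b c a

/-- The scalar curvature. -/
def frameScal : A := ∑ a, ∑ b, gi a b * frameRic g gi e a b

/-- The components of the Hessian. -/
def frameHess (φ : A) (a b : ι) : A :=
  ⁅e a, ⁅e b, φ⁆⁆ - ∑ c, frameConn g gi e a b c * ⁅e c, φ⁆

/-- The Laplacian. -/
def frameLap (φ : A) : A := ∑ a, ∑ b, gi a b * frameHess g gi e φ a b

/-- The squared norm of the gradient. -/
def frameGradSq (φ : A) : A := ∑ a, ∑ b, gi a b * ⁅e a, φ⁆ * ⁅e b, φ⁆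

end Defs

lemma IsGramInv.sum_eq_trForm {g : LinearMap.BilinForm A L} {gi : Matrix ι ι A} {e : ι → L}
    (hgi : IsGramInv g e gi) (B : LinearMap.BilinForm A L) :
    ∑ a, ∑ b, gi a b * B (e a) (e b) = trForm e (dualFamily e gi) B := by
  refine Finset.sum_congr rfl fun a _ => ?_
  rw [g_dualFamily]
  exact Finset.sum_congr rfl fun b _ => by rw [hgi.symm a b, mul_comm]

lemma IsDualFrames.frameGradSq_eq {g : LinearMap.BilinForm A L} {gi : Matrix ι ι A} {e : ι → L}
    (hF : IsDualFrames g e (dualFamily e gi)) (hgi : IsGramInv g e gi) (φ : A) :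
    frameGradSq gi e φ = g (gradField e (dualFamily e gi) φ) (gradField e (dualFamily e gi) φ) := by
  rw [hF.g_gradField, gradField, sum_lie_coeff]
  simp only [LieRinehartRing.lie_smul_eq_mul]
  refine Finset.sum_congr rfl fun a _ => ?_
  rw [dualFamily, sum_lie_coeff, Finset.mul_sum]
  refine Finset.sum_congr rfl fun b _ => ?_
  rw [LieRinehartRing.lie_smul_eq_mul, hgi.symm a b]; ring

variable {g : LinearMap.BilinForm A L} {nab : L → L → L} (h : IsLeviCivita g nab)
  {gi : Matrix ι ι A} {e : ι → L}

include h

lemma IsLeviCivita.frameConn_eq (a b d : ι) :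
    frameConn g gi e a b d = g (nab (e a) (e b)) (dualFamily e gi d) := by
  rw [g_dualFamily]
  simp only [frameConn, h.koszul]

/-- The components of the curvature in `e`, where `e` need only span up to fields `N a b` whose
derivatives are orthogonal to `e`. -/
lemma IsLeviCivita.frameRiem_eq (hgi : IsGramInv g e gi) (N : ι → ι → L)
    (hN : ∀ a b, nab (e a) (e b) = ∑ d, frameConn g gi e a b d • e d + N a b)
    (hN' : ∀ a b c d, g (nab (e c) (N a b)) (e d) = 0)
    (hB : ∀ a b, ⁅e a, e b⁆ = ∑ d, frameStruct g gi e a b d • e d) (a b c d : ι) :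
    frameRiem g gi e a b c d = g (curv nab (e a) (e b) (e c)) (dualFamily e gi d) := by
  have d1 (k : ι) : g (e k) (dualFamily e gi d) = if k = d then 1 else 0 := by
    rw [g_dualFamily, hgi.mul]
  -- The correction `N` drops out of the second derivatives. This makes the formula usable for a
  -- spatial frame inside the ambient space, where `N` is a multiple of the parallel null field.
  have d2 (a b c : ι) : g (nab (e c) (N a b)) (dualFamily e gi d) = 0 := by
    rw [g_dualFamily]; simp [hN']
  have key (a b c : ι) : g (nab (e a) (nab (e b) (e c))) (dualFamily e gi d) =
      ⁅e a, frameConn g gi e b c d⁆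
        + ∑ k, frameConn g gi e b c k * frameConn g gi e a k d := by
    rw [hN b c, h.add_right, h.sum_right]
    simp only [h.smul_right, map_add, map_sum, map_smul, LinearMap.add_apply, LinearMap.sum_apply,
      LinearMap.smul_apply, d1, d2, ← h.frameConn_eq, smul_eq_mul, Finset.sum_add_distrib]
    simp
    ring
  have key2 : g (nab ⁅e a, e b⁆ (e c)) (dualFamily e gi d) =
      ∑ k, frameStruct g gi e a b k * frameConn g gi e k c d := by
    rw [hB a b, h.sum_left]
    simp only [h.smul_left, map_sum, map_smul, LinearMap.sum_apply, LinearMap.smul_apply,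
      ← h.frameConn_eq, smul_eq_mul]
  simp only [curv, map_sub, LinearMap.sub_apply, key, key2, frameRiem, Finset.sum_sub_distrib]
  ring

section FullFrame

variable (hgi : IsGramInv g e gi) (hF : IsDualFrames g e (dualFamily e gi))
include hgi hF

lemma IsLeviCivita.nab_frame (a b : ι) :
    nab (e a) (e b) = ∑ d, frameConn g gi e a b d • e d := by
  conv_lhs => rw [← hF.left (nab (e a) (e b))]
  simp only [h.frameConn_eq]

lemma IsLeviCivita.frameRic_eq (b c : ι) :
    frameRic g gi e b c = h.ricci e (dualFamily e gi) (e b) (e c) := by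
  refine Finset.sum_congr rfl fun a _ => ?_
  refine h.frameRiem_eq hgi (fun _ _ => 0) (fun a b => ?_) (fun a b c d => ?_)
    (fun a b => ?_) _ _ _ _
  · rw [add_zero, h.nab_frame hgi hF]
  · simp [h.zero_right]
  · conv_lhs => rw [← hF.left ⁅e a, e b⁆]
    simp only [frameStruct, g_dualFamily]

lemma IsLeviCivita.frameHess_eq (φ : A) (a b : ι) :
    frameHess g gi e φ a b = h.hessian φ (e a) (e b) := by
  rw [h.hessian_apply, h.nab_frame hgi hF, sum_lie_coeff]
  simp [frameHess]

lemma IsLeviCivita.frameScal_eq :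
    frameScal g gi e = trForm e (dualFamily e gi) (h.ricci e (dualFamily e gi)) := by
  simp only [frameScal, h.frameRic_eq hgi hF, hgi.sum_eq_trForm]

lemma IsLeviCivita.frameLap_eq (φ : A) :
    frameLap g gi e φ = trForm e (dualFamily e gi) (h.hessian φ) := by
  simp only [frameLap, h.frameHess_eq hgi hF, hgi.sum_eq_trForm]

end FullFrame

end FrameFormulas

/-! ### Independence of the choice of frame. -/

section Independence

variable {A L : Type*} [CommRing A] [LieRing L] [Module A L] [LieRingModule L A]
  [LieRinehartRing A L] [Invertible (2 : A)] {ι : Type*} [Fintype ι] [DecidableEq ι]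
  {κ : Type*} [Fintype κ] [DecidableEq κ]

lemma IsLeviCivita.ricci_eq {g : LinearMap.BilinForm A L} {nab nab' : L → L → L}
    (h : IsLeviCivita g nab) (h' : IsLeviCivita g nab') {e f : ι → L} (F : IsDualFrames g e f)
    {e' f' : κ → L} (F' : IsDualFrames g e' f') : h.ricci e f = h'.ricci e' f' := by
  obtain rfl : nab = nab' := by
    funext X Y
    exact h.ext _ _ fun Z => by rw [h.koszul, h'.koszul]
  ext X Y
  exact F.trForm_eq F' _

lemma IsLeviCivita.hessian_eq_hessian {g : LinearMap.BilinForm A L} {nab nab' : L → L → L}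
    (h : IsLeviCivita g nab) (h' : IsLeviCivita g nab') (φ : A) : h.hessian φ = h'.hessian φ := by
  obtain rfl : nab = nab' := by
    funext X Y
    exact h.ext _ _ fun Z => by rw [h.koszul, h'.koszul]
  rfl

lemma IsDualFrames.gradField_eq {g : LinearMap.BilinForm A L} {e f : ι → L}
    (F : IsDualFrames g e f) {e' f' : κ → L} (F' : IsDualFrames g e' f') (φ : A) :
    gradField e f φ = gradField e' f' φ :=
  F.isLeviCivita.ext _ _ fun Z => by rw [F.g_gradField, F'.g_gradField]

end Independence

/-! ### The ambient equations in an adapted frame. -/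

section Ambient

set_option linter.unusedSectionVars false

variable {A L : Type*} [CommRing A] [LieRing L] [Module A L] [LieRingModule L A]
  [LieRinehartRing A L] [Invertible (2 : A)] {ι : Type*} [Fintype ι] [DecidableEq ι]

/-- The frame of the ambient space obtained from a spatial frame `e` by adding `T` and `V`. -/
def ambientFrame (e : ι → L) (T V : L) : ι ⊕ Fin 2 → L := Sum.elim e ![T, V]

/-- An ambient metric of a gradient Ricci flow, in an adapted frame. The potential of the flow
is `φ`, the weighted scalar curvature `ρ`, and `wi` is the inverse of `1 - lam u`. -/
structure IsAmbient (g : LinearMap.BilinForm A L) (e : ι → L) (gi : Matrix ι ι A) (T V : L)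
    (u v φ ρ lam wi : A) : Prop where
  symm : ∀ X Y, g X Y = g Y X
  gram : IsGramInv g e gi
  span : ∀ X, X ∈ Submodule.span A (Set.range (ambientFrame e T V))
  e_T : ∀ a, g (e a) T = 0
  T_T : g T T = -ρ
  closed : ∀ Z, g V Z = ⁅Z, u⁆
  e_u : ∀ a, ⁅e a, u⁆ = 0
  T_u : ⁅T, u⁆ = -(1 - lam * u)
  V_u : ⁅V, u⁆ = 0
  wi_mul : wi * (1 - lam * u) = 1
  const : ∀ X : L, ⁅X, lam⁆ = 0
  lie_V_e : ∀ a, ⁅V, e a⁆ = 0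
  lie_V_T : ⁅V, T⁆ = 0
  V_gram : ∀ a b, ⁅V, g (e a) (e b)⁆ = 0
  V_ρ : ⁅V, ρ⁆ = 0
  V_φ : ⁅V, φ⁆ = 0
  V_v : ⁅V, v⁆ = 1
  e_v : ∀ a, ⁅e a, v⁆ = 0
  T_v : ⁅T, v⁆ = 0
  lie_e_e_T : ∀ a b, g ⁅e a, e b⁆ T = 0
  flow_g : ∀ a b, ⁅T, g (e a) (e b)⁆ - g ⁅T, e a⁆ (e b) - g (e a) ⁅T, e b⁆ =
    -2 * (frameRic g gi e a b + frameHess g gi e φ a b - lam * g (e a) (e b))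
  flow_φ : ⁅T, φ⁆ = -(frameScal g gi e + frameLap g gi e φ - Fintype.card ι * lam)
  ρ_eq : ρ = frameScal g gi e + 2 * frameLap g gi e φ - frameGradSq gi e φ
    + 2 * lam * (φ - Fintype.card ι)

namespace IsAmbient

variable {g : LinearMap.BilinForm A L} {e : ι → L} {gi : Matrix ι ι A} {T V : L}
  {u v φ ρ lam wi : A} (H : IsAmbient g e gi T V u v φ ρ lam wi)

/-- The frame dual to the adapted frame. -/
def dualFrame (e : ι → L) (gi : Matrix ι ι A) (T V : L) (ρ wi : A) : ι ⊕ Fin 2 → L :=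
  Sum.elim (dualFamily e gi) ![-wi • V, -wi • T + (wi ^ 2 * ρ) • V]

include H

lemma V_e (a : ι) : g V (e a) = 0 := by rw [H.closed, H.e_u]
lemma V_V : g V V = 0 := by rw [H.closed, H.V_u]
lemma V_T : g V T = -(1 - lam * u) := by rw [H.closed, H.T_u]

lemma V_dual (a : ι) : g V (dualFamily e gi a) = 0 := by
  rw [g_dualFamily]; simp [H.V_e]

lemma T_dual (a : ι) : g T (dualFamily e gi a) = 0 := by
  rw [g_dualFamily]; simp [H.symm T, H.e_T]

lemma e_dual (a b : ι) : g (e a) (dualFamily e gi b) = if a = b then 1 else 0 := by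
  rw [g_dualFamily, H.gram.mul]

/-- Since `V` is null and `g(V, T) = -(1 - lam u)`, duality exchanges `T` and `V` up to the factor
`-wi`; the extra multiple of `V` in the dual of `V` compensates `g(T, T) = -ρ`. -/
lemma frames : IsDualFrames g (ambientFrame e T V) (dualFrame e gi T V ρ wi) := by
  have w := H.wi_mul
  have eV (a : ι) : g (e a) V = 0 := by rw [H.symm, H.V_e]
  have TV : g T V = -(1 - lam * u) := by rw [H.symm, H.V_T]
  refine .of_span H.symm ?_ H.span
  rintro (a | a) (b | b)
  · simp [ambientFrame, dualFrame, H.e_dual]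
  · fin_cases b <;> simp [ambientFrame, dualFrame, eV, H.e_T]
  · fin_cases a <;> simp [ambientFrame, dualFrame, H.V_dual, H.T_dual]
  · fin_cases a <;> fin_cases b <;>
      simp [ambientFrame, dualFrame, H.V_T, H.V_V, TV, H.T_T]
    · linear_combination w
    · linear_combination -wi * ρ * w
    · linear_combination w

/-- The Lie derivative of `g` along `V` is tensorial, so it may be checked on the adapted frame,
which commutes with `V` and whose Gram matrix is constant along `V`. -/
lemma killing (X Z : L) : ⁅V, g X Z⁆ = g ⁅V, X⁆ Z + g X ⁅V, Z⁆ := by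
  have hV (i : ι ⊕ Fin 2) : ⁅V, ambientFrame e T V i⁆ = 0 := by
    rcases i with a | i
    · exact H.lie_V_e a
    · fin_cases i
      · exact H.lie_V_T
      · exact lie_self V
  have hu : ⁅V, ⁅V, u⁆⁆ = 0 ∧ ⁅V, ⁅T, u⁆⁆ = 0 := by
    constructor
    · rw [H.V_u, lie_zero]
    · rw [H.T_u, lie_neg, lie_sub, lie_mul_coeff, H.const, H.V_u]; simp
  have hg (i j : ι ⊕ Fin 2) : ⁅V, g (ambientFrame e T V i) (ambientFrame e T V j)⁆ = 0 := by
    rcases i with a | i <;> rcases j with b | j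
    · exact H.V_gram a b
    · fin_cases j
      · simp [ambientFrame, H.e_T]
      · simp [ambientFrame, H.symm _ V, H.V_e]
    · fin_cases i
      · simp [ambientFrame, H.symm T, H.e_T]
      · simp [ambientFrame, H.V_e]
    · fin_cases i <;> fin_cases j
      · simp [ambientFrame, H.T_T, H.V_ρ]
      · simpa [ambientFrame, H.symm T V, H.closed] using hu.2
      · simpa [ambientFrame, H.closed] using hu.2
      · simpa [ambientFrame, H.closed] using hu.1
  induction H.span X using Submodule.span_induction with
  | mem x hx =>
    obtain ⟨i, rfl⟩ := hx
    induction H.span Z using Submodule.span_induction with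
    | mem z hz => obtain ⟨j, rfl⟩ := hz; simp [hV, hg]
    | zero => simp
    | add z z' _ _ h1 h2 => simp only [map_add, lie_add, h1, h2]; ring
    | smul a z _ h1 =>
      simp only [map_smul, smul_eq_mul, lie_mul_coeff, h1, LieRinehartRing.leibniz_smul_right,
        map_add]
      ring
  | zero => simp
  | add z z' _ _ h1 h2 => simp only [map_add, lie_add, h1, h2, LinearMap.add_apply]; ring
  | smul a z _ h1 =>
    simp only [map_smul, smul_eq_mul, lie_mul_coeff, h1, LieRinehartRing.leibniz_smul_right,
      map_add, LinearMap.smul_apply, LinearMap.add_apply]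
    ring

/-- The expansion of a field in the adapted frame. -/
lemma expand (X : L) : X = ∑ a, g X (dualFamily e gi a) • e a
    + (-wi * g X V) • T + (-wi * g X T + wi ^ 2 * ρ * g X V) • V := by
  have := H.frames.left X
  conv_lhs => rw [← this]
  simp [ambientFrame, dualFrame, add_assoc]

/-- The bracket has no `T`-component because `u` is constant along `e`, and then no `V`-component
because it is orthogonal to `T`. -/
lemma lie_e_e (a b : ι) : ⁅e a, e b⁆ = ∑ d, frameStruct g gi e a b d • e d := by
  have hv : g ⁅e a, e b⁆ V = 0 := by
    rw [H.symm, H.closed, lie_lie, H.e_u, H.e_u]; simp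
  conv_lhs => rw [H.expand ⁅e a, e b⁆]
  simp [hv, H.lie_e_e_T, frameStruct, g_dualFamily]

lemma X_potential (X : L) : ⁅X, φ - v + lam * u * v⁆ =
    ⁅X, φ⁆ - (1 - lam * u) * ⁅X, v⁆ + lam * v * ⁅X, u⁆ := by
  simp only [lie_add, lie_sub, lie_mul_coeff, H.const]; ring

lemma e_potential (a : ι) : ⁅e a, φ - v + lam * u * v⁆ = ⁅e a, φ⁆ := by
  rw [H.X_potential, H.e_u, H.e_v]; ring

lemma V_potential : ⁅V, φ - v + lam * u * v⁆ = -(1 - lam * u) := by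
  rw [H.X_potential, H.V_u, H.V_v, H.V_φ]; ring

lemma T_potential : ⁅T, φ - v + lam * u * v⁆ = ⁅T, φ⁆ - lam * v * (1 - lam * u) := by
  rw [H.X_potential, H.T_u, H.T_v]; ring

variable {nab : L → L → L} (h : IsLeviCivita g nab)
include h

/-- Twice `g(∇_X V, Z)` is the Lie derivative of `g` along `V` plus the exterior derivative of the
form dual to `V`. The first vanishes by `killing`, the second because that form is `du`. -/
lemma nab_V (X : L) : nab X V = 0 := by
  refine h.ext _ _ fun Z => eq_of_two_mul_eq ?_
  have l : ⁅⁅X, Z⁆, u⁆ = ⁅X, ⁅Z, u⁆⁆ - ⁅Z, ⁅X, u⁆⁆ := lie_lie _ _ _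
  have k := H.killing X Z
  rw [h.koszul, two_mul_koszulForm, H.symm X V, H.symm ⁅X, Z⁆ V, H.closed, H.closed, H.closed, l, k,
    ← lie_skew X V, H.symm X]
  simp only [map_neg, map_zero, LinearMap.neg_apply, LinearMap.zero_apply]
  ring

lemma curv_V_right (X Y : L) : curv nab X Y V = 0 := by
  simp [curv, H.nab_V h, h.zero_right]

/-- Pair symmetry moves `V` to the differentiated slot, where it is parallel. -/
lemma curv_V_left (X Y : L) : curv nab V X Y = 0 :=
  h.ext _ _ fun Z => by rw [h.curv_pair_symm, H.curv_V_right h]; simp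

lemma curv_V_mid (X Y : L) : curv nab X V Y = 0 := by
  rw [h.curv_skew, H.curv_V_left h, neg_zero]

lemma g_nab_V (X Y : L) : g (nab X Y) V = ⁅X, g Y V⁆ := by
  rw [h.metric, H.nab_V h]; simp

lemma nab_e_e (a b : ι) : nab (e a) (e b) =
    ∑ d, frameConn g gi e a b d • e d + (-wi * g (nab (e a) (e b)) T) • V := by
  have hv : g (nab (e a) (e b)) V = 0 := by
    rw [H.g_nab_V h, H.symm, H.V_e, lie_zero]
  conv_lhs => rw [H.expand (nab (e a) (e b))]
  simp [hv, h.frameConn_eq]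

/-- A Gauss equation without second fundamental form terms: normal parts of `∇_{e_a} e_b` are
multiples of `V`, and the trace over `T` and `V` sees only curvatures with a `V` in some slot. The
right side is intrinsic to the slices, since its ingredients involve `e` alone. -/
lemma ricci_e_e (b c : ι) :
    h.ricci (ambientFrame e T V) (dualFrame e gi T V ρ wi) (e b) (e c) = frameRic g gi e b c := by
  have r (a : ι) : frameRiem g gi e a b c a = g (curv nab (e a) (e b) (e c)) (dualFamily e gi a) :=
    h.frameRiem_eq H.gram (fun a b => (-wi * g (nab (e a) (e b)) T) • V) (H.nab_e_e h)
      (fun a b c d => by rw [h.smul_right, H.nab_V h]; simp [H.V_e]) H.lie_e_e a b c a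
  simp only [h.ricci_apply, trForm, frameRic, r, h.curvForm_apply, Fintype.sum_sum_type,
    Fin.sum_univ_two]
  simp [ambientFrame, dualFrame, H.curv_V_left h, h.curv_skew_right _ _ _ V, H.curv_V_right h]

lemma ricci_V (X : L) :
    h.ricci (ambientFrame e T V) (dualFrame e gi T V ρ wi) X V = 0 := by
  simp [h.ricci_apply, trForm, H.curv_V_right h]

/-- As `e` and its brackets are orthogonal to `T`, the Koszul formula leaves half of minus the Lie
derivative of `g` along `T`, which the flow prescribes. -/
lemma g_nab_e_e_T (a b : ι) : g (nab (e a) (e b)) T =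
    frameRic g gi e a b + frameHess g gi e φ a b - lam * g (e a) (e b) := by
  apply eq_of_two_mul_eq
  have f := H.flow_g a b
  rw [h.koszul, two_mul_koszulForm, H.e_T, H.e_T, H.lie_e_e_T, ← lie_skew (e a) T,
    ← lie_skew (e b) T, map_neg, map_neg, LinearMap.neg_apply, LinearMap.neg_apply,
    H.symm ⁅T, e b⁆]
  simp only [lie_zero]
  linear_combination -f

/-- The `V`-component of `∇_{e_a} e_b` carries the factor `wi`, and the `V`-derivative of the
potential is `-(1 - lam u)`. Their product contributes the negative of the flow tensor and cancels
the Hessian of `φ`. -/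
lemma hessian_e_e (a b : ι) : h.hessian (φ - v + lam * u * v) (e a) (e b) =
    lam * g (e a) (e b) - frameRic g gi e a b := by
  rw [h.hessian_apply, H.nab_e_e h, add_lie, sum_lie_coeff, H.g_nab_e_e_T h]
  simp only [LieRinehartRing.lie_smul_eq_mul, H.e_potential, H.V_potential]
  unfold frameHess
  linear_combination (-1 : A) * (frameRic g gi e a b + (⁅e a, ⁅e b, φ⁆⁆ -
    ∑ c, frameConn g gi e a b c * ⁅e c, φ⁆) - lam * g (e a) (e b)) * H.wi_mul

lemma hessian_V (X : L) : h.hessian (φ - v + lam * u * v) X V = lam * g X V := by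
  rw [h.hessian_apply, H.nab_V h, zero_lie, H.V_potential, H.symm X V, H.closed]
  simp only [lie_neg, lie_sub, lie_mul_coeff, lie_one_coeff, H.const]
  ring

lemma wP_V (X : L) : h.wPForm (ambientFrame e T V) (dualFrame e gi T V ρ wi)
    (φ - v + lam * u * v) lam X V = 0 := by
  rw [h.wPForm_apply, H.ricci_V h, H.hessian_V h]; ring

lemma wP_e_e (a b : ι) : h.wPForm (ambientFrame e T V) (dualFrame e gi T V ρ wi)
    (φ - v + lam * u * v) lam (e a) (e b) = 0 := by
  rw [h.wPForm_apply, H.ricci_e_e h, H.hessian_e_e h]; ring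

lemma wP_symm (X Y : L) : h.wPForm (ambientFrame e T V) (dualFrame e gi T V ρ wi)
    (φ - v + lam * u * v) lam X Y = h.wPForm (ambientFrame e T V) (dualFrame e gi T V ρ wi)
    (φ - v + lam * u * v) lam Y X := by
  rw [h.wPForm_apply, h.wPForm_apply, h.ricci_symm H.frames, h.hessian_symm, H.symm X]

/-- The spatial trace contributes `n lam - R`, where `n` is the size of `e`; the pair `T`, `V`
contributes `2 lam`. -/
lemma lap_potential : trForm (ambientFrame e T V) (dualFrame e gi T V ρ wi)
    (h.hessian (φ - v + lam * u * v)) =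
      -frameScal g gi e + (Fintype.card ι + 2) * lam := by
  have t (a : ι) : h.hessian (φ - v + lam * u * v) (e a) (dualFamily e gi a) =
      lam * g (e a) (dualFamily e gi a) - ∑ b, gi a b * frameRic g gi e a b := by
    rw [g_dualFamily, g_dualFamily]
    simp only [H.hessian_e_e h, sub_mul, Finset.sum_sub_distrib, Finset.mul_sum, H.gram.symm a]
    congr 1
    · exact Finset.sum_congr rfl fun b _ => by ring
    · exact Finset.sum_congr rfl fun b _ => by ring
  have tv := H.hessian_V h V
  have tt := H.hessian_V h T
  have vt : h.hessian (φ - v + lam * u * v) V T = lam * g T V := by rw [h.hessian_symm, tt]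
  rw [H.V_V] at tv
  rw [H.symm T V, H.V_T] at tt vt
  simp only [trForm, Fintype.sum_sum_type, Fin.sum_univ_two, ambientFrame, dualFrame,
    Sum.elim_inl, Sum.elim_inr, Matrix.cons_val_zero, Matrix.cons_val_one, t, H.e_dual, map_add,
    map_smul, smul_eq_mul, tt, vt, tv, Finset.sum_sub_distrib, frameScal]
  simp
  linear_combination 2 * lam * H.wi_mul

lemma wF_eq_zero : trForm (ambientFrame e T V) (dualFrame e gi T V ρ wi)
      (h.hessian (φ - v + lam * u * v))
    - g (gradField (ambientFrame e T V) (dualFrame e gi T V ρ wi) (φ - v + lam * u * v))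
        (gradField (ambientFrame e T V) (dualFrame e gi T V ρ wi) (φ - v + lam * u * v))
    + 2 * lam * (φ - v + lam * u * v) - (Fintype.card ι + 2) * lam = 0 := by
  have gs (a : ι) : ⁅e a, φ⁆ * ⁅dualFamily e gi a, φ - v + lam * u * v⁆ =
      ∑ b, gi a b * ⁅e a, φ⁆ * ⁅e b, φ⁆ := by
    rw [dualFamily, sum_lie_coeff, Finset.mul_sum]
    refine Finset.sum_congr rfl fun b _ => ?_
    rw [LieRinehartRing.lie_smul_eq_mul, H.e_potential, H.gram.symm a b]; ring
  rw [H.lap_potential h, H.frames.g_gradField]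
  simp only [gradField, sum_lie_coeff, LieRinehartRing.lie_smul_eq_mul, Fintype.sum_sum_type,
    Fin.sum_univ_two, ambientFrame, dualFrame, Sum.elim_inl, Sum.elim_inr, Matrix.cons_val_zero,
    Matrix.cons_val_one, add_lie, H.e_potential, H.V_potential, H.T_potential, gs]
  have r := H.ρ_eq
  have f := H.flow_φ
  unfold frameGradSq at r
  have w := H.wi_mul
  have w2 : (wi * (1 - lam * u)) ^ 2 = 1 := by rw [w, one_pow]
  -- The gradient square is `|∇φ|² + 2 TΦ + ρ`; the terms in `v` cancel, and the flow of `φ` reduces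
  -- the rest to `R_φ - ρ`.
  linear_combination -r - 2 * f - ρ * w2 - 2 * (⁅T, φ⁆ - lam * v * (1 - lam * u)) * w

/-- In the second Bianchi identity the other two terms differentiate the curvature with the parallel
field `V` in a slot where it is annihilated. -/
lemma nabCurv_V (X Y Z : L) : nabCurv nab V X Y Z = 0 := by
  have b := h.bianchi_second V X Y Z
  have c0 (X Y : L) : curv nab X 0 Y = 0 := by rw [h.curv_skew, h.curv_zero_left, neg_zero]
  have e1 : nabCurv nab X Y V Z = 0 := by
    simp [nabCurv, H.curv_V_mid h, H.nab_V h, h.zero_right, c0]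
  have e2 : nabCurv nab Y V X Z = 0 := by
    rw [h.nabCurv_skew]
    simp [nabCurv, H.curv_V_mid h, H.nab_V h, h.zero_right, c0]
  simpa [e1, e2] using b

/-- The form `P` is parallel along `V`. -/
lemma nabForm_wP_V (Y Z : L) : nabForm nab (h.wPForm (ambientFrame e T V)
    (dualFrame e gi T V ρ wi) (φ - v + lam * u * v) lam) V Y Z = 0 := by
  -- Since the curvature kills `V`, the derivative of the Hessian along `V` may be exchanged for one
  -- along `Y` with `V` in a slot, where the Hessian is `lam g`.
  have c := h.nabForm_hessian_sub (H.frames.g_gradField (φ - v + lam * u * v)) V Y Z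
  rw [H.curv_V_left h, map_zero, LinearMap.zero_apply, sub_eq_zero] at c
  rw [h.nabForm_wPForm _ _ _ _ H.const, ← h.sum_nabCurv H.frames, c, nabForm, H.nab_V h,
    h.hessian_symm _ V Z, h.hessian_symm _ V (nab Y Z), H.hessian_V h, H.hessian_V h,
    lie_mul_coeff, H.const, h.metric, H.nab_V h]
  simp [H.nabCurv_V h]

/-- The kernel of `du` is spanned by `e` and `V`, where `P` is already known. -/
lemma wP_eq_zero_of_lie_u {X Y : L} (hX : ⁅X, u⁆ = 0) (hY : ⁅Y, u⁆ = 0) :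
    h.wPForm (ambientFrame e T V) (dualFrame e gi T V ρ wi) (φ - v + lam * u * v) lam X Y = 0 := by
  rw [← H.closed, H.symm] at hX hY
  have hVX (X : L) := (H.wP_symm h V X).trans (H.wP_V h X)
  rw [H.expand X, H.expand Y, hX, hY]
  simp [H.wP_V h, hVX, H.wP_e_e h]

lemma lie_dualFamily_u (a : ι) : ⁅dualFamily e gi a, u⁆ = 0 := by
  rw [← H.closed, H.V_dual]

/-- `P(Z, T) = 0` if the divergence of `P` vanishes at `Z`, and `Z` is `P`-orthogonal to `e`. -/
lemma wP_T_of_div {P : LinearMap.BilinForm A L} (hP : P = h.wPForm (ambientFrame e T V)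
      (dualFrame e gi T V ρ wi) (φ - v + lam * u * v) lam) {Z : L}
    (hZ : ∑ i, nabForm nab P (ambientFrame e T V i) Z (dualFrame e gi T V ρ wi i) = 0)
    (hZe : ∀ a, P Z (dualFamily e gi a) = 0) : P Z T = 0 := by
  have b := h.weighted_bianchi H.frames (φ - v + lam * u * v) lam H.const Z
  have hF := H.wF_eq_zero h
  have hV (X : L) : P X V = 0 := hP ▸ H.wP_V h X
  have hV' (X : L) : P V X = 0 := hP ▸ (H.wP_symm h V X).trans (H.wP_V h X)
  have he (a : ι) : P (e a) (dualFamily e gi a) = 0 :=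
    hP ▸ H.wP_eq_zero_of_lie_u h (H.e_u a) (H.lie_dualFamily_u h a)
  have ht : trForm (ambientFrame e T V) (dualFrame e gi T V ρ wi) P = 0 := by
    simp only [trForm, Fintype.sum_sum_type, Fin.sum_univ_two]
    simp [ambientFrame, dualFrame, he, hV, hV']
  have ht' : trForm (ambientFrame e T V) (dualFrame e gi T V ρ wi) P =
      trForm (ambientFrame e T V) (dualFrame e gi T V ρ wi)
        (h.ricci (ambientFrame e T V) (dualFrame e gi T V ρ wi))
      + trForm (ambientFrame e T V) (dualFrame e gi T V ρ wi)
        (h.hessian (φ - v + lam * u * v)) - lam * (Fintype.card ι + 2) := by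
    have hg := H.frames.trForm_metric
    simp only [Fintype.card_sum, Fintype.card_fin, Nat.cast_add, Nat.cast_ofNat] at hg
    rw [← hg, hP]
    simp only [trForm, h.wPForm_apply, Finset.sum_sub_distrib, Finset.sum_add_distrib,
      Finset.mul_sum]
  have hc (m : ℕ) : ⁅Z, (m : A)⁆ = 0 := by
    induction m with
    | zero => simp
    | succ m ih => rw [Nat.cast_succ, lie_add, ih, lie_one_coeff, add_zero]
  -- Adding `F = 0` to `tr P = 0` makes the function differentiated in the weighted Bianchi identity
  -- constant.
  have key : trForm (ambientFrame e T V) (dualFrame e gi T V ρ wi)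
        (h.ricci (ambientFrame e T V) (dualFrame e gi T V ρ wi))
      + 2 * trForm (ambientFrame e T V) (dualFrame e gi T V ρ wi)
        (h.hessian (φ - v + lam * u * v))
      - g (gradField (ambientFrame e T V) (dualFrame e gi T V ρ wi) (φ - v + lam * u * v))
        (gradField (ambientFrame e T V) (dualFrame e gi T V ρ wi) (φ - v + lam * u * v))
      + 2 * (lam * (φ - v + lam * u * v)) = ((2 * (Fintype.card ι + 2) : ℕ) : A) * lam := by
    push_cast
    linear_combination hF + ht - ht'
  rw [key, lie_mul_coeff, hc, H.const, ← hP, hZ, mul_zero, zero_mul, add_zero, zero_sub] at b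
  have b' : P Z (gradField (ambientFrame e T V) (dualFrame e gi T V ρ wi)
      (φ - v + lam * u * v)) = 0 := by
    refine eq_of_two_mul_eq ?_
    linear_combination -b
  simp only [gradField, Fintype.sum_sum_type, Fin.sum_univ_two, map_add, map_sum, map_smul,
    ambientFrame, dualFrame, Sum.elim_inl, Sum.elim_inr, Matrix.cons_val_zero, Matrix.cons_val_one,
    hZe, hV, H.V_potential, smul_eq_mul] at b'
  simp only [mul_zero, Finset.sum_const_zero] at b'
  -- Only `T` survives in the gradient, with coefficient `wi * (1 - lam u) = 1`.
  linear_combination b' - P Z T * H.wi_mul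

/-- The weighted ambient equation `P = 0`. -/
theorem wPForm_eq_zero : h.wPForm (ambientFrame e T V) (dualFrame e gi T V ρ wi)
    (φ - v + lam * u * v) lam = 0 := by
  obtain ⟨P, hP⟩ : ∃ P, P = h.wPForm (ambientFrame e T V) (dualFrame e gi T V ρ wi)
    (φ - v + lam * u * v) lam := ⟨_, rfl⟩
  have hsymm (X Y : L) : P X Y = P Y X := hP ▸ H.wP_symm h X Y
  have hV (X : L) : P X V = 0 := hP ▸ H.wP_V h X
  have hV' (X : L) : P V X = 0 := (hsymm V X).trans (hV X)
  have hu {X Y : L} (hX : ⁅X, u⁆ = 0) (hY : ⁅Y, u⁆ = 0) : P X Y = 0 :=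
    hP ▸ H.wP_eq_zero_of_lie_u h hX hY
  -- The kernel of `du` is the orthogonal complement of the parallel field `V`, so every covariant
  -- derivative preserves it.
  have hnu (X : L) {Y : L} (hY : ⁅Y, u⁆ = 0) : ⁅nab X Y, u⁆ = 0 := by
    rw [← H.closed] at hY
    rw [← H.closed, H.symm, H.g_nab_V h, H.symm, hY, lie_zero]
  have hn (Y Z : L) : nabForm nab P V Y Z = 0 := hP ▸ H.nabForm_wP_V h Y Z
  have hnV (c : A) (X Y : L) : nabForm nab P X Y (c • V) = 0 := by
    simp [nabForm, hV, h.smul_right, H.nab_V h]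
  have hdual := H.lie_dualFamily_u h
  have hT {Z : L} (hZ : ⁅Z, u⁆ = 0) : P Z T = 0 := by
    refine H.wP_T_of_div h hP ?_ fun a => hu hZ (hdual a)
    -- In the divergence the `T`-term has `V` in the last slot and the `V`-term is a derivative
    -- along `V`; both vanish, and the spatial terms stay inside `ker du`.
    rw [Fintype.sum_sum_type, Fin.sum_univ_two]
    simp only [ambientFrame, dualFrame, Sum.elim_inl, Sum.elim_inr, Matrix.cons_val_zero,
      Matrix.cons_val_one, hn, hnV]
    simp [nabForm, hu hZ (hdual _), hu (hnu _ hZ) (hdual _), hu hZ (hnu _ (hdual _))]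
  have hall (X : L) {Z : L} (hZ : ⁅Z, u⁆ = 0) : P X Z = 0 := by
    rw [H.expand X]
    simp [hV', hu (H.e_u _) hZ, hsymm T, hT hZ]
  -- With `Z = T` the divergence again involves only vectors of `ker du` in the last slot, now
  -- covered by `hall`.
  have hTT : P T T = 0 := by
    refine H.wP_T_of_div h hP ?_ fun a => hall T (hdual a)
    rw [Fintype.sum_sum_type, Fin.sum_univ_two]
    simp only [ambientFrame, dualFrame, Sum.elim_inl, Sum.elim_inr, Matrix.cons_val_zero,
      Matrix.cons_val_one, hn, hnV]
    simp [nabForm, hall _ (hdual _), hall _ (hnu _ (hdual _))]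
  rw [← hP]
  ext X Y
  rw [H.expand Y]
  simp [hV, hall X (H.e_u _), hsymm X T]
  rw [H.expand X]
  simp [hV, hTT, hall T (H.e_u _)]

end IsAmbient

end Ambient

/-! ### Smooth vector fields, their brackets and their action on functions. -/

section Fields

set_option linter.unusedSectionVars false

variable {E : Type*} [NormedAddCommGroup E] [NormedSpace ℝ E]
  {H : Type*} [TopologicalSpace H] {I : ModelWithCorners ℝ E H}
  {N : Type*} [TopologicalSpace N] [ChartedSpace H N] [IsManifold I ∞ N]

lemma SmoothFieldOn.mono {X : VField I N} {U W : Set N} (hX : SmoothFieldOn I X U) (h : W ⊆ U) :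
    SmoothFieldOn I X W :=
  ContMDiffOn.mono hX h

lemma IsFrameOn.mono {ι : Type*} {D : (x : N) → Submodule ℝ (TangentSpace I x)}
    {e : ι → VField I N} {U W : Set N} (he : IsFrameOn I D e U) (hW : IsOpen W) (hWU : W ⊆ U) :
    IsFrameOn I D e W :=
  ⟨hW, fun a => (he.smooth a).mono hWU, fun x hx => he.linearIndependent x (hWU hx),
    fun x hx => he.span_eq x (hWU hx)⟩

lemma SmoothFieldOn.mdiffAt {X : VField I N} {U : Set N} (hU : IsOpen U)
    (hX : SmoothFieldOn I X U) {x : N} (hx : x ∈ U) :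
    MDifferentiableAt I I.tangent (fun x => (⟨x, X x⟩ : TangentBundle I N)) x :=
  ((hX x hx).contMDiffAt (hU.mem_nhds hx)).mdifferentiableAt (by simp)

lemma mdiffAt_of_contMDiffOn {f : N → ℝ} {U : Set N} (hU : IsOpen U)
    (hf : ContMDiffOn I 𝓘(ℝ, ℝ) ∞ f U) {x : N} (hx : x ∈ U) :
    MDifferentiableAt I 𝓘(ℝ, ℝ) f x :=
  ((hf x hx).contMDiffAt (hU.mem_nhds hx)).mdifferentiableAt (by simp)

lemma along_congr {X X' : VField I N} {f f' : N → ℝ} {x : N} (hX : X x = X' x)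
    (hf : f =ᶠ[𝓝 x] f') : along I X f x = along I X' f' x := by
  unfold along
  rw [hX]
  have : mfderiv I 𝓘(ℝ, ℝ) f x = mfderiv I 𝓘(ℝ, ℝ) f' x := hf.mfderiv_eq
  unfold mvfderiv
  rw [this]
  rfl

lemma SmoothFieldOn.along {X : VField I N} {U : Set N} (hU : IsOpen U)
    (hX : SmoothFieldOn I X U) {f : N → ℝ} (hf : ContMDiffOn I 𝓘(ℝ, ℝ) ∞ f U) :
    ContMDiffOn I 𝓘(ℝ, ℝ) ∞ (along I X f) U := by
  have h1 := hf.contMDiffOn_tangentMapWithin (m := ∞) (by simp) hU.uniqueMDiffOn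
  have h2 := h1.comp hX (fun x hx => hx)
  have h3 := (contMDiff_snd_tangentBundle_modelSpace (n := ∞) ℝ 𝓘(ℝ, ℝ)).comp_contMDiffOn h2
  refine h3.congr fun x hx => ?_
  simp only [Function.comp, tangentMapWithin, RicciAmbient.along, mvfderiv]
  rw [mfderivWithin_of_isOpen hU hx]
  rfl

lemma SmoothFieldOn.lieBracket [CompleteSpace E] {X Y : VField I N} {U : Set N} (hU : IsOpen U)
    (hX : SmoothFieldOn I X U) (hY : SmoothFieldOn I Y U) :
    SmoothFieldOn I (mlieBracket I X Y) U := by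
  intro x hx
  have hX' : ContMDiffAt I I.tangent ((⊤ : ℕ∞) : ℕ∞ω) (fun x => (⟨x, X x⟩ : TangentBundle I N)) x :=
    (hX x hx).contMDiffAt (hU.mem_nhds hx)
  have hY' : ContMDiffAt I I.tangent ((⊤ : ℕ∞) : ℕ∞ω) (fun x => (⟨x, Y x⟩ : TangentBundle I N)) x :=
    (hY x hx).contMDiffAt (hU.mem_nhds hx)
  have : IsManifold I (minSmoothness ℝ 2) N := by
    rw [minSmoothness_of_isRCLikeNormedField]; infer_instance
  have : IsManifold I (((⊤ : ℕ∞) : ℕ∞ω) + 1) N := by simpa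
  exact (ContMDiffAt.mlieBracket_vectorField (m := ⊤) hX' hY' (by simp)).contMDiffWithinAt

lemma SmoothFieldOn.add {X Y : VField I N} {U : Set N} (hX : SmoothFieldOn I X U)
    (hY : SmoothFieldOn I Y U) : SmoothFieldOn I (X + Y) U :=
  ContMDiffOn.add_section hX hY

lemma SmoothFieldOn.smul {f : N → ℝ} {X : VField I N} {U : Set N}
    (hf : ContMDiffOn I 𝓘(ℝ, ℝ) ∞ f U) (hX : SmoothFieldOn I X U) :
    SmoothFieldOn I (f • X) U :=
  ContMDiffOn.smul_section hf hX

lemma smoothFieldOn_zero (U : Set N) : SmoothFieldOn I (0 : VField I N) U :=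
  (Bundle.contMDiff_zeroSection ℝ (TangentSpace I : N → Type _)).contMDiffOn

lemma exists_smoothFieldOn (x : N) (w : TangentSpace I x) :
    ∃ (X : VField I N) (U : Set N), IsOpen U ∧ x ∈ U ∧ SmoothFieldOn I X U ∧ X x = w := by
  obtain ⟨s, hs, h⟩ := FiberBundle.exists_contMDiffOn_extend (k := ∞) I E w
  obtain ⟨U, hUs, hU, hx⟩ := mem_nhds_iff.1 hs
  exact ⟨FiberBundle.extend E w, U, hU, hx, h.mono hUs, FiberBundle.extend_apply_self E w⟩

lemma jacobi [CompleteSpace E] {X Y Z : VField I N} {U : Set N} (hU : IsOpen U)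
    (hX : SmoothFieldOn I X U) (hY : SmoothFieldOn I Y U) (hZ : SmoothFieldOn I Z U) {x : N}
    (hx : x ∈ U) : mlieBracket I X (mlieBracket I Y Z) x =
      mlieBracket I (mlieBracket I X Y) Z x + mlieBracket I Y (mlieBracket I X Z) x := by
  have : IsManifold I (minSmoothness ℝ 3) N := by
    rw [minSmoothness_of_isRCLikeNormedField]; infer_instance
  have aux {X : VField I N} (hX : SmoothFieldOn I X U) :
      ContMDiffAt I I.tangent (minSmoothness ℝ 2) (fun x => (⟨x, X x⟩ : TangentBundle I N)) x :=
    ((hX x hx).contMDiffAt (hU.mem_nhds hx)).of_le (by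
      rw [minSmoothness_of_isRCLikeNormedField]; exact ENat.LEInfty.out)
  exact leibniz_identity_mlieBracket_apply (aux hX) (aux hY) (aux hZ)

lemma lieBracket_smul [CompleteSpace E] {X Y : VField I N} {f : N → ℝ} {U : Set N} (hU : IsOpen U)
    (hY : SmoothFieldOn I Y U)
    (hf : ContMDiffOn I 𝓘(ℝ, ℝ) ∞ f U) {x : N} (hx : x ∈ U) :
    mlieBracket I X (f • Y) x = along I X f x • Y x + f x • mlieBracket I X Y x := by
  have : IsManifold I 2 N := inferInstance
  exact mlieBracket_smul_right (mdiffAt_of_contMDiffOn hU hf hx) (hY.mdiffAt hU hx)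

/-- The bracket of vector fields acts on functions as the commutator. -/
lemma along_lieBracket [CompleteSpace E] {X Y : VField I N} {f : N → ℝ} {U : Set N}
    (hU : IsOpen U) (hX : SmoothFieldOn I X U) (hY : SmoothFieldOn I Y U)
    (hf : ContMDiffOn I 𝓘(ℝ, ℝ) ∞ f U) {x : N} (hx : x ∈ U) :
    along I (mlieBracket I X Y) f x = along I X (along I Y f) x - along I Y (along I X f) x := by
  -- Scalars are detected on a field `Z` with `Z x ≠ 0`; in a zero tangent space both sides are `0`.
  by_cases h0 : ∀ w : TangentSpace I x, w = 0
  · simp [along, h0]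
  push Not at h0
  obtain ⟨w, hw⟩ := h0
  obtain ⟨Z, W, hW, hxW, hZ, hZx⟩ := exists_smoothFieldOn x w
  have hO := hU.inter hW
  have hxO : x ∈ U ∩ W := ⟨hx, hxW⟩
  replace hX := hX.mono (W := U ∩ W) Set.inter_subset_left
  replace hY := hY.mono (W := U ∩ W) Set.inter_subset_left
  replace hZ := hZ.mono (W := U ∩ W) Set.inter_subset_right
  replace hf := hf.mono (t := U ∩ W) Set.inter_subset_left
  -- The Jacobi identity for `X`, `Y`, `f • Z` is expanded by the Leibniz rule. The mixed terms
  -- cancel, and the coefficients of `Z x` give the claim.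
  have key {X Y : VField I N} (hX : SmoothFieldOn I X (U ∩ W)) (hY : SmoothFieldOn I Y (U ∩ W)) :
      mlieBracket I X (mlieBracket I Y (f • Z)) x =
        along I X (along I Y f) x • Z x + along I Y f x • mlieBracket I X Z x
        + (along I X f x • mlieBracket I Y Z x + f x • mlieBracket I X (mlieBracket I Y Z) x) := by
    have h1 : mlieBracket I Y (f • Z) =ᶠ[𝓝 x]
        ((along I Y f) • Z + f • mlieBracket I Y Z : VField I N) := by
      filter_upwards [hO.mem_nhds hxO] with y hy
      exact lieBracket_smul hO hZ hf hy
    have hYf := hY.along hO hf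
    have hYZ := hY.lieBracket hO hZ
    rw [Filter.EventuallyEq.mlieBracket_vectorField_eq (Filter.EventuallyEq.refl _ X) h1,
      mlieBracket_add_right ((SmoothFieldOn.smul hYf hZ).mdiffAt hO hxO)
        ((SmoothFieldOn.smul hf hYZ).mdiffAt hO hxO),
      lieBracket_smul hO hZ hYf hxO, lieBracket_smul hO hYZ hf hxO]
  have j := jacobi hO hX hY (SmoothFieldOn.smul hf hZ) hxO
  have j' := jacobi hO hX hY hZ hxO
  rw [key hX hY, key hY hX, lieBracket_smul hO hZ hf hxO, j'] at j
  have e : (along I (mlieBracket I X Y) f x) • Z x =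
      (along I X (along I Y f) x - along I Y (along I X f) x) • Z x := by
    rw [← sub_eq_zero] at j ⊢
    rw [← neg_eq_zero, ← j]
    simp only [smul_add, sub_smul]
    abel
  exact smul_left_injective ℝ (hZx ▸ hw) e

end Fields

/-! ### The Lie–Rinehart algebra of smooth functions and sections over an open set. -/

section Sections

variable {E : Type*} [NormedAddCommGroup E] [NormedSpace ℝ E]
  {H : Type*} [TopologicalSpace H] {I : ModelWithCorners ℝ E H}
  {N : Type*} [TopologicalSpace N] [ChartedSpace H N]

variable (I) in
/-- The algebra of smooth functions on an open set. -/
def SmoothFun (U : TopologicalSpace.Opens N) : Subalgebra ℝ (U → ℝ) where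
  carrier := {f | ∃ F : N → ℝ, ContMDiffOn I 𝓘(ℝ, ℝ) ∞ F U ∧ ∀ x : U, f x = F x}
  mul_mem' := by
    rintro f g ⟨F, hF, hf⟩ ⟨G, hG, hg⟩
    exact ⟨F * G, hF.mul hG, fun x => by simp [hf, hg]⟩
  add_mem' := by
    rintro f g ⟨F, hF, hf⟩ ⟨G, hG, hg⟩
    exact ⟨F + G, hF.add hG, fun x => by simp [hf, hg]⟩
  algebraMap_mem' r := ⟨fun _ => r, contMDiffOn_const, fun _ => rfl⟩

variable {U : TopologicalSpace.Opens N}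

/-- A function on the manifold that restricts to the given one. -/
def funOut (f : SmoothFun I U) : N → ℝ := f.2.choose

lemma funOut_smooth (f : SmoothFun I U) : ContMDiffOn I 𝓘(ℝ, ℝ) ∞ (funOut f) U :=
  f.2.choose_spec.1

lemma funOut_apply (f : SmoothFun I U) (x : U) : funOut f x = f.1 x := (f.2.choose_spec.2 x).symm

namespace SmoothFun

/-- The restriction to `U` of a function that is smooth on `U`. -/
def mk (F : N → ℝ) (hF : ContMDiffOn I 𝓘(ℝ, ℝ) ∞ F U) : SmoothFun I U :=
  ⟨fun x => F x, F, hF, fun _ => rfl⟩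

@[ext] lemma ext' {f f' : SmoothFun I U} (h : ∀ x : U, f.1 x = f'.1 x) : f = f' :=
  Subtype.ext (funext h)

@[simp] lemma mk_apply (F : N → ℝ) (hF : ContMDiffOn I 𝓘(ℝ, ℝ) ∞ F U) (x : U) :
    (mk F hF).1 x = F x := rfl

instance : Invertible (2 : SmoothFun I U) where
  invOf := algebraMap ℝ _ (1 / 2)
  invOf_mul_self := by
    rw [← map_ofNat (algebraMap ℝ (SmoothFun I U)) 2, ← map_mul]; norm_num
  mul_invOf_self := by
    rw [← map_ofNat (algebraMap ℝ (SmoothFun I U)) 2, ← map_mul]; norm_num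

end SmoothFun

variable [IsManifold I ∞ N]

variable (I N) in
/-- An involutive distribution. -/
structure InvolutiveDist where
  /-- the distribution -/
  dist : (x : N) → Submodule ℝ (TangentSpace I x)
  lie_mem : ∀ (U : Set N) (X Y : VField I N), IsOpen U → SmoothFieldOn I X U →
    SmoothFieldOn I Y U → (∀ x ∈ U, X x ∈ dist x) → (∀ x ∈ U, Y x ∈ dist x) →
    ∀ x ∈ U, mlieBracket I X Y x ∈ dist x

/-- The module of smooth sections of a distribution over an open set. -/
def SmoothSec (D : InvolutiveDist I N) (U : TopologicalSpace.Opens N) :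
    Submodule (SmoothFun I U) ((x : U) → TangentSpace I (x : N)) where
  carrier := {X | ∃ X' : VField I N, SmoothFieldOn I X' U ∧ (∀ x ∈ U, X' x ∈ D.dist x) ∧
    ∀ x : U, X x = X' x}
  zero_mem' := ⟨0, smoothFieldOn_zero _, fun x _ => (D.dist x).zero_mem, fun _ => rfl⟩
  add_mem' := by
    rintro X Y ⟨X', hX', hX, hXX⟩ ⟨Y', hY', hY, hYY⟩
    exact ⟨X' + Y', hX'.add hY', fun x hx => (D.dist x).add_mem (hX x hx) (hY x hx),
      fun x => by simp [hXX, hYY]⟩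
  smul_mem' := by
    rintro ⟨f, F, hF, hf⟩ X ⟨X', hX', hX, hXX⟩
    refine ⟨F • X', SmoothFieldOn.smul hF hX', fun x hx => (D.dist x).smul_mem _ (hX x hx),
      fun x => ?_⟩
    have : ((⟨f, F, hF, hf⟩ : SmoothFun I U) • X) x = f x • X x := rfl
    rw [this, hf, hXX]; rfl

variable {D : InvolutiveDist I N}

/-- A vector field on the manifold that restricts to the given one. -/
def secOut (X : SmoothSec D U) : VField I N := X.2.choose

lemma secOut_smooth (X : SmoothSec D U) : SmoothFieldOn I (secOut X) U := X.2.choose_spec.1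

lemma secOut_mem (X : SmoothSec D U) : ∀ x ∈ U, secOut X x ∈ D.dist x := X.2.choose_spec.2.1

lemma secOut_apply (X : SmoothSec D U) (x : U) : secOut X x = X.1 x :=
  (X.2.choose_spec.2.2 x).symm

namespace SmoothSec

/-- The restriction to `U` of a vector field that is smooth on `U`. -/
def mk (X : VField I N) (hX : SmoothFieldOn I X U) (hD : ∀ x ∈ U, X x ∈ D.dist x) :
    SmoothSec D U := ⟨fun x => X x, X, hX, hD, fun _ => rfl⟩

lemma apply_mem (X : SmoothSec D U) (x : U) : X.1 x ∈ D.dist x :=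
  secOut_apply X x ▸ secOut_mem X x x.2

@[ext] lemma ext' {X Y : SmoothSec D U} (h : ∀ x : U, X.1 x = Y.1 x) : X = Y :=
  Subtype.ext (funext h)

@[simp] lemma mk_apply (X : VField I N) (hX : SmoothFieldOn I X U) (hD : ∀ x ∈ U, X x ∈ D.dist x)
    (x : U) : (mk X hX hD : SmoothSec D U).1 x = X x := rfl

@[simp] lemma add_apply (X Y : SmoothSec D U) (x : U) : (X + Y).1 x = X.1 x + Y.1 x := rfl

@[simp] lemma smul_apply (f : SmoothFun I U) (X : SmoothSec D U) (x : U) :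
    (f • X).1 x = f.1 x • X.1 x := rfl

lemma sum_apply {κ : Type*} (s : Finset κ) (X : κ → SmoothSec D U) (x : U) :
    (∑ i ∈ s, X i).1 x = ∑ i ∈ s, (X i).1 x := by
  rw [Submodule.coe_sum, Finset.sum_apply]

instance : Bracket (SmoothSec D U) (SmoothFun I U) where
  bracket X f := SmoothFun.mk (along I (secOut X) (funOut f))
    ((secOut_smooth X).along U.2 (funOut_smooth f))

/-- The bracket is defined through chosen extensions; it depends only on the germ of the function
and on the value of the field, so any representatives compute it. -/
lemma lie_fun_apply {X : SmoothSec D U} {f : SmoothFun I U} {X' : VField I N} {f' : N → ℝ}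
    {x : U} (hX : X.1 x = X' x) (hf : ∀ y : U, f.1 y = f' y) :
    (⁅X, f⁆ : SmoothFun I U).1 x = along I X' f' x := by
  refine along_congr (by rw [secOut_apply, hX]) ?_
  filter_upwards [U.2.mem_nhds x.2] with y hy
  rw [funOut_apply f ⟨y, hy⟩, hf]

variable [CompleteSpace E]

instance : Bracket (SmoothSec D U) (SmoothSec D U) where
  bracket X Y := SmoothSec.mk (mlieBracket I (secOut X) (secOut Y))
    ((secOut_smooth X).lieBracket U.2 (secOut_smooth Y))
    (D.lie_mem U _ _ U.2 (secOut_smooth X) (secOut_smooth Y) (secOut_mem X) (secOut_mem Y))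

lemma lie_apply {X Y : SmoothSec D U} {X' Y' : VField I N} (hX : ∀ x : U, X.1 x = X' x)
    (hY : ∀ x : U, Y.1 x = Y' x) (x : U) :
    (⁅X, Y⁆ : SmoothSec D U).1 x = mlieBracket I X' Y' x := by
  refine Filter.EventuallyEq.mlieBracket_vectorField_eq ?_ ?_
  · filter_upwards [U.2.mem_nhds x.2] with y hy
    rw [secOut_apply X ⟨y, hy⟩, hX]
  · filter_upwards [U.2.mem_nhds x.2] with y hy
    rw [secOut_apply Y ⟨y, hy⟩, hY]

lemma lie_add_apply (X Y Z : SmoothSec D U) : ⁅X, Y + Z⁆ = ⁅X, Y⁆ + ⁅X, Z⁆ := by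
  have : IsManifold I 2 N := inferInstance
  ext x
  rw [lie_apply (fun y => (secOut_apply X y).symm) (Y' := secOut Y + secOut Z)
    (fun y => by simp [secOut_apply]),
    mlieBracket_add_right ((secOut_smooth Y).mdiffAt U.2 x.2) ((secOut_smooth Z).mdiffAt U.2 x.2)]
  rfl

lemma lie_swap (X Y : SmoothSec D U) : ⁅X, Y⁆ = -⁅Y, X⁆ := by
  ext x
  exact mlieBracket_swap_apply

instance : LieRing (SmoothSec D U) where
  add_lie X Y Z := by
    rw [lie_swap, lie_add_apply, lie_swap X, lie_swap Y]; abel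
  lie_add := lie_add_apply
  lie_self X := by
    ext x
    change mlieBracket I (secOut X) (secOut X) x = 0
    simp
  leibniz_lie X Y Z := by
    ext x
    rw [lie_apply (X' := secOut X) (Y' := mlieBracket I (secOut Y) (secOut Z))
      (fun y => (secOut_apply X y).symm) (fun y => rfl), add_apply,
      lie_apply (X' := mlieBracket I (secOut X) (secOut Y)) (Y' := secOut Z) (fun y => rfl)
      (fun y => (secOut_apply Z y).symm),
      lie_apply (X' := secOut Y) (Y' := mlieBracket I (secOut X) (secOut Z))
      (fun y => (secOut_apply Y y).symm) (fun y => rfl)]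
    exact jacobi U.2 (secOut_smooth X) (secOut_smooth Y) (secOut_smooth Z) x.2

instance : LieRingModule (SmoothSec D U) (SmoothFun I U) where
  add_lie X Y f := by
    ext x
    rw [lie_fun_apply (X' := secOut X + secOut Y) (f' := funOut f) (by simp [secOut_apply])
      (fun y => (funOut_apply f y).symm)]
    simp only [along, Pi.add_apply, map_add]
    rfl
  lie_add X f f' := by
    ext x
    rw [lie_fun_apply (X' := secOut X) (f' := funOut f + funOut f') (secOut_apply X x).symm
      (fun y => by simp [funOut_apply])]
    have := mvfderiv_add (mdiffAt_of_contMDiffOn U.2 (funOut_smooth f) x.2)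
      (mdiffAt_of_contMDiffOn U.2 (funOut_smooth f') x.2)
    simp only [along, this]
    rfl
  leibniz_lie X Y f := by
    ext x
    have h := along_lieBracket U.2 (secOut_smooth X) (secOut_smooth Y) (funOut_smooth f) x.2
    have h1 : (⁅X, ⁅Y, f⁆⁆ : SmoothFun I U).1 x =
        along I (secOut X) (along I (secOut Y) (funOut f)) x :=
      lie_fun_apply (secOut_apply X x).symm fun y => rfl
    have h2 : (⁅Y, ⁅X, f⁆⁆ : SmoothFun I U).1 x =
        along I (secOut Y) (along I (secOut X) (funOut f)) x :=
      lie_fun_apply (secOut_apply Y x).symm fun y => rfl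
    have h3 : (⁅⁅X, Y⁆, f⁆ : SmoothFun I U).1 x =
        along I (mlieBracket I (secOut X) (secOut Y)) (funOut f) x :=
      lie_fun_apply rfl fun y => (funOut_apply f y).symm
    have h4 : (⁅⁅X, Y⁆, f⁆ + ⁅Y, ⁅X, f⁆⁆ : SmoothFun I U).1 x =
      (⁅⁅X, Y⁆, f⁆ : SmoothFun I U).1 x + (⁅Y, ⁅X, f⁆⁆ : SmoothFun I U).1 x := rfl
    rw [h4, h1, h2, h3, h]
    ring

instance : LieRinehartRing (SmoothFun I U) (SmoothSec D U) where
  lie_smul_eq_mul' f f' X := by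
    ext x
    rw [lie_fun_apply (X' := funOut f • secOut X) (f' := funOut f')
      (by simp [secOut_apply, funOut_apply]) (fun y => (funOut_apply f' y).symm)]
    simp only [along, Pi.smul_apply', map_smul, funOut_apply]
    rfl
  leibniz_mul_right' X f f' := by
    ext x
    rw [lie_fun_apply (X' := secOut X) (f' := funOut f * funOut f') (secOut_apply X x).symm
      (fun y => by simp [funOut_apply])]
    have := mvfderiv_mul (mdiffAt_of_contMDiffOn U.2 (funOut_smooth f) x.2)
      (mdiffAt_of_contMDiffOn U.2 (funOut_smooth f') x.2)
    simp only [along, this]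
    have h : (f • ⁅X, f'⁆ + ⁅X, f⁆ * f' : SmoothFun I U).1 x =
      f.1 x * along I (secOut X) (funOut f') x + along I (secOut X) (funOut f) x * f'.1 x := rfl
    rw [h]
    simp [along, funOut_apply, mul_comm]
  leibniz_smul_right' X Y f := by
    ext x
    rw [lie_apply (X' := secOut X) (Y' := funOut f • secOut Y) (fun y => (secOut_apply X y).symm)
      (fun y => by simp [secOut_apply, funOut_apply]),
      lieBracket_smul U.2 (secOut_smooth Y) (funOut_smooth f) x.2, add_comm, funOut_apply,
      secOut_apply]
    rfl

end SmoothSec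

/-- The bilinear form on sections defined by a smooth field of forms. -/
def secForm (g : FormField I N) (hg : SmoothForm I g) (D : InvolutiveDist I N)
    (U : TopologicalSpace.Opens N) : LinearMap.BilinForm (SmoothFun I U) (SmoothSec D U) :=
  LinearMap.mk₂ (SmoothFun I U)
    (fun X Y => SmoothFun.mk (fun x => g x (secOut X x) (secOut Y x))
      (hg U (secOut X) (secOut Y) U.2 (secOut_smooth X) (secOut_smooth Y)))
    (fun X X' Y => by
      ext x
      have h : ∀ a b : SmoothFun I U, (a + b).1 x = a.1 x + b.1 x := fun _ _ => rfl
      simp [h, secOut_apply])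
    (fun a X Y => by
      ext x
      simp [secOut_apply])
    (fun X X' Y => by
      ext x
      have h : ∀ a b : SmoothFun I U, (a + b).1 x = a.1 x + b.1 x := fun _ _ => rfl
      simp [h, secOut_apply])
    (fun a X Y => by
      ext x
      simp [secOut_apply])

lemma secForm_apply (g : FormField I N) (hg : SmoothForm I g) (X Y : SmoothSec D U) (x : U) :
    (secForm g hg D U X Y).1 x = g x (X.1 x) (Y.1 x) := by
  rw [← secOut_apply, ← secOut_apply]; rfl

end Sections

/-! ### Evaluation at a point, and frame independence of the pointwise quantities. -/

section Evaluation

set_option linter.unusedSectionVars false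

variable {E : Type*} [NormedAddCommGroup E] [NormedSpace ℝ E]
  {H : Type*} [TopologicalSpace H] {I : ModelWithCorners ℝ E H}
  {N : Type*} [TopologicalSpace N] [ChartedSpace H N]
  {U : TopologicalSpace.Opens N}

/-- Evaluation of smooth functions at a point. -/
def ev (x : U) : SmoothFun I U →+* ℝ :=
  (Pi.evalRingHom (fun _ : U => ℝ) x).comp (SmoothFun I U).val.toRingHom

lemma ev_apply (x : U) (f : SmoothFun I U) : ev x f = f.1 x := rfl

@[simp] lemma ev_mk (F : N → ℝ) (hF : ContMDiffOn I 𝓘(ℝ, ℝ) ∞ F U) (x : U) :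
    ev x (SmoothFun.mk F hF) = F x := rfl

lemma ext_ev {f f' : SmoothFun I U} (h : ∀ x : U, ev x f = ev x f') : f = f' :=
  SmoothFun.ext' h

@[simp] lemma ev_invOf_two (x : U) : ev x (⅟(2 : SmoothFun I U)) = 1 / 2 := rfl

lemma contMDiffOn_of_ev (f : SmoothFun I U) {F : N → ℝ} (h : ∀ x : U, ev x f = F x) :
    ContMDiffOn I 𝓘(ℝ, ℝ) ∞ F U :=
  (funOut_smooth f).congr fun x hx => by rw [← h ⟨x, hx⟩, ev_apply, ← funOut_apply]

lemma isUnit_of_ev_ne_zero {f : SmoothFun I U} (h : ∀ x : U, ev x f ≠ 0) : IsUnit f := by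
  have h' : ∀ x ∈ U, funOut f x ≠ 0 := fun x hx => by
    rw [funOut_apply f ⟨x, hx⟩]; exact h ⟨x, hx⟩
  refine IsUnit.of_mul_eq_one (SmoothFun.mk (fun x => (funOut f x)⁻¹)
    ((funOut_smooth f).inv₀ h')) (ext_ev fun x => ?_)
  rw [map_mul, map_one, ev_mk, funOut_apply]
  exact mul_inv_cancel₀ (h x)

variable [IsManifold I ∞ N] [CompleteSpace E] {D : InvolutiveDist I N}

lemma ev_lie {X : SmoothSec D U} {X' : VField I N} {f : SmoothFun I U} {F : N → ℝ} {x : U}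
    (hX : X.1 x = X' x) (hF : ∀ y : U, ev y f = F y) : ev x ⁅X, f⁆ = along I X' F x :=
  SmoothSec.lie_fun_apply hX hF

variable {g : FormField I N} {hg : SmoothForm I g} {ι : Type*} [Fintype ι] [DecidableEq ι]

lemma ev_koszulForm {X Y Z : SmoothSec D U} {X' Y' Z' : VField I N} (hX : ∀ x : U, X.1 x = X' x)
    (hY : ∀ x : U, Y.1 x = Y' x) (hZ : ∀ x : U, Z.1 x = Z' x) (x : U) :
    ev x (koszulForm (secForm g hg D U) X Y Z) = koszul I g X' Y' Z' x := by
  have hf {X Y : SmoothSec D U} {X' Y' : VField I N} (hX : ∀ x : U, X.1 x = X' x)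
      (hY : ∀ x : U, Y.1 x = Y' x) (y : U) :
      ev y (secForm g hg D U X Y) = g y (X' y) (Y' y) := by
    rw [ev_apply, secForm_apply, hX, hY]
  simp only [koszulForm, koszul, map_mul, map_sub, map_add, ev_invOf_two]
  rw [ev_lie (F := fun y => g y (Y' y) (Z' y)) (hX x) (hf hY hZ),
    ev_lie (F := fun y => g y (X' y) (Z' y)) (hY x) (hf hX hZ),
    ev_lie (F := fun y => g y (X' y) (Y' y)) (hZ x) (hf hX hY)]
  simp only [ev_apply, secForm_apply, SmoothSec.lie_apply hX hY, SmoothSec.lie_apply hX hZ,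
    SmoothSec.lie_apply hY hZ, hX, hY, hZ]

section Family

variable {e : ι → VField I N} {s : ι → SmoothSec D U} (hs : ∀ a, ∀ x : U, (s a).1 x = e a x)
  {gi : Matrix ι ι (SmoothFun I U)} (hgi : ∀ (x : U) a b, ev x (gi a b) = gramInv I g e x a b)
include hs hgi

lemma ev_frameConn (x : U) (a b d : ι) :
    ev x (frameConn (secForm g hg D U) gi s a b d) = connCoeff I g e a b d x := by
  simp only [frameConn, connCoeff, map_sum, map_mul, hgi, ev_koszulForm (hs _) (hs _) (hs _)]

lemma ev_frameStruct (x : U) (a b d : ι) :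
    ev x (frameStruct (secForm g hg D U) gi s a b d) = structFun I g e a b d x := by
  simp only [frameStruct, structFun, map_sum, map_mul, hgi]
  simp only [ev_apply, secForm_apply, SmoothSec.lie_apply (hs _) (hs _), hs]

lemma ev_frameRiem (x : U) (a b c d : ι) :
    ev x (frameRiem (secForm g hg D U) gi s a b c d) = riem I g e a b c d x := by
  simp only [frameRiem, riem, map_sum, map_mul, map_sub, map_add, ev_frameConn hs hgi,
    ev_frameStruct hs hgi]
  rw [ev_lie (hs a x) (ev_frameConn hs hgi · b c d), ev_lie (hs b x) (ev_frameConn hs hgi · a c d)]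

lemma ev_frameRic (x : U) (b c : ι) :
    ev x (frameRic (secForm g hg D U) gi s b c) = ric I g e b c x := by
  simp only [frameRic, ric, map_sum, ev_frameRiem hs hgi]

lemma ev_frameScal (x : U) : ev x (frameScal (secForm g hg D U) gi s) = scal I g e x := by
  simp only [frameScal, scal, map_sum, map_mul, hgi, ev_frameRic hs hgi]

variable {φ : SmoothFun I U} {Φ : N → ℝ} (hφ : ∀ x : U, ev x φ = Φ x)
include hφ

lemma ev_frameHess (x : U) (a b : ι) :
    ev x (frameHess (secForm g hg D U) gi s φ a b) = hess I g e Φ a b x := by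
  simp only [frameHess, hess, map_sum, map_mul, map_sub, ev_frameConn hs hgi]
  rw [ev_lie (hs a x) (fun y => ev_lie (hs b y) hφ)]
  simp only [ev_lie (hs _ x) hφ]

lemma ev_frameLap (x : U) : ev x (frameLap (secForm g hg D U) gi s φ) = lap I g e Φ x := by
  simp only [frameLap, lap, map_sum, map_mul, hgi, ev_frameHess hs hgi hφ]

lemma ev_frameGradSq (x : U) : ev x (frameGradSq gi s φ) = gradSq I g e Φ x := by
  simp only [frameGradSq, gradSq, map_sum, map_mul, hgi, ev_lie (hs _ x) hφ]

end Family

/-- The sections defined by a local frame. -/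
def IsFrameOn.sec {e : ι → VField I N} (he : IsFrameOn I D.dist e U) (a : ι) : SmoothSec D U :=
  SmoothSec.mk (e a) (he.smooth a) fun x hx => by
    rw [← he.span_eq x hx]; exact Submodule.subset_span ⟨a, rfl⟩

lemma IsFrameOn.sec_apply {e : ι → VField I N} (he : IsFrameOn I D.dist e U) (a : ι) (x : U) :
    (he.sec a).1 x = e a x := rfl

variable (hg) in
/-- The inverse Gram matrix of a local frame, as a matrix of smooth functions. -/
lemma exists_isGramInv {e : ι → VField I N} {s : ι → SmoothSec D U}
    (hs : ∀ a, ∀ x : U, (s a).1 x = e a x) (symm : ∀ x X Y, g x X Y = g x Y X)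
    (hdet : ∀ x ∈ U, (gram I g e x).det ≠ 0) :
    ∃ gi : Matrix ι ι (SmoothFun I U), IsGramInv (secForm g hg D U) s gi ∧
      ∀ (x : U) a b, ev x (gi a b) = gramInv I g e x a b := by
  let G : Matrix ι ι (SmoothFun I U) := Matrix.of fun a b => secForm g hg D U (s a) (s b)
  have hG (x : U) : (ev x).mapMatrix G = gram I g e x := by
    ext a b
    simp [G, gram, ev_apply, secForm_apply, hs]
  have hsymm : G.transpose = G := by
    ext a b x
    simp only [G, Matrix.transpose_apply, Matrix.of_apply, secForm_apply, symm]
  have hu : IsUnit G.det := isUnit_of_ev_ne_zero fun x => by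
    rw [RingHom.map_det, hG]; exact hdet x x.2
  have hmul : G * G⁻¹ = 1 := Matrix.mul_nonsing_inv G hu
  refine ⟨G⁻¹, ⟨fun a b => ?_, fun a b => ?_⟩, fun x a b => ?_⟩
  · have : G⁻¹.transpose = G⁻¹ := by rw [Matrix.transpose_nonsing_inv, hsymm]
    exact (congrFun (congrFun this b) a)
  · have := congrFun (congrFun hmul a) b
    rw [Matrix.mul_apply, Matrix.one_apply] at this
    exact this
  · have h1 : gram I g e x * (ev x).mapMatrix G⁻¹ = 1 := by
      rw [← hG, ← map_mul, hmul, map_one]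
    rw [gramInv, Matrix.inv_eq_right_inv h1]
    rfl

/-- A frame spans pointwise by definition; the inverse Gram matrix expresses the pointwise
coefficients by smooth functions, so it spans over the ring as well. -/
lemma IsGramInv.sec_span {e : ι → VField I N} (he : IsFrameOn I D.dist e U)
    {gi : Matrix ι ι (SmoothFun I U)} (h : IsGramInv (secForm g hg D U) he.sec gi)
    (X : SmoothSec D U) : X ∈ Submodule.span (SmoothFun I U) (Set.range he.sec) := by
  rw [Submodule.mem_span_range_iff_exists_fun]
  refine ⟨fun d => ∑ c, secForm g hg D U X (he.sec c) * gi c d, SmoothSec.ext' fun x => ?_⟩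
  have hx : X.1 x ∈ Submodule.span ℝ (Set.range fun a => e a x) := by
    rw [he.span_eq x x.2]; exact SmoothSec.apply_mem X x
  obtain ⟨c, hc⟩ := (Submodule.mem_span_range_iff_exists_fun ℝ).1 hx
  have hd (d : ι) : ev x (∑ k, secForm g hg D U X (he.sec k) * gi k d) = c d := by
    have hm (a : ι) : ∑ k, g x (e a x) (e k x) * ev x (gi k d) = if a = d then 1 else 0 := by
      have := congrArg (ev x) (h.mul a d)
      rw [map_sum] at this
      simp only [map_mul, ev_apply, secForm_apply, IsFrameOn.sec_apply] at this ⊢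
      rw [this]
      split_ifs <;> rfl
    simp only [map_sum, map_mul]
    simp only [ev_apply, secForm_apply, IsFrameOn.sec_apply, ← hc]
    simp only [← ev_apply, map_sum, map_smul, LinearMap.sum_apply, LinearMap.smul_apply,
      Finset.sum_mul, smul_eq_mul, mul_assoc]
    rw [Finset.sum_comm]
    simp only [← Finset.mul_sum, hm]
    simp
  rw [SmoothSec.sum_apply, ← hc]
  refine Finset.sum_congr rfl fun d _ => ?_
  rw [SmoothSec.smul_apply, ← ev_apply, hd, IsFrameOn.sec_apply]

lemma IsFrameOn.isDualFrames {e : ι → VField I N} (he : IsFrameOn I D.dist e U)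
    (symm : ∀ x X Y, g x X Y = g x Y X)
    {gi : Matrix ι ι (SmoothFun I U)} (h : IsGramInv (secForm g hg D U) he.sec gi) :
    IsDualFrames (secForm g hg D U) he.sec (dualFamily he.sec gi) :=
  h.isDualFrames (fun X Y => ext_ev fun x => by
    rw [ev_apply, ev_apply, secForm_apply, secForm_apply, symm]) h.sec_span

/-- The weighted scalar curvature does not depend on the frame. -/
theorem wR_eq_wR {g : FormField I N} (hg : SmoothForm I g) (symm : ∀ x X Y, g x X Y = g x Y X)
    {e e' : ι → VField I N} (he : IsFrameOn I D.dist e U) (he' : IsFrameOn I D.dist e' U)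
    (hdet : ∀ x ∈ U, (gram I g e x).det ≠ 0) (hdet' : ∀ x ∈ U, (gram I g e' x).det ≠ 0)
    {Φ : N → ℝ} (hΦ : ContMDiffOn I 𝓘(ℝ, ℝ) ∞ Φ U) (lam : ℝ) {x : N} (hx : x ∈ U) :
    wR I g e Φ lam x = wR I g e' Φ lam x := by
  obtain ⟨gi, hgi, hev⟩ := exists_isGramInv hg he.sec_apply symm hdet
  obtain ⟨gi', hgi', hev'⟩ := exists_isGramInv hg he'.sec_apply symm hdet'
  have F := he.isDualFrames symm hgi
  have F' := he'.isDualFrames symm hgi'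
  have hφ : ∀ x : U, ev x (SmoothFun.mk Φ hΦ) = Φ x := fun x => rfl
  have h1 : frameScal (secForm g hg D U) gi he.sec = frameScal (secForm g hg D U) gi' he'.sec := by
    rw [F.isLeviCivita.frameScal_eq hgi F, F'.isLeviCivita.frameScal_eq hgi' F', F.trForm_eq F',
      F.isLeviCivita.ricci_eq F'.isLeviCivita F F']
  have h2 : frameLap (secForm g hg D U) gi he.sec (SmoothFun.mk Φ hΦ) =
      frameLap (secForm g hg D U) gi' he'.sec (SmoothFun.mk Φ hΦ) := by
    rw [F.isLeviCivita.frameLap_eq hgi F, F'.isLeviCivita.frameLap_eq hgi' F', F.trForm_eq F',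
      F.isLeviCivita.hessian_eq_hessian F'.isLeviCivita]
  have h3 : frameGradSq gi he.sec (SmoothFun.mk Φ hΦ) =
      frameGradSq gi' he'.sec (SmoothFun.mk Φ hΦ) := by
    rw [F.frameGradSq_eq hgi, F'.frameGradSq_eq hgi', F.gradField_eq F']
  have e1 := congrArg (ev ⟨x, hx⟩) h1
  have e2 := congrArg (ev ⟨x, hx⟩) h2
  have e3 := congrArg (ev ⟨x, hx⟩) h3
  rw [ev_frameScal he.sec_apply hev, ev_frameScal he'.sec_apply hev'] at e1
  rw [ev_frameLap he.sec_apply hev hφ, ev_frameLap he'.sec_apply hev' hφ] at e2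
  rw [ev_frameGradSq he.sec_apply hev hφ, ev_frameGradSq he'.sec_apply hev' hφ] at e3
  simp only [wR, e1, e2, e3]

/-- The weighted scalar curvature in a frame is smooth. -/
theorem contMDiffOn_wR {g : FormField I N} (hg : SmoothForm I g)
    (symm : ∀ x X Y, g x X Y = g x Y X)
    {e : ι → VField I N} (he : IsFrameOn I D.dist e U)
    (hdet : ∀ x ∈ U, (gram I g e x).det ≠ 0)
    {Φ : N → ℝ} (hΦ : ContMDiffOn I 𝓘(ℝ, ℝ) ∞ Φ U) (lam : ℝ) :
    ContMDiffOn I 𝓘(ℝ, ℝ) ∞ (wR I g e Φ lam) U := by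
  obtain ⟨gi, hgi, hev⟩ := exists_isGramInv hg he.sec_apply symm hdet
  have hφ : ∀ x : U, ev x (SmoothFun.mk Φ hΦ) = Φ x := fun x => rfl
  refine contMDiffOn_of_ev (frameScal (secForm g hg D U) gi he.sec
    + 2 * frameLap (secForm g hg D U) gi he.sec (SmoothFun.mk Φ hΦ)
    - frameGradSq gi he.sec (SmoothFun.mk Φ hΦ)
    + 2 * algebraMap ℝ _ lam * (SmoothFun.mk Φ hΦ - (Fintype.card ι : SmoothFun I U))) fun x => ?_
  simp only [map_add, map_sub, map_mul, ev_frameScal he.sec_apply hev,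
    ev_frameLap he.sec_apply hev hφ, ev_frameGradSq he.sec_apply hev hφ, map_natCast, map_ofNat]
  rfl

/-- `P_φ` in terms of any pair of dual frames. -/
theorem wP_eq_ev {g : FormField I N} (hg : SmoothForm I g) (symm : ∀ x X Y, g x X Y = g x Y X)
    {e : ι → VField I N} (he : IsFrameOn I D.dist e U)
    (hdet : ∀ x ∈ U, (gram I g e x).det ≠ 0)
    {Φ : N → ℝ} {φ : SmoothFun I U} (hφ : ∀ x : U, ev x φ = Φ x) (lam : ℝ)
    {κ : Type*} [Fintype κ] [DecidableEq κ] {s f : κ → SmoothSec D U}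
    (F : IsDualFrames (secForm g hg D U) s f) (x : U) (a b : ι) :
    wP I g e Φ lam a b x =
      ev x (F.isLeviCivita.wPForm s f φ (algebraMap ℝ _ lam) (he.sec a) (he.sec b)) := by
  obtain ⟨gi, hgi, hev⟩ := exists_isGramInv hg he.sec_apply symm hdet
  have F' := he.isDualFrames symm hgi
  rw [IsLeviCivita.wPForm_apply, F.isLeviCivita.ricci_eq F'.isLeviCivita F F',
    F.isLeviCivita.hessian_eq_hessian F'.isLeviCivita, ← F'.isLeviCivita.frameRic_eq hgi F',
    ← F'.isLeviCivita.frameHess_eq hgi F', map_sub, map_add, map_mul,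
    ev_frameRic he.sec_apply hev, ev_frameHess he.sec_apply hev hφ]
  simp only [wP, ev_apply x (secForm _ _ _ _ _ _), secForm_apply]
  rfl

/-- `F_φ` in terms of any pair of dual frames. -/
theorem wF_eq_ev {g : FormField I N} (hg : SmoothForm I g) (symm : ∀ x X Y, g x X Y = g x Y X)
    {e : ι → VField I N} (he : IsFrameOn I D.dist e U)
    (hdet : ∀ x ∈ U, (gram I g e x).det ≠ 0)
    {Φ : N → ℝ} {φ : SmoothFun I U} (hφ : ∀ x : U, ev x φ = Φ x) (lam : ℝ)
    {κ : Type*} [Fintype κ] [DecidableEq κ] {s f : κ → SmoothSec D U}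
    (F : IsDualFrames (secForm g hg D U) s f) (x : U) :
    wF I g e Φ lam x =
      ev x (trForm s f (F.isLeviCivita.hessian φ)
        - secForm g hg D U (gradField s f φ) (gradField s f φ)
        + 2 * algebraMap ℝ _ lam * φ - (Fintype.card ι : SmoothFun I U) * algebraMap ℝ _ lam) := by
  obtain ⟨gi, hgi, hev⟩ := exists_isGramInv hg he.sec_apply symm hdet
  have F' := he.isDualFrames symm hgi
  rw [F.trForm_eq F', F.isLeviCivita.hessian_eq_hessian F'.isLeviCivita, F.gradField_eq F',
    ← F'.isLeviCivita.frameLap_eq hgi F', ← F'.frameGradSq_eq hgi]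
  simp only [map_add, map_sub, map_mul, ev_frameLap he.sec_apply hev hφ,
    ev_frameGradSq he.sec_apply hev hφ, map_natCast, map_ofNat, hφ]
  rfl

end Evaluation

/-! ### Gram determinants and linear independence. -/

section Gram

set_option linter.unusedSectionVars false

variable {E : Type*} [NormedAddCommGroup E] [NormedSpace ℝ E]
  {H : Type*} [TopologicalSpace H] {I : ModelWithCorners ℝ E H}
  {N : Type*} [TopologicalSpace N] [ChartedSpace H N] {ι : Type*} [Fintype ι] [DecidableEq ι]

lemma linearIndependent_of_det_gram_ne_zero {g : FormField I N} {e : ι → VField I N} {x : N}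
    (h : (gram I g e x).det ≠ 0) : LinearIndependent ℝ (fun a => e a x) := by
  rw [Fintype.linearIndependent_iff]
  intro c hc
  refine congrFun (Matrix.eq_zero_of_vecMul_eq_zero h ?_)
  ext b
  have := congrArg (fun X => g x X (e b x)) hc
  simpa [Matrix.vecMul, dotProduct, gram] using this

lemma det_gram_ne_zero {g : FormField I N} {e : ι → VField I N} {x : N}
    (symm : ∀ X Y, g x X Y = g x Y X) (hli : LinearIndependent ℝ (fun a => e a x))
    (hnd : ∀ X ∈ Submodule.span ℝ (Set.range fun a => e a x),
      (∀ a, g x X (e a x) = 0) → X = 0) : (gram I g e x).det ≠ 0 := by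
  intro h
  obtain ⟨v, hv, hv0⟩ := Matrix.exists_mulVec_eq_zero_iff.2 h
  refine hv (funext (Fintype.linearIndependent_iff.1 hli v ?_))
  refine hnd _ (Submodule.sum_mem _ fun a _ =>
    Submodule.smul_mem _ _ (Submodule.subset_span ⟨a, rfl⟩)) fun a => ?_
  have := congrFun hv0 a
  simp only [Matrix.mulVec, dotProduct, gram, Matrix.of_apply, Pi.zero_apply] at this
  simp only [map_sum, map_smul, LinearMap.sum_apply, LinearMap.smul_apply, smul_eq_mul]
  rw [← this]
  exact Finset.sum_congr rfl fun b _ => by rw [symm, mul_comm]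

end Gram

/-! ### The spatial distribution, its frames and the weighted scalar curvature. -/

section Spacetime

variable {n : ℕ} {M : Type*} [TopologicalSpace M] [ChartedSpace (EuclideanHalfSpace (n + 1)) M]
  [IsManifold (𝓡∂ (n + 1)) ∞ M] {lam : ℝ}

namespace GradientRicciFlowSpacetime

variable (S : GradientRicciFlowSpacetime n M lam)

lemma mem_spatial {x : M} {X : TangentSpace (𝓡∂ (n + 1)) x} :
    X ∈ spatial S.time x ↔ mvfderiv (𝓡∂ (n + 1)) S.time x X = 0 := Iff.rfl

/-- The spatial distribution is involutive. -/
def spatialDist : InvolutiveDist (𝓡∂ (n + 1)) M where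
  dist := spatial S.time
  lie_mem U X Y hU hX hY hXD hYD x hx := by
    -- Both `X t` and `Y t` vanish on the open set, hence so does their commutator derivative `[X,
    -- Y] t`.
    have h := along_lieBracket hU hX hY S.time_smooth.contMDiffOn hx
    have zero {X Y : VField (𝓡∂ (n + 1)) M} (hY : ∀ x ∈ U, Y x ∈ spatial S.time x) :
        along (𝓡∂ (n + 1)) X (along (𝓡∂ (n + 1)) Y S.time) x = 0 := by
      rw [along_congr (f' := fun _ => 0) rfl]
      · simp [along, mvfderiv_const]
      · filter_upwards [hU.mem_nhds hx] with y hy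
        exact hY y hy
    rw [zero hYD, zero hXD, sub_zero] at h
    exact h

lemma finrank_spatial (x : M) : Module.finrank ℝ (spatial (n := n) S.time x) = n := by
  have hfd : FiniteDimensional ℝ (TangentSpace (𝓡∂ (n + 1)) x) :=
    inferInstanceAs (FiniteDimensional ℝ (EuclideanSpace ℝ (Fin (n + 1))))
  have hd : Module.finrank ℝ (TangentSpace (𝓡∂ (n + 1)) x) = n + 1 :=
    finrank_euclideanSpace_fin (𝕜 := ℝ)
  have h := LinearMap.finrank_range_add_finrank_ker
    (mvfderiv (𝓡∂ (n + 1)) S.time x).toLinearMap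
  have hr : LinearMap.range (mvfderiv (𝓡∂ (n + 1)) S.time x).toLinearMap = ⊤ := by
    rw [LinearMap.range_eq_top]
    intro r
    refine ⟨r • S.dt x, ?_⟩
    have := S.dt_time x
    simp only [along] at this
    simp [this]
  rw [hr, finrank_top, hd, Module.finrank_self] at h
  have : Module.finrank ℝ (spatial (n := n) S.time x) + 1 = n + 1 :=
    (add_comm _ _).trans h
  omega

lemma det_gram_spatial_ne_zero {e : Fin n → VField (𝓡∂ (n + 1)) M} {x : M}
    (hli : LinearIndependent ℝ (fun a => e a x)) (he : ∀ a, e a x ∈ spatial S.time x) :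
    (gram (𝓡∂ (n + 1)) S.g e x).det ≠ 0 := by
  refine det_gram_ne_zero (S.g_symm x) hli fun X hX h0 => ?_
  by_contra hne
  have hXs : X ∈ spatial S.time x :=
    (Submodule.span_le.2 (by rintro _ ⟨a, rfl⟩; exact he a)) hX
  refine (S.g_pos x X hXs hne).ne' ?_
  obtain ⟨c, hc⟩ := (Submodule.mem_span_range_iff_exists_fun ℝ).1 hX
  calc S.g x X X = S.g x X (∑ a, c a • e a x) := by rw [hc]
    _ = 0 := by simp [h0]

lemma det_gram_frame_ne_zero {e : Fin n → VField (𝓡∂ (n + 1)) M} {U : Set M}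
    (he : IsFrameOn (𝓡∂ (n + 1)) (spatial S.time) e U) {x : M} (hx : x ∈ U) :
    (gram (𝓡∂ (n + 1)) S.g e x).det ≠ 0 :=
  S.det_gram_spatial_ne_zero (he.linearIndependent x hx) fun a => by
    rw [← he.span_eq x hx]; exact Submodule.subset_span ⟨a, rfl⟩

/-- Local frames of the spatial distribution exist. -/
theorem exists_frame (x : M) : ∃ (e : Fin n → VField (𝓡∂ (n + 1)) M) (U : Set M),
    IsFrameOn (𝓡∂ (n + 1)) (spatial S.time) e U ∧ x ∈ U := by
  have hfd (y : M) : FiniteDimensional ℝ (TangentSpace (𝓡∂ (n + 1)) y) :=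
    inferInstanceAs (FiniteDimensional ℝ (EuclideanSpace ℝ (Fin (n + 1))))
  let b := Module.finBasisOfFinrankEq ℝ (spatial (n := n) S.time x) (S.finrank_spatial x)
  choose W O hO hxO hW hWx using fun a =>
    exists_smoothFieldOn (I := 𝓡∂ (n + 1)) x (b a : TangentSpace (𝓡∂ (n + 1)) x)
  let U₀ : Set M := ⋂ a, O a
  have hU₀ : IsOpen U₀ := isOpen_iInter_of_finite hO
  have hxU₀ : x ∈ U₀ := Set.mem_iInter.2 hxO
  -- Projection to `ker dt` along `∂_t`. At `x` it changes nothing, as the values there are already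
  -- spatial.
  let e : Fin n → VField (𝓡∂ (n + 1)) M := fun a =>
    W a + (fun y => -along (𝓡∂ (n + 1)) (W a) S.time y) • S.dt
  have hW' (a : Fin n) : SmoothFieldOn (𝓡∂ (n + 1)) (W a) U₀ :=
    (hW a).mono (Set.iInter_subset _ a)
  have he (a : Fin n) : SmoothFieldOn (𝓡∂ (n + 1)) (e a) U₀ :=
    (hW' a).add (SmoothFieldOn.smul ((hW' a).along hU₀ S.time_smooth.contMDiffOn).neg
      (S.dt_smooth.mono (Set.subset_univ _)))
  have hes (a : Fin n) (y : M) : e a y ∈ spatial S.time y := by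
    have := S.dt_time y
    simp only [along] at this
    rw [S.mem_spatial]
    simp [e, along, this]
  have hex (a : Fin n) : e a x = b a := by
    have h0 : along (𝓡∂ (n + 1)) (W a) S.time x = 0 := by
      rw [along, hWx]; exact (b a).2
    simp [e, h0, hWx]
  have hlix : LinearIndependent ℝ (fun a => e a x) := by
    simp only [hex]
    exact b.linearIndependent.map' (Submodule.subtype _) (Submodule.ker_subtype _)
  have hdet : ContinuousOn (fun y => (gram (𝓡∂ (n + 1)) S.g e y).det) U₀ := by
    have : ContinuousOn (fun y => gram (𝓡∂ (n + 1)) S.g e y) U₀ :=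
      continuousOn_pi.2 fun a => continuousOn_pi.2 fun c =>
        (S.g_smooth U₀ (e a) (e c) hU₀ (he a) (he c)).continuousOn
    exact (continuous_id.matrix_det).comp_continuousOn this
  -- Non-vanishing of the Gram determinant is an open condition that forces independence; it holds
  -- at `x` because `g` is positive on `ker dt`.
  refine ⟨e, U₀ ∩ (fun y => (gram (𝓡∂ (n + 1)) S.g e y).det) ⁻¹' {0}ᶜ,
    ⟨hdet.isOpen_inter_preimage hU₀ isOpen_compl_singleton,
      fun a => (he a).mono Set.inter_subset_left,
      fun y hy => linearIndependent_of_det_gram_ne_zero hy.2, fun y hy => ?_⟩, hxU₀,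
    S.det_gram_spatial_ne_zero hlix fun a => hes a x⟩
  have hli := linearIndependent_of_det_gram_ne_zero hy.2
  refine Submodule.eq_of_le_of_finrank_eq
    (Submodule.span_le.2 (by rintro _ ⟨a, rfl⟩; exact hes a y)) ?_
  rw [finrank_span_eq_card hli, S.finrank_spatial, Fintype.card_fin]

/-- The frame picked in the definition depends on the point; it is compared with `e` on the
intersection of their domains. -/
lemma weightedScal_eq {e : Fin n → VField (𝓡∂ (n + 1)) M} {U : Set M}
    (he : IsFrameOn (𝓡∂ (n + 1)) (spatial S.time) e U) {x : M} (hx : x ∈ U) :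
    S.weightedScal x = wR (𝓡∂ (n + 1)) S.g e S.φ lam x := by
  have h : ∃ (e : Fin n → VField (𝓡∂ (n + 1)) M) (U : Set M),
      IsFrameOn (𝓡∂ (n + 1)) (spatial S.time) e U ∧ x ∈ U := ⟨e, U, he, hx⟩
  rw [weightedScal, dif_pos h]
  obtain ⟨U', he', hx'⟩ := h.choose_spec
  have hO := he'.isOpen.inter he.isOpen
  exact wR_eq_wR (D := S.spatialDist) (U := ⟨U' ∩ U, hO⟩) S.g_smooth S.g_symm
    (he'.mono hO Set.inter_subset_left) (he.mono hO Set.inter_subset_right)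
    (fun y hy => S.det_gram_frame_ne_zero he' hy.1) (fun y hy => S.det_gram_frame_ne_zero he hy.2)
    S.φ_smooth.contMDiffOn lam ⟨hx', hx⟩

lemma weightedScal_smooth : ContMDiff (𝓡∂ (n + 1)) 𝓘(ℝ, ℝ) ∞ S.weightedScal := by
  intro x
  obtain ⟨e, U, he, hx⟩ := S.exists_frame x
  have := contMDiffOn_wR (D := S.spatialDist) (U := ⟨U, he.isOpen⟩) S.g_smooth S.g_symm he
    (fun y hy => S.det_gram_frame_ne_zero he hy) S.φ_smooth.contMDiffOn lam
  exact ((this.congr fun y hy => S.weightedScal_eq he hy) x hx).contMDiffAt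
    (he.isOpen.mem_nhds hx)

end GradientRicciFlowSpacetime

end Spacetime

/-! ### Coframes, and lifts of fields and functions to the product with a line. -/

section Product

set_option linter.unusedSectionVars false

variable {E : Type*} [NormedAddCommGroup E] [NormedSpace ℝ E]
  {H : Type*} [TopologicalSpace H] {I : ModelWithCorners ℝ E H}
  {N : Type*} [TopologicalSpace N] [ChartedSpace H N] [IsManifold I ∞ N]

/-- Around every point there are coordinate functions whose differentials form a coframe, dual to a
smooth frame. -/
lemma exists_coframe [FiniteDimensional ℝ E] (x : N) :
    ∃ (O : Set N) (s : Fin (Module.finrank ℝ E) → VField I N)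
      (ξ : Fin (Module.finrank ℝ E) → N → ℝ), IsOpen O ∧ x ∈ O ∧ (∀ i, SmoothFieldOn I (s i) O) ∧
      (∀ i, ContMDiffOn I 𝓘(ℝ, ℝ) ∞ (ξ i) O) ∧
      ∀ y ∈ O, ∀ w : TangentSpace I y, w = ∑ i, mvfderiv I (ξ i) y w • s i y := by
  let t := trivializationAt E (TangentSpace I : N → Type _) x
  let b := Module.finBasis ℝ E
  let ℓ (i : Fin (Module.finrank ℝ E)) : E →L[ℝ] ℝ := LinearMap.toContinuousLinearMap (b.coord i)
  have hbase : t.baseSet = (chartAt H x).source := rfl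
  refine ⟨(chartAt H x).source, t.localFrame b, fun i => ℓ i ∘ extChartAt I x,
    (chartAt H x).open_source, mem_chart_source H x, fun i => ?_, fun i => ?_, fun y hy w => ?_⟩
  · exact t.contMDiffOn_localFrame_baseSet ∞ b i
  · exact (ℓ i).contMDiff.comp_contMDiffOn contMDiffOn_extChartAt
  · have hyt : y ∈ t.baseSet := hbase ▸ hy
    have h1 := (t.basisAt b hyt).sum_repr w
    have h2 (i) : (t.basisAt b hyt).repr w i = mvfderiv I (ℓ i ∘ extChartAt I x) y w := by
      have h3 : mvfderiv I (ℓ i ∘ extChartAt I x) y w =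
          ℓ i (mfderiv I 𝓘(ℝ, E) (extChartAt I x) y w) := by
        have := mvfderiv_comp_apply (I := 𝓘(ℝ, E)) (I' := I) (g := ℓ i) (f := extChartAt I x) y
          ((ℓ i).contMDiff.mdifferentiableAt (n := ∞) (by simp)) (mdifferentiableAt_extChartAt hy) w
        rw [this]
        have : mfderiv 𝓘(ℝ, E) 𝓘(ℝ, ℝ) (ℓ i) (extChartAt I x y) = ℓ i := (ℓ i).mfderiv_eq
        unfold mvfderiv
        rw [this]
        rfl
      rw [h3, ← TangentBundle.continuousLinearMapAt_trivializationAt hy]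
      simp only [Bundle.Trivialization.basisAt, Module.Basis.map_repr, LinearEquiv.trans_apply,
        LinearEquiv.symm_symm]
      change b.repr _ i = b.repr _ i
      congr 2
      exact (congrFun (t.coe_linearMapAt_of_mem (R := ℝ) hyt) w).symm
    conv_lhs => rw [← h1]
    refine Finset.sum_congr rfl fun i _ => ?_
    rw [h2, Bundle.Trivialization.localFrame_apply_of_mem_baseSet (hx := hyt)]

/-- The horizontal lift of a vector field to the product with the line. -/
def lift (X : VField I N) : VField (I.prod 𝓘(ℝ, ℝ)) (N × ℝ) := fun p =>
  mfderiv I (I.prod 𝓘(ℝ, ℝ)) (fun y => (y, p.2)) p.1 (X p.1)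

/-- The coordinate vector field of the line factor. -/
def lineField : VField (I.prod 𝓘(ℝ, ℝ)) (N × ℝ) := fun p =>
  mfderiv 𝓘(ℝ, ℝ) (I.prod 𝓘(ℝ, ℝ)) (fun s : ℝ => (p.1, s)) p.2 (1 : ℝ)

lemma mfderiv_fst_lift (X : VField I N) (p : N × ℝ) :
    mfderiv (I.prod 𝓘(ℝ, ℝ)) I Prod.fst p (lift X p) = X p.1 := by
  rw [lift, mfderiv_prod_left, mfderiv_fst]; rfl

lemma mfderiv_fst_lineField (p : N × ℝ) :
    mfderiv (I.prod 𝓘(ℝ, ℝ)) I Prod.fst p (lineField p) = 0 := by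
  rw [lineField, mfderiv_prod_right, mfderiv_fst]; rfl

lemma mvfderiv_snd_lift (X : VField I N) (p : N × ℝ) :
    mvfderiv (I.prod 𝓘(ℝ, ℝ)) (Prod.snd : N × ℝ → ℝ) p (lift X p) = 0 := by
  unfold mvfderiv
  rw [lift, mfderiv_prod_left, mfderiv_snd]; rfl

lemma mvfderiv_snd_lineField (p : N × ℝ) :
    mvfderiv (I.prod 𝓘(ℝ, ℝ)) (Prod.snd : N × ℝ → ℝ) p (lineField p) = 1 := by
  unfold mvfderiv
  rw [lineField, mfderiv_prod_right, mfderiv_snd]; rfl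

lemma tangent_prod_ext {p : N × ℝ} {w w' : TangentSpace (I.prod 𝓘(ℝ, ℝ)) p}
    (h1 : mfderiv (I.prod 𝓘(ℝ, ℝ)) I Prod.fst p w = mfderiv (I.prod 𝓘(ℝ, ℝ)) I Prod.fst p w')
    (h2 : mvfderiv (I.prod 𝓘(ℝ, ℝ)) (Prod.snd : N × ℝ → ℝ) p w =
      mvfderiv (I.prod 𝓘(ℝ, ℝ)) (Prod.snd : N × ℝ → ℝ) p w') : w = w' := by
  unfold mvfderiv at h2
  rw [mfderiv_fst] at h1
  rw [mfderiv_snd] at h2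
  exact Prod.ext h1 h2

lemma SmoothFieldOn.lift {X : VField I N} {U : Set N} (hX : SmoothFieldOn I X U) :
    SmoothFieldOn (I.prod 𝓘(ℝ, ℝ)) (lift X) (Prod.fst ⁻¹' U) := by
  have h1 : ContMDiffOn (I.prod 𝓘(ℝ, ℝ)) I.tangent ∞
      (fun p : N × ℝ => (⟨p.1, X p.1⟩ : TangentBundle I N)) (Prod.fst ⁻¹' U) :=
    ContMDiffOn.comp hX contMDiffOn_fst fun p hp => hp
  have h2 : ContMDiffOn (I.prod 𝓘(ℝ, ℝ)) 𝓘(ℝ, ℝ).tangent ∞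
      (fun p : N × ℝ => (⟨p.2, 0⟩ : TangentBundle 𝓘(ℝ, ℝ) ℝ)) (Prod.fst ⁻¹' U) :=
    ContMDiff.comp_contMDiffOn
      (Bundle.contMDiff_zeroSection ℝ (TangentSpace 𝓘(ℝ, ℝ) : ℝ → Type _)) contMDiffOn_snd
  refine (contMDiff_equivTangentBundleProd_symm.comp_contMDiffOn (h1.prodMk h2)).congr
    fun p _ => ?_
  rw [RicciAmbient.lift, mfderiv_prod_left]
  rfl

lemma smoothFieldOn_lineField (U : Set (N × ℝ)) :
    SmoothFieldOn (I.prod 𝓘(ℝ, ℝ)) (lineField (I := I)) U := by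
  have h1 : ContMDiffOn (I.prod 𝓘(ℝ, ℝ)) I.tangent ∞
      (fun p : N × ℝ => (⟨p.1, 0⟩ : TangentBundle I N)) U :=
    ContMDiff.comp_contMDiffOn
      (Bundle.contMDiff_zeroSection ℝ (TangentSpace I : N → Type _)) contMDiffOn_fst
  have h2 : ContMDiffOn (I.prod 𝓘(ℝ, ℝ)) 𝓘(ℝ, ℝ).tangent ∞
      (fun p : N × ℝ => (⟨p.2, (1 : ℝ)⟩ : TangentBundle 𝓘(ℝ, ℝ) ℝ)) U := by
    refine ContMDiff.comp_contMDiffOn (f := Prod.snd)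
      (g := fun s : ℝ => (⟨s, (1 : ℝ)⟩ : TangentBundle 𝓘(ℝ, ℝ) ℝ)) ?_ contMDiffOn_snd
    exact contMDiff_vectorSpace_iff_contDiff.2 contDiff_const
  refine (contMDiff_equivTangentBundleProd_symm.comp_contMDiffOn (h1.prodMk h2)).congr
    fun p _ => ?_
  rw [RicciAmbient.lineField, mfderiv_prod_right]
  rfl

lemma mvfderiv_comp_fst {f : N → ℝ} {p : N × ℝ} (hf : MDifferentiableAt I 𝓘(ℝ, ℝ) f p.1)
    (w : TangentSpace (I.prod 𝓘(ℝ, ℝ)) p) :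
    mvfderiv (I.prod 𝓘(ℝ, ℝ)) (fun q : N × ℝ => f q.1) p w =
      mvfderiv I f p.1 (mfderiv (I.prod 𝓘(ℝ, ℝ)) I Prod.fst p w) :=
  mvfderiv_comp_apply (f := Prod.fst) (g := f) p hf mdifferentiableAt_fst w

/-- The horizontal lift acts on functions pulled back from the base; no smoothness is needed. -/
lemma along_lift (X : VField I N) (f : N → ℝ) (p : N × ℝ) :
    along (I.prod 𝓘(ℝ, ℝ)) (lift X) (fun q : N × ℝ => f q.1) p = along I X f p.1 := by
  by_cases hf : MDifferentiableAt I 𝓘(ℝ, ℝ) f p.1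
  · rw [along, mvfderiv_comp_fst hf, mfderiv_fst_lift]; rfl
  -- Restriction to the slice through `p` shows that the pullback is not differentiable either, so
  -- both derivatives take the default value `0`.
  · have hf' : ¬ MDifferentiableAt (I.prod 𝓘(ℝ, ℝ)) 𝓘(ℝ, ℝ) (fun q : N × ℝ => f q.1) p := by
      intro h
      refine hf ?_
      have h0 : MDifferentiableAt I (I.prod 𝓘(ℝ, ℝ)) (fun y : N => (y, p.2)) p.1 :=
        mdifferentiableAt_id.prodMk mdifferentiableAt_const
      exact MDifferentiableAt.comp (f := fun y : N => (y, p.2)) p.1 h h0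
    simp [along, mvfderiv, mfderiv_zero_of_not_mdifferentiableAt hf,
      mfderiv_zero_of_not_mdifferentiableAt hf']

lemma along_lineField_comp_fst {f : N → ℝ} {p : N × ℝ} (hf : MDifferentiableAt I 𝓘(ℝ, ℝ) f p.1) :
    along (I.prod 𝓘(ℝ, ℝ)) lineField (fun q : N × ℝ => f q.1) p = 0 := by
  rw [along, mvfderiv_comp_fst hf, mfderiv_fst_lineField, map_zero]

end Product

/-! ### Brackets of lifts, pullback of forms, and leafwise geometry of lifts. -/

section Naturality

set_option linter.unusedSectionVars false

variable {E : Type*} [NormedAddCommGroup E] [NormedSpace ℝ E] [FiniteDimensional ℝ E]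
  {H : Type*} [TopologicalSpace H] {I : ModelWithCorners ℝ E H}
  {N : Type*} [TopologicalSpace N] [ChartedSpace H N] [IsManifold I ∞ N]

/-- A tangent vector is determined by its action on smooth functions. -/
lemma tangent_ext {x : N} {w w' : TangentSpace I x}
    (h : ∀ (O : Set N) (f : N → ℝ), IsOpen O → x ∈ O → ContMDiffOn I 𝓘(ℝ, ℝ) ∞ f O →
      mvfderiv I f x w = mvfderiv I f x w') : w = w' := by
  obtain ⟨O, s, ξ, hO, hx, -, hξ, hw⟩ := exists_coframe (I := I) x
  rw [hw x hx w, hw x hx w']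
  exact Finset.sum_congr rfl fun i _ => by rw [h O (ξ i) hO hx (hξ i)]

lemma preimage_fst_mem_nhds {U : Set N} (hU : IsOpen U) {p : N × ℝ} (hp : p.1 ∈ U) :
    Prod.fst ⁻¹' U ∈ 𝓝 p :=
  (hU.preimage continuous_fst).mem_nhds hp

/-- A tangent vector of the product is tested on functions pulled back from `N` and on the line
coordinate. Lifts act on the former as the original fields and annihilate the latter. -/
lemma mlieBracket_lift {X Y : VField I N} {U : Set N} (hU : IsOpen U) (hX : SmoothFieldOn I X U)
    (hY : SmoothFieldOn I Y U) {p : N × ℝ} (hp : p.1 ∈ U) :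
    mlieBracket (I.prod 𝓘(ℝ, ℝ)) (lift X) (lift Y) p = lift (mlieBracket I X Y) p := by
  have : CompleteSpace E := FiniteDimensional.complete ℝ E
  refine tangent_prod_ext ?_ ?_
  · rw [mfderiv_fst_lift]
    refine tangent_ext fun O f hO hpO hf => ?_
    have hOU := hO.inter hU
    replace hX := hX.mono (W := O ∩ U) Set.inter_subset_right
    replace hY := hY.mono (W := O ∩ U) Set.inter_subset_right
    replace hf := hf.mono (t := O ∩ U) Set.inter_subset_left
    have hm : p.1 ∈ O ∩ U := ⟨hpO, hp⟩
    have h1 := along_lieBracket hOU hX hY hf hm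
    have h2 := along_lieBracket (hOU.preimage continuous_fst) hX.lift hY.lift
      (f := fun q : N × ℝ => f q.1) (hf.comp contMDiffOn_fst fun q hq => hq) hm
    have h3 (X : VField I N) : along (I.prod 𝓘(ℝ, ℝ)) (lift X) (fun q : N × ℝ => f q.1) =
        fun q => along I X f q.1 := funext fun q => along_lift X f q
    rw [h3, h3, along_lift, along_lift, ← h1, along,
      mvfderiv_comp_fst (mdiffAt_of_contMDiffOn hOU hf hm)] at h2
    exact h2
  · rw [mvfderiv_snd_lift]
    have h := along_lieBracket (hU.preimage continuous_fst) hX.lift hY.lift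
      (f := (Prod.snd : N × ℝ → ℝ)) contMDiffOn_snd hp
    have h3 (X : VField I N) : along (I.prod 𝓘(ℝ, ℝ)) (lift X) (Prod.snd : N × ℝ → ℝ) =
        fun q => 0 := funext fun q => mvfderiv_snd_lift X q
    rw [h3, h3] at h
    simpa [along, mvfderiv_const] using h

lemma mlieBracket_lineField_lift {X : VField I N} {U : Set N} (hU : IsOpen U)
    (hX : SmoothFieldOn I X U) {p : N × ℝ} (hp : p.1 ∈ U) :
    mlieBracket (I.prod 𝓘(ℝ, ℝ)) lineField (lift X) p = 0 := by
  have : CompleteSpace E := FiniteDimensional.complete ℝ E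
  refine tangent_prod_ext ?_ ?_
  · refine tangent_ext fun O f hO hpO hf => ?_
    have hOU := hO.inter hU
    replace hX := hX.mono (W := O ∩ U) Set.inter_subset_right
    replace hf := hf.mono (t := O ∩ U) Set.inter_subset_left
    have hm : p.1 ∈ O ∩ U := ⟨hpO, hp⟩
    have h2 := along_lieBracket (hOU.preimage continuous_fst) (smoothFieldOn_lineField _) hX.lift
      (f := fun q : N × ℝ => f q.1) (hf.comp contMDiffOn_fst fun q hq => hq) hm
    have h3 : along (I.prod 𝓘(ℝ, ℝ)) (lift X) (fun q : N × ℝ => f q.1) =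
        fun q => along I X f q.1 := funext fun q => along_lift X f q
    have h4 : along (I.prod 𝓘(ℝ, ℝ)) (lift X)
        (along (I.prod 𝓘(ℝ, ℝ)) lineField (fun q : N × ℝ => f q.1)) p = 0 := by
      rw [along_congr (f' := fun _ => 0) rfl]
      · simp [along, mvfderiv_const]
      · filter_upwards [preimage_fst_mem_nhds hOU hm] with q hq
        exact along_lineField_comp_fst (mdiffAt_of_contMDiffOn hOU hf hq)
    rw [h3, h4, along_lineField_comp_fst (mdiffAt_of_contMDiffOn hOU (hX.along hOU hf) hm), along,
      mvfderiv_comp_fst (mdiffAt_of_contMDiffOn hOU hf hm)] at h2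
    rw [h2, map_zero, map_zero, sub_zero]
  · have h := along_lieBracket (hU.preimage continuous_fst) (smoothFieldOn_lineField _) hX.lift
      (f := (Prod.snd : N × ℝ → ℝ)) contMDiffOn_snd hp
    have h3 : along (I.prod 𝓘(ℝ, ℝ)) (lift X) (Prod.snd : N × ℝ → ℝ) =
        fun q => 0 := funext fun q => mvfderiv_snd_lift X q
    have h4 : along (I.prod 𝓘(ℝ, ℝ)) (lineField (I := I)) (Prod.snd : N × ℝ → ℝ) =
        fun q => 1 := funext fun q => mvfderiv_snd_lineField q
    rw [h3, h4] at h
    simpa [along, mvfderiv_const] using h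

/-- The pullback of a smooth form under the projection is smooth. -/
lemma SmoothForm.comp_fst {g : FormField I N} (hg : SmoothForm I g) :
    SmoothForm (I.prod 𝓘(ℝ, ℝ)) (N := N × ℝ) (fun p =>
      LinearMap.BilinForm.comp (g p.1)
        (mfderiv (I.prod 𝓘(ℝ, ℝ)) I (Prod.fst : N × ℝ → N) p).toLinearMap
        (mfderiv (I.prod 𝓘(ℝ, ℝ)) I (Prod.fst : N × ℝ → N) p).toLinearMap) := by
  intro U X Y hU hX hY p hp
  -- The projection of a field on the product need not be a field on `N`, so it is expanded in a
  -- frame pulled back from `N`; the coefficients are derivatives of coordinate functions.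
  obtain ⟨O, s, ξ, hO, hpO, hs, hξ, hw⟩ := exists_coframe (I := I) p.1
  let W : Set (N × ℝ) := U ∩ Prod.fst ⁻¹' O
  have hW : IsOpen W := hU.inter (hO.preimage continuous_fst)
  have hξ' (i) : ContMDiffOn (I.prod 𝓘(ℝ, ℝ)) 𝓘(ℝ, ℝ) ∞ (fun q : N × ℝ => ξ i q.1) W :=
    (hξ i).comp contMDiffOn_fst fun q hq => hq.2
  have hc {X : VField (I.prod 𝓘(ℝ, ℝ)) (N × ℝ)} (hX : SmoothFieldOn (I.prod 𝓘(ℝ, ℝ)) X U) (i) :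
      ContMDiffOn (I.prod 𝓘(ℝ, ℝ)) 𝓘(ℝ, ℝ) ∞
        (along (I.prod 𝓘(ℝ, ℝ)) X fun q : N × ℝ => ξ i q.1) W :=
    (hX.mono Set.inter_subset_left).along hW (hξ' i)
  have hgs (i j) : ContMDiffOn (I.prod 𝓘(ℝ, ℝ)) 𝓘(ℝ, ℝ) ∞
      (fun q : N × ℝ => g q.1 (s i q.1) (s j q.1)) W :=
    (hg O (s i) (s j) hO (hs i) (hs j)).comp contMDiffOn_fst fun q hq => hq.2
  have main : ContMDiffOn (I.prod 𝓘(ℝ, ℝ)) 𝓘(ℝ, ℝ) ∞ (fun q : N × ℝ => ∑ i, ∑ j,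
      along (I.prod 𝓘(ℝ, ℝ)) X (fun q : N × ℝ => ξ i q.1) q
        * (along (I.prod 𝓘(ℝ, ℝ)) Y (fun q : N × ℝ => ξ j q.1) q
        * g q.1 (s i q.1) (s j q.1))) W :=
    contMDiffOn_finsetSum fun i _ => contMDiffOn_finsetSum fun j _ =>
      (hc hX i).mul ((hc hY j).mul (hgs i j))
  have hexp (X : VField (I.prod 𝓘(ℝ, ℝ)) (N × ℝ)) (q : N × ℝ) (hq : q ∈ W) :
      mfderiv (I.prod 𝓘(ℝ, ℝ)) I (Prod.fst : N × ℝ → N) q (X q) =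
        ∑ i, along (I.prod 𝓘(ℝ, ℝ)) X (fun q : N × ℝ => ξ i q.1) q • s i q.1 := by
    rw [hw q.1 hq.2 (mfderiv (I.prod 𝓘(ℝ, ℝ)) I (Prod.fst : N × ℝ → N) q (X q))]
    refine Finset.sum_congr rfl fun i _ => ?_
    rw [along, mvfderiv_comp_fst (mdiffAt_of_contMDiffOn hO (hξ i) hq.2)]
  refine (((main.congr fun q hq => ?_) p ⟨hp, hpO⟩).contMDiffAt
    (hW.mem_nhds ⟨hp, hpO⟩)).contMDiffWithinAt
  change g q.1 (mfderiv (I.prod 𝓘(ℝ, ℝ)) I (Prod.fst : N × ℝ → N) q (X q))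
    (mfderiv (I.prod 𝓘(ℝ, ℝ)) I (Prod.fst : N × ℝ → N) q (Y q)) = _
  rw [hexp X q hq, hexp Y q hq]
  simp only [map_sum, map_smul, LinearMap.sum_apply, LinearMap.smul_apply, smul_eq_mul,
    Finset.mul_sum]
  rw [Finset.sum_comm]
  exact Finset.sum_congr rfl fun i _ => Finset.sum_congr rfl fun j _ => mul_left_comm _ _ _

/-! Leafwise geometry of horizontal lifts. -/

variable {ι : Type*} [Fintype ι] [DecidableEq ι] {g : FormField I N}
  {G : FormField (I.prod 𝓘(ℝ, ℝ)) (N × ℝ)} {e : ι → VField I N} {U : Set N}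

/-- The form `G` restricts to the pullback of `g` on the horizontal lifts of the family `e`. -/
structure LiftsForm (g : FormField I N) (G : FormField (I.prod 𝓘(ℝ, ℝ)) (N × ℝ))
    (e : ι → VField I N) (U : Set N) : Prop where
  isOpen : IsOpen U
  smooth : ∀ a, SmoothFieldOn I (e a) U
  apply : ∀ p : N × ℝ, p.1 ∈ U → ∀ (X : VField I N) a,
    G p (lift X p) (lift (e a) p) = g p.1 (X p.1) (e a p.1)

namespace LiftsForm

variable (h : LiftsForm g G e U)
include h

lemma gram_eq {p : N × ℝ} (hp : p.1 ∈ U) :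
    gram (I.prod 𝓘(ℝ, ℝ)) G (fun a => lift (e a)) p = gram I g e p.1 := by
  ext a b
  exact h.apply p hp _ b

lemma gramInv_eq {p : N × ℝ} (hp : p.1 ∈ U) :
    gramInv (I.prod 𝓘(ℝ, ℝ)) G (fun a => lift (e a)) p = gramInv I g e p.1 := by
  rw [gramInv, gramInv, h.gram_eq hp]

lemma along_eq {p : N × ℝ} (hp : p.1 ∈ U) {F : N × ℝ → ℝ} {f : N → ℝ}
    (hF : ∀ q : N × ℝ, q.1 ∈ U → F q = f q.1) (X : VField I N) :
    along (I.prod 𝓘(ℝ, ℝ)) (lift X) F p = along I X f p.1 := by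
  rw [← along_lift, along_congr rfl]
  filter_upwards [preimage_fst_mem_nhds h.isOpen hp] with q hq using hF q hq

/-- The bracket need not be one of the `e a`; this is why `LiftsForm.apply` allows an arbitrary lift
in the first slot. -/
lemma bracket_eq {p : N × ℝ} (hp : p.1 ∈ U) (a b c : ι) :
    G p (mlieBracket (I.prod 𝓘(ℝ, ℝ)) (lift (e a)) (lift (e b)) p) (lift (e c) p) =
      g p.1 (mlieBracket I (e a) (e b) p.1) (e c p.1) := by
  rw [mlieBracket_lift h.isOpen (h.smooth a) (h.smooth b) hp, h.apply p hp]

lemma koszul_eq {p : N × ℝ} (hp : p.1 ∈ U) (a b c : ι) :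
    koszul (I.prod 𝓘(ℝ, ℝ)) G (lift (e a)) (lift (e b)) (lift (e c)) p =
      koszul I g (e a) (e b) (e c) p.1 := by
  have hF (a b c : ι) : along (I.prod 𝓘(ℝ, ℝ)) (lift (e a))
      (fun q => G q (lift (e b) q) (lift (e c) q)) p =
        along I (e a) (fun y => g y (e b y) (e c y)) p.1 :=
    h.along_eq hp (f := fun y => g y (e b y) (e c y)) (fun q hq => h.apply q hq _ c) _
  simp only [koszul, h.bracket_eq hp, hF]

lemma connCoeff_eq {p : N × ℝ} (hp : p.1 ∈ U) (a b d : ι) :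
    connCoeff (I.prod 𝓘(ℝ, ℝ)) G (fun a => lift (e a)) a b d p = connCoeff I g e a b d p.1 := by
  simp only [connCoeff, h.koszul_eq hp, h.gramInv_eq hp]

lemma structFun_eq {p : N × ℝ} (hp : p.1 ∈ U) (a b d : ι) :
    structFun (I.prod 𝓘(ℝ, ℝ)) G (fun a => lift (e a)) a b d p = structFun I g e a b d p.1 := by
  simp only [structFun, h.bracket_eq hp, h.gramInv_eq hp]

lemma ric_eq {p : N × ℝ} (hp : p.1 ∈ U) (b c : ι) :
    ric (I.prod 𝓘(ℝ, ℝ)) G (fun a => lift (e a)) b c p = ric I g e b c p.1 := by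
  simp only [ric, riem, h.connCoeff_eq hp, h.structFun_eq hp]
  refine Finset.sum_congr rfl fun a _ => ?_
  rw [h.along_eq hp fun q hq => h.connCoeff_eq hq b c a,
    h.along_eq hp fun q hq => h.connCoeff_eq hq a c a]

lemma scal_eq {p : N × ℝ} (hp : p.1 ∈ U) :
    scal (I.prod 𝓘(ℝ, ℝ)) G (fun a => lift (e a)) p = scal I g e p.1 := by
  simp only [scal, h.ric_eq hp, h.gramInv_eq hp]

lemma hess_eq {p : N × ℝ} (hp : p.1 ∈ U) (φ : N → ℝ) (a b : ι) :
    hess (I.prod 𝓘(ℝ, ℝ)) G (fun a => lift (e a)) (fun q => φ q.1) a b p =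
      hess I g e φ a b p.1 := by
  simp only [hess, h.connCoeff_eq hp, along_lift]
  rw [h.along_eq hp fun q _ => along_lift (e b) φ q]

lemma lap_eq {p : N × ℝ} (hp : p.1 ∈ U) (φ : N → ℝ) :
    lap (I.prod 𝓘(ℝ, ℝ)) G (fun a => lift (e a)) (fun q => φ q.1) p = lap I g e φ p.1 := by
  simp only [lap, h.hess_eq hp, h.gramInv_eq hp]

lemma gradSq_eq {p : N × ℝ} (hp : p.1 ∈ U) (φ : N → ℝ) :
    gradSq (I.prod 𝓘(ℝ, ℝ)) G (fun a => lift (e a)) (fun q => φ q.1) p = gradSq I g e φ p.1 := by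
  simp only [gradSq, h.gramInv_eq hp, along_lift]

end LiftsForm

end Naturality

/-- The factor is an exponential, hence positive at all times. This makes the ambient metric smooth
and non-degenerate on all of `M × ℝ`. -/
lemma one_sub_lam_mul_uCoord (lam t₀ t : ℝ) :
    1 - lam * uCoord lam t₀ t = Real.exp (lam * (t - t₀)) := by
  by_cases h : lam = 0
  · simp [h]
  · rw [uCoord, if_neg h]; field_simp; ring

lemma uCoord_nonpos_iff (lam t₀ t : ℝ) : uCoord lam t₀ t ≤ 0 ↔ t₀ ≤ t := by
  by_cases h : lam = 0
  · simp [uCoord, h]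
  · rw [uCoord, if_neg h]
    rcases lt_or_gt_of_ne h with h | h
    · rw [div_nonpos_iff]
      constructor
      · rintro (⟨h1, -⟩ | ⟨-, h1⟩)
        · have : Real.exp (lam * (t - t₀)) ≤ 1 := by linarith
          rw [Real.exp_le_one_iff] at this
          nlinarith
        · linarith
      · intro h1
        have : Real.exp (lam * (t - t₀)) ≤ 1 := by
          rw [Real.exp_le_one_iff]; nlinarith
        exact Or.inl ⟨by linarith, h.le⟩
    · rw [div_le_iff₀ h, zero_mul, sub_nonpos, ← Real.exp_zero, Real.exp_le_exp,
        mul_nonneg_iff_of_pos_left h, sub_nonneg]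

lemma contDiff_uCoord (lam t₀ : ℝ) : ContDiff ℝ ∞ (uCoord lam t₀) := by
  by_cases h : lam = 0
  · have : uCoord lam t₀ = fun s => t₀ - s := by funext s; simp [uCoord, h]
    rw [this]; fun_prop
  · have : uCoord lam t₀ = fun s => (1 - Real.exp (lam * (s - t₀))) / lam := by
      funext s; simp [uCoord, h]
    rw [this]; fun_prop

/-! ### Values, smoothness and invariance of the ambient metric and potential. -/

section AmbientMetric

set_option linter.unusedSectionVars false

variable {n : ℕ} {M : Type*} [TopologicalSpace M] [ChartedSpace (EuclideanHalfSpace (n + 1)) M]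
  [IsManifold (𝓡∂ (n + 1)) ∞ M] {lam : ℝ}

namespace GradientRicciFlowSpacetime

variable (S : GradientRicciFlowSpacetime n M lam) (t₀ : ℝ)

lemma u_smooth : ContMDiff (prodModel n) 𝓘(ℝ, ℝ) ∞ (S.u t₀) :=
  (contDiff_uCoord lam t₀).contMDiff.comp (S.time_smooth.comp contMDiff_fst)

lemma one_sub_pos (p : M × ℝ) : 0 < 1 - lam * S.u t₀ p := by
  rw [u, one_sub_lam_mul_uCoord]; exact Real.exp_pos _

lemma du_apply (p : M × ℝ) (w : TangentSpace (prodModel n) p) :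
    S.du t₀ p w = -(1 - lam * S.u t₀ p) * mvfderiv (𝓡∂ (n + 1)) S.time p.1 (dπ p w) := by
  have ht := S.time_smooth.mdifferentiableAt (x := p.1) (by simp)
  have h1 := mvfderiv_comp_apply (I := 𝓘(ℝ, ℝ)) (I' := prodModel n)
    (f := fun q : M × ℝ => S.time q.1) (g := uCoord lam t₀) p
    ((hasDerivAt_uCoord lam t₀ _).differentiableAt.mdifferentiableAt)
    (ht.comp p mdifferentiableAt_fst) w
  have h2 := mvfderiv_comp_fst ht w
  have h3 (r : ℝ) :
      mvfderiv 𝓘(ℝ, ℝ) (uCoord lam t₀) (S.time p.1) r = r * -(1 - lam * S.u t₀ p) := by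
    have : mfderiv 𝓘(ℝ, ℝ) 𝓘(ℝ, ℝ) (uCoord lam t₀) (S.time p.1) =
      fderiv ℝ (uCoord lam t₀) (S.time p.1) := mfderiv_eq_fderiv
    unfold mvfderiv
    rw [this, (hasDerivAt_uCoord lam t₀ (S.time p.1)).hasFDerivAt.fderiv]
    exact ContinuousLinearMap.toSpanSingleton_apply (R₁ := ℝ) _ r
  change mvfderiv (prodModel n) (uCoord lam t₀ ∘ fun q : M × ℝ => S.time q.1) p w = _
  refine h1.trans ((h3 _).trans ((mul_comm _ _).trans (congrArg _ ?_)))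
  exact h2

lemma dπ_lift (X : VField (𝓡∂ (n + 1)) M) (p : M × ℝ) : dπ p (lift X p) = X p.1 :=
  mfderiv_fst_lift X p

lemma dπ_vertField (p : M × ℝ) : dπ (n := n) p (vertField p) = 0 :=
  mfderiv_fst_lineField p

lemma dv_lift (X : VField (𝓡∂ (n + 1)) M) (p : M × ℝ) : dv p (lift X p) = 0 :=
  mvfderiv_snd_lift X p

lemma dv_vertField (p : M × ℝ) : dv (n := n) p (vertField p) = 1 :=
  mvfderiv_snd_lineField p

lemma du_vertField (p : M × ℝ) : S.du t₀ p (vertField p) = 0 := by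
  rw [du_apply, dπ_vertField, map_zero, mul_zero]

lemma du_lift (X : VField (𝓡∂ (n + 1)) M) (p : M × ℝ) :
    S.du t₀ p (lift X p) = -(1 - lam * S.u t₀ p) * mvfderiv (𝓡∂ (n + 1)) S.time p.1 (X p.1) := by
  rw [du_apply, dπ_lift]

lemma du_lift_of_mem {X : VField (𝓡∂ (n + 1)) M} {p : M × ℝ} (h : X p.1 ∈ spatial S.time p.1) :
    S.du t₀ p (lift X p) = 0 := by
  rw [du_lift, S.mem_spatial.1 h, mul_zero]

lemma du_lift_dt (p : M × ℝ) : S.du t₀ p (lift S.dt p) = -(1 - lam * S.u t₀ p) := by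
  have := S.dt_time p.1
  rw [along] at this
  rw [du_lift, this, mul_one]

lemma ambientMetric_apply (p : M × ℝ) (X Y : TangentSpace (prodModel n) p) :
    S.ambientMetric t₀ p X Y = S.du t₀ p X * dv p Y + dv p X * S.du t₀ p Y
      + S.g p.1 (dπ p X) (dπ p Y)
      - ((1 - lam * S.u t₀ p) ^ 2)⁻¹ * (S.weightedScal p.1 * (S.du t₀ p X * S.du t₀ p Y)) := rfl

lemma ambientMetric_symm (p : M × ℝ) (X Y : TangentSpace (prodModel n) p) :
    S.ambientMetric t₀ p X Y = S.ambientMetric t₀ p Y X := by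
  rw [ambientMetric_apply, ambientMetric_apply, S.g_symm]; ring

lemma ambientMetric_vertField (p : M × ℝ) (Z : TangentSpace (prodModel n) p) :
    S.ambientMetric t₀ p (vertField p) Z = S.du t₀ p Z := by
  rw [ambientMetric_apply, du_vertField, dv_vertField, dπ_vertField]; simp

lemma ambientMetric_lift {X Y : VField (𝓡∂ (n + 1)) M} {p : M × ℝ}
    (h : Y p.1 ∈ spatial S.time p.1) :
    S.ambientMetric t₀ p (lift X p) (lift Y p) = S.g p.1 (X p.1) (Y p.1) := by
  rw [ambientMetric_apply, S.du_lift_of_mem t₀ h, dv_lift, dv_lift, dπ_lift, dπ_lift]; simp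

/-- The factor `(1 - lam u)⁻²` of the metric cancels the square of `du(∂_t) = -(1 - lam u)`. -/
lemma ambientMetric_dt_dt (p : M × ℝ) :
    S.ambientMetric t₀ p (lift S.dt p) (lift S.dt p) = -S.weightedScal p.1 := by
  have := (S.one_sub_pos t₀ p).ne'
  rw [ambientMetric_apply, du_lift_dt, dv_lift, dπ_lift, S.g_dt]
  field_simp
  ring

lemma ambientMetric_smooth : SmoothForm (prodModel n) (S.ambientMetric t₀) := by
  intro U X Y hU hX hY
  have hdu {X : VField (prodModel n) (M × ℝ)} (hX : SmoothFieldOn (prodModel n) X U) :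
      ContMDiffOn (prodModel n) 𝓘(ℝ, ℝ) ∞ (fun p => S.du t₀ p (X p)) U :=
    hX.along hU (S.u_smooth t₀).contMDiffOn
  have hdv {X : VField (prodModel n) (M × ℝ)} (hX : SmoothFieldOn (prodModel n) X U) :
      ContMDiffOn (prodModel n) 𝓘(ℝ, ℝ) ∞ (fun p => dv p (X p)) U :=
    hX.along hU contMDiffOn_snd
  have hg : ContMDiffOn (prodModel n) 𝓘(ℝ, ℝ) ∞ (fun p => S.g p.1 (dπ p (X p)) (dπ p (Y p))) U :=
    S.g_smooth.comp_fst U X Y hU hX hY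
  have hw : ContMDiffOn (prodModel n) 𝓘(ℝ, ℝ) ∞ (fun p => ((1 - lam * S.u t₀ p) ^ 2)⁻¹) U :=
    ContMDiffOn.inv₀ ((contMDiffOn_const.sub
      (contMDiffOn_const.mul (S.u_smooth t₀).contMDiffOn)).pow 2)
      fun p _ => pow_ne_zero 2 (S.one_sub_pos t₀ p).ne'
  have hρ : ContMDiffOn (prodModel n) 𝓘(ℝ, ℝ) ∞ (fun p : M × ℝ => S.weightedScal p.1) U :=
    (S.weightedScal_smooth.comp contMDiff_fst).contMDiffOn
  exact ((((hdu hX).mul (hdv hY)).add ((hdv hX).mul (hdu hY))).add hg).sub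
    (hw.mul (hρ.mul ((hdu hX).mul (hdu hY))))

lemma ambientPotential_smooth :
    ContMDiff (prodModel n) 𝓘(ℝ, ℝ) ∞ (S.ambientPotential t₀) :=
  ((S.φ_smooth.comp contMDiff_fst).sub contMDiff_snd).add
    ((contMDiff_const.mul (S.u_smooth t₀)).mul contMDiff_snd)

lemma ambientPotential_dilation (s : ℝ) (p : M × ℝ) :
    S.ambientPotential t₀ (S.dilation t₀ s p) = S.ambientPotential t₀ p + s := by
  have h : lam * S.u t₀ p - 1 ≠ 0 := by
    have := S.one_sub_pos t₀ p
    linarith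
  have hu : S.u t₀ (S.dilation t₀ s p) = S.u t₀ p := rfl
  rw [ambientPotential, ambientPotential, hu]
  simp only [dilation]
  field_simp
  ring

lemma dπ_mfderiv_vertShift (s : ℝ) (p : M × ℝ) (X : TangentSpace (prodModel n) p) :
    dπ (vertShift s p) (mfderiv (prodModel n) (prodModel n) (vertShift (M := M) s) p X) =
      dπ p X := by
  have hs : MDifferentiableAt (prodModel n) (prodModel n) (vertShift (M := M) s) p :=
    mdifferentiableAt_fst.prodMk
      ((contMDiff_snd.add contMDiff_const).mdifferentiableAt (n := 1) (by simp))
  exact (mfderiv_comp_apply (I'' := 𝓡∂ (n + 1)) (g := Prod.fst) (f := vertShift (M := M) s) p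
    mdifferentiableAt_fst hs X).symm

lemma dv_mfderiv_vertShift (s : ℝ) (p : M × ℝ) (X : TangentSpace (prodModel n) p) :
    dv (vertShift s p) (mfderiv (prodModel n) (prodModel n) (vertShift (M := M) s) p X) =
      dv p X := by
  have hs : MDifferentiableAt (prodModel n) (prodModel n) (vertShift (M := M) s) p :=
    mdifferentiableAt_fst.prodMk
      ((contMDiff_snd.add contMDiff_const).mdifferentiableAt (n := 1) (by simp))
  have h1 := mvfderiv_comp_apply (I := prodModel n) (g := (Prod.snd : M × ℝ → ℝ))
    (f := vertShift (M := M) s) p mdifferentiableAt_snd hs X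
  have h2 := mvfderiv_add (I := prodModel n) (g := (Prod.snd : M × ℝ → ℝ)) (g' := fun _ => s)
    (x := p) mdifferentiableAt_snd mdifferentiableAt_const
  rw [mvfderiv_const, add_zero] at h2
  have h3 : (Prod.snd : M × ℝ → ℝ) ∘ vertShift s = Prod.snd + fun _ => s := rfl
  rw [h3, h2] at h1
  exact h1.symm

lemma ambientMetric_vertShift (s : ℝ) (p : M × ℝ) (X Y : TangentSpace (prodModel n) p) :
    S.ambientMetric t₀ (vertShift s p)
      (mfderiv (prodModel n) (prodModel n) (vertShift (M := M) s) p X)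
      (mfderiv (prodModel n) (prodModel n) (vertShift (M := M) s) p Y) =
        S.ambientMetric t₀ p X Y := by
  have hu : S.u t₀ (vertShift s p) = S.u t₀ p := rfl
  have hdu (X : TangentSpace (prodModel n) p) : S.du t₀ (vertShift s p)
      (mfderiv (prodModel n) (prodModel n) (vertShift (M := M) s) p X) = S.du t₀ p X := by
    rw [du_apply, du_apply, dπ_mfderiv_vertShift]; rfl
  rw [ambientMetric_apply, ambientMetric_apply, hdu, hdu, dv_mfderiv_vertShift,
    dv_mfderiv_vertShift, dπ_mfderiv_vertShift, dπ_mfderiv_vertShift]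
  rfl

end GradientRicciFlowSpacetime

end AmbientMetric

/-! ### Non-degeneracy and Lorentzian signature. -/

section Signature

set_option linter.unusedSectionVars false

/-- A positive definite form has an orthonormal family of full cardinality. -/
lemma exists_orthonormal {V : Type*} [AddCommGroup V] [Module ℝ V] [FiniteDimensional ℝ V] {n : ℕ}
    (hn : Module.finrank ℝ V = n) (B : LinearMap.BilinForm ℝ V) (symm : ∀ X Y, B X Y = B Y X)
    (pos : ∀ X, X ≠ 0 → 0 < B X X) :
    ∃ f : Fin n → V, ∀ a b, B (f a) (f b) = if a = b then 1 else 0 := by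
  subst hn
  obtain ⟨v, hv⟩ := LinearMap.BilinForm.exists_orthogonal_basis (B := B) ⟨symm⟩
  refine ⟨fun a => (√(B (v a) (v a)))⁻¹ • v a, fun a b => ?_⟩
  simp only [map_smul, LinearMap.smul_apply, smul_eq_mul]
  split_ifs with h
  · subst h
    have hp := pos (v a) (v.ne_zero a)
    have h1 := Real.mul_self_sqrt hp.le
    have h2 := (Real.sqrt_pos.2 hp).ne'
    field_simp
    rw [sq, h1]
  · have : B (v a) (v b) = 0 := hv h
    rw [this, mul_zero, mul_zero]

variable {n : ℕ} {M : Type*} [TopologicalSpace M] [ChartedSpace (EuclideanHalfSpace (n + 1)) M]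
  [IsManifold (𝓡∂ (n + 1)) ∞ M] {lam : ℝ}

lemma finrank_tangent_prod (p : M × ℝ) :
    Module.finrank ℝ (TangentSpace (prodModel n) p) = n + 2 := by
  have : Module.finrank ℝ (EuclideanSpace ℝ (Fin (n + 1)) × ℝ) = n + 2 := by
    rw [Module.finrank_prod, finrank_euclideanSpace_fin, Module.finrank_self]
  exact this

namespace GradientRicciFlowSpacetime

variable (S : GradientRicciFlowSpacetime n M lam) (t₀ : ℝ)

/-- Pairing with `∂_v` kills `du X`, pairing with the lift of the projection of `X` then kills that
projection by positivity, and pairing with `∂_t` kills `dv X`. -/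
lemma ambientMetric_nondegenerate {p : M × ℝ} {X : TangentSpace (prodModel n) p}
    (h : ∀ Y, S.ambientMetric t₀ p X Y = 0) : X = 0 := by
  have hw := (S.one_sub_pos t₀ p).ne'
  have hdu : S.du t₀ p X = 0 := by
    rw [← ambientMetric_vertField, ambientMetric_symm, h]
  have hs : dπ p X ∈ spatial S.time p.1 := by
    rw [du_apply] at hdu
    exact (mul_eq_zero.1 hdu).resolve_left (neg_ne_zero.2 hw)
  have hπ : dπ p X = 0 := by
    by_contra hne
    obtain ⟨Z, -, -, -, -, hZ⟩ := exists_smoothFieldOn p.1 (dπ p X)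
    have hZs : Z p.1 ∈ spatial S.time p.1 := hZ ▸ hs
    have h1 := h (lift Z p)
    rw [ambientMetric_apply, hdu, S.du_lift_of_mem t₀ hZs, dπ_lift, hZ] at h1
    have := S.g_pos p.1 _ hs hne
    simp at h1
    linarith
  have hdv : dv p X = 0 := by
    have h1 := h (lift S.dt p)
    rw [ambientMetric_apply, hdu, hπ, S.du_lift_dt] at h1
    simp only [zero_mul, map_zero, LinearMap.zero_apply, mul_zero, add_zero, zero_add,
      sub_zero] at h1
    exact (mul_eq_zero.1 h1).resolve_right (neg_ne_zero.2 hw)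
  exact tangent_prod_ext (hπ.trans (map_zero (dπ p)).symm) (hdv.trans (map_zero (dv p)).symm)

lemma exists_orthonormal_spatial (x : M) : ∃ f : Fin n → TangentSpace (𝓡∂ (n + 1)) x,
    (∀ a, f a ∈ spatial S.time x) ∧ ∀ a b, S.g x (f a) (f b) = if a = b then 1 else 0 := by
  have hfd : FiniteDimensional ℝ (TangentSpace (𝓡∂ (n + 1)) x) :=
    inferInstanceAs (FiniteDimensional ℝ (EuclideanSpace ℝ (Fin (n + 1))))
  obtain ⟨f, hf⟩ := exists_orthonormal (V := spatial (n := n) S.time x) (S.finrank_spatial x)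
    ((S.g x).restrict (spatial S.time x)) (fun X Y => S.g_symm x X Y)
    (fun X hX => S.g_pos x X X.2 fun h => hX (Subtype.ext h))
  exact ⟨fun a => f a, fun a => (f a).2, hf⟩

/-- The ambient metric is Lorentzian. -/
theorem ambientMetric_signature (p : M × ℝ) :
    HasLorentzSignature (n + 1) (S.ambientMetric t₀ p) := by
  have hfd : FiniteDimensional ℝ (TangentSpace (prodModel n) p) :=
    inferInstanceAs (FiniteDimensional ℝ (EuclideanSpace ℝ (Fin (n + 1)) × ℝ))
  obtain ⟨f, hf, hfo⟩ := S.exists_orthonormal_spatial p.1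
  choose e _ _ _ _ he using fun a => exists_smoothFieldOn p.1 (f a)
  have hes (a : Fin n) : e a p.1 ∈ spatial S.time p.1 := by rw [he]; exact hf a
  have hw := (S.one_sub_pos t₀ p).ne'
  let G := S.ambientMetric t₀ p
  let w := 1 - lam * S.u t₀ p
  let ρ := S.weightedScal p.1
  -- The vector `∂_t + c ∂_v` has square `-ρ - 2 c w`. The two values of `c` make this `1` and `-1`,
  -- and their sum `-ρ / w` makes `b₁` and `b₂` orthogonal.
  let b₁ : TangentSpace (prodModel n) p := lift S.dt p + (-ρ / (2 * w) - 1 / (2 * w)) • vertField p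
  let b₂ : TangentSpace (prodModel n) p := lift S.dt p + (-ρ / (2 * w) + 1 / (2 * w)) • vertField p
  let b : Fin (n + 1) ⊕ Fin 1 → TangentSpace (prodModel n) p :=
    Sum.elim (Fin.cons b₁ fun a => lift (e a) p) fun _ => b₂
  have gVV : G (vertField p) (vertField p) = 0 := by
    simp only [G]; rw [ambientMetric_vertField, du_vertField]
  have gVT : G (vertField p) (lift S.dt p) = -w := by
    simp only [G]; rw [ambientMetric_vertField, du_lift_dt]
  have gTV : G (lift S.dt p) (vertField p) = -w := by
    simp only [G]; rw [ambientMetric_symm]; exact gVT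
  have gTT : G (lift S.dt p) (lift S.dt p) = -ρ := S.ambientMetric_dt_dt t₀ p
  have gVe (a) : G (vertField p) (lift (e a) p) = 0 := by
    simp only [G]; rw [ambientMetric_vertField, S.du_lift_of_mem t₀ (hes a)]
  have gTe (a) : G (lift S.dt p) (lift (e a) p) = 0 := by
    simp only [G]; rw [S.ambientMetric_lift t₀ (hes a), S.g_dt]
  have geV (a) : G (lift (e a) p) (vertField p) = 0 := by
    simp only [G]; rw [ambientMetric_symm]; exact gVe a
  have geT (a) : G (lift (e a) p) (lift S.dt p) = 0 := by
    simp only [G]; rw [ambientMetric_symm]; exact gTe a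
  have gee (a c) : G (lift (e a) p) (lift (e c) p) = if a = c then 1 else 0 := by
    simp only [G]; rw [S.ambientMetric_lift t₀ (hes c), he, he, hfo]
  have hb (i j) : G (b i) (b j) =
      (Matrix.fromBlocks 1 0 0 (-1) :
        Matrix (Fin (n + 1) ⊕ Fin 1) (Fin (n + 1) ⊕ Fin 1) ℝ) i j := by
    have hw' : w ≠ 0 := hw
    rcases i with i | i <;> rcases j with j | j
    · rw [Matrix.fromBlocks_apply₁₁, Matrix.one_apply]
      simp only [b, Sum.elim_inl]
      induction i using Fin.cases <;> induction j using Fin.cases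
      · simp [b₁, gVV, gVT, gTV, gTT]; field_simp; ring
      · simp [b₁, gVe, gTe, (Fin.succ_ne_zero _).symm]
      · simp [b₁, geV, geT]
      · simp [gee]
    · rw [Matrix.fromBlocks_apply₁₂]
      simp only [b, Sum.elim_inl, Sum.elim_inr]
      induction i using Fin.cases
      · simp [b₁, b₂, gVV, gVT, gTV, gTT]; field_simp; ring
      · simp [b₂, geV, geT]
    · rw [Matrix.fromBlocks_apply₂₁]
      simp only [b, Sum.elim_inl, Sum.elim_inr]
      induction j using Fin.cases
      · simp [b₁, b₂, gVV, gVT, gTV, gTT]; field_simp; ring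
      · simp [b₂, gVe, gTe]
    · rw [Matrix.fromBlocks_apply₂₂, Subsingleton.elim i j]
      simp [b, b₂, gVV, gVT, gTV, gTT]; field_simp; ring
  have hli : LinearIndependent ℝ b := by
    refine LinearMap.linearIndependent_of_isOrthoᵢ (B := G) (fun i j hij => ?_) fun i => ?_
    · rw [Function.onFun, hb]
      rcases i with i | i <;> rcases j with j | j
      · simpa [Matrix.one_apply] using hij
      · simp
      · simp
      · exact (hij (by rw [Subsingleton.elim i j])).elim
    · rw [hb]
      rcases i with i | i <;> simp
  have hcard : Fintype.card (Fin (n + 1) ⊕ Fin 1) =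
      Module.finrank ℝ (TangentSpace (prodModel n) p) := by
    rw [finrank_tangent_prod]; simp
  exact ⟨basisOfLinearIndependentOfCardEqFinrank hli hcard, fun i j => by
    simpa using hb i j⟩

end GradientRicciFlowSpacetime

end Signature

/-! ### Adapted frames on the product. -/

section AmbientEquations

set_option linter.unusedSectionVars false

variable {n : ℕ} {M : Type*} [TopologicalSpace M] [ChartedSpace (EuclideanHalfSpace (n + 1)) M]
  [IsManifold (𝓡∂ (n + 1)) ∞ M] {lam : ℝ}

/-- The full tangent bundle as a distribution. -/
def fullDist {E : Type*} [NormedAddCommGroup E] [NormedSpace ℝ E]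
    {H : Type*} [TopologicalSpace H] (I : ModelWithCorners ℝ E H)
    (N : Type*) [TopologicalSpace N] [ChartedSpace H N] [IsManifold I ∞ N] :
    InvolutiveDist I N where
  dist _ := ⊤
  lie_mem _ _ _ _ _ _ _ _ _ _ := Submodule.mem_top

namespace GradientRicciFlowSpacetime

variable (S : GradientRicciFlowSpacetime n M lam) (t₀ : ℝ)

lemma det_gram_ambient_ne_zero {ι : Type*} [Fintype ι] [DecidableEq ι]
    {e : ι → VField (prodModel n) (M × ℝ)} {U : Set (M × ℝ)}
    (he : IsFrameOn (prodModel n) (fun _ => ⊤) e U) {p : M × ℝ} (hp : p ∈ U) :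
    (gram (prodModel n) (S.ambientMetric t₀) e p).det ≠ 0 := by
  refine det_gram_ne_zero (S.ambientMetric_symm t₀ p) (he.linearIndependent p hp) fun X _ h => ?_
  refine S.ambientMetric_nondegenerate t₀ fun Y => ?_
  have hY : Y ∈ Submodule.span ℝ (Set.range fun a => e a p) := by
    rw [he.span_eq p hp]; exact Submodule.mem_top
  obtain ⟨c, rfl⟩ := (Submodule.mem_span_range_iff_exists_fun ℝ).1 hY
  simp [h]

variable {e : Fin n → VField (𝓡∂ (n + 1)) M} {U : Set M}
  (he : IsFrameOn (𝓡∂ (n + 1)) (spatial S.time) e U)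
include he

lemma frame_mem (a : Fin n) {x : M} (hx : x ∈ U) : e a x ∈ spatial S.time x := by
  rw [← he.span_eq x hx]; exact Submodule.subset_span ⟨a, rfl⟩

lemma liftsForm : LiftsForm S.g (S.ambientMetric t₀) e U :=
  ⟨he.isOpen, he.smooth, fun _ hp _ a => S.ambientMetric_lift t₀ (S.frame_mem he a hp)⟩

/-- A spatial frame, completed by the time field and the vertical field, is a frame of the
ambient space. -/
lemma isFrameOn_ambient {W : Set (M × ℝ)} (hW : IsOpen W) (hWU : ∀ p ∈ W, p.1 ∈ U) :
    IsFrameOn (prodModel n) (fun _ => ⊤)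
      (Sum.elim (fun a => lift (e a)) ![lift S.dt, vertField] :
        Fin n ⊕ Fin 2 → VField (prodModel n) (M × ℝ)) W := by
  have hli : ∀ p ∈ W, LinearIndependent ℝ (fun a => (Sum.elim (fun a => lift (e a))
      ![lift S.dt, vertField] : Fin n ⊕ Fin 2 → VField (prodModel n) (M × ℝ)) a p) := by
    intro p hp
    rw [Fintype.linearIndependent_iff]
    intro c hc
    simp only [Fintype.sum_sum_type, Sum.elim_inl, Sum.elim_inr, Fin.sum_univ_two,
      Matrix.cons_val_zero, Matrix.cons_val_one] at hc
    have h1 : c (Sum.inr 1) = 0 := by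
      have := congrArg (dv p) hc
      simpa [dv_lift, dv_vertField] using this
    have h0 : c (Sum.inr 0) = 0 := by
      -- The frame does not involve the base time, so `du` for the arbitrary base time `0` serves to
      -- isolate the coefficient of `∂_t`.
      have := congrArg (S.du 0 p) hc
      have hw := (S.one_sub_pos 0 p).ne'
      simp only [map_add, map_sum, map_smul, S.du_lift_of_mem 0 (S.frame_mem he _ (hWU p hp)),
        S.du_lift_dt, S.du_vertField, map_zero, Finset.sum_const_zero, zero_add,
        add_zero, smul_eq_mul, mul_zero] at this
      exact (mul_eq_zero.1 this).resolve_right (neg_ne_zero.2 hw)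
    have h2 (a : Fin n) : c (Sum.inl a) = 0 := by
      have := congrArg (dπ p) hc
      rw [h0, h1] at this
      simp only [zero_smul, add_zero, map_sum, map_smul, dπ_lift, map_zero] at this
      exact Fintype.linearIndependent_iff.1 (he.linearIndependent p.1 (hWU p hp)) _ this a
    rintro (a | a)
    · exact h2 a
    · fin_cases a
      · exact h0
      · exact h1
  refine ⟨hW, ?_, hli, fun p hp => ?_⟩
  · rintro (a | a)
    · exact (he.smooth a).lift.mono hWU
    · fin_cases a
      · exact S.dt_smooth.lift.mono fun _ _ => Set.mem_univ _
      · exact smoothFieldOn_lineField W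
  · have hfd : FiniteDimensional ℝ (TangentSpace (prodModel n) p) :=
      inferInstanceAs (FiniteDimensional ℝ (EuclideanSpace ℝ (Fin (n + 1)) × ℝ))
    refine (hli p hp).span_eq_top_of_card_eq_finrank' ?_
    rw [finrank_tangent_prod]; simp

set_option maxHeartbeats 1000000 in
/-- The ambient metric of a gradient Ricci flow in an adapted frame. -/
theorem exists_isAmbient (W : TopologicalSpace.Opens (M × ℝ)) (hWU : ∀ p ∈ W, p.1 ∈ U) :
    ∃ (s : Fin n → SmoothSec (fullDist (prodModel n) (M × ℝ)) W)
      (gi : Matrix (Fin n) (Fin n) (SmoothFun (prodModel n) W))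
      (T V : SmoothSec (fullDist (prodModel n) (M × ℝ)) W)
      (u v φ ρ wi : SmoothFun (prodModel n) W),
      IsAmbient (secForm (S.ambientMetric t₀) (S.ambientMetric_smooth t₀) _ W) s gi T V u v φ ρ
        (algebraMap ℝ _ lam) wi ∧
      ∀ x : W, ev x (φ - v + algebraMap ℝ _ lam * u * v) = S.ambientPotential t₀ x := by
  -- All leafwise quantities of the lifted frame at a point of `W` equal those of the slice at its
  -- projection; this moves the flow equations to the product.
  have hL := S.liftsForm t₀ he
  have hF := S.isFrameOn_ambient he W.2 hWU
  set D := fullDist (prodModel n) (M × ℝ) with hD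
  let G := secForm (S.ambientMetric t₀) (S.ambientMetric_smooth t₀) D W
  let s (a : Fin n) : SmoothSec D W :=
    SmoothSec.mk (lift (e a)) ((he.smooth a).lift.mono hWU) fun _ _ => Submodule.mem_top
  let T : SmoothSec D W :=
    SmoothSec.mk (lift S.dt) (S.dt_smooth.lift.mono fun _ _ => Set.mem_univ _)
      fun _ _ => Submodule.mem_top
  let V : SmoothSec D W := SmoothSec.mk vertField (smoothFieldOn_lineField _)
    fun _ _ => Submodule.mem_top
  let u : SmoothFun (prodModel n) W := SmoothFun.mk (S.u t₀) (S.u_smooth t₀).contMDiffOn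
  let v : SmoothFun (prodModel n) W := SmoothFun.mk Prod.snd contMDiffOn_snd
  let φ : SmoothFun (prodModel n) W := SmoothFun.mk (fun p => S.φ p.1)
    (S.φ_smooth.comp contMDiff_fst).contMDiffOn
  let ρ : SmoothFun (prodModel n) W := SmoothFun.mk (fun p => S.weightedScal p.1)
    (S.weightedScal_smooth.comp contMDiff_fst).contMDiffOn
  let wi : SmoothFun (prodModel n) W := SmoothFun.mk (fun p => (1 - lam * S.u t₀ p)⁻¹)
    (ContMDiffOn.inv₀ (contMDiffOn_const.sub
      (contMDiffOn_const.mul (S.u_smooth t₀).contMDiffOn)) fun p _ => (S.one_sub_pos t₀ p).ne')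
  have hs (a : Fin n) (x : W) : (s a).1 x = lift (e a) x := rfl
  have hT (x : W) : T.1 x = lift S.dt x := rfl
  have hV (x : W) : V.1 x = vertField (x : M × ℝ) := rfl
  have hu (x : W) : ev x u = S.u t₀ x := rfl
  have hv (x : W) : ev x v = (x : M × ℝ).2 := rfl
  have hφ (x : W) : ev x φ = (fun q : M × ℝ => S.φ q.1) x := rfl
  have hρ (x : W) : ev x ρ = (fun q : M × ℝ => S.weightedScal q.1) x := rfl
  have hwi (x : W) : ev x wi = (1 - lam * S.u t₀ x)⁻¹ := rfl
  have hlam (x : W) : ev x (algebraMap ℝ (SmoothFun (prodModel n) W) lam) = lam := rfl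
  have hG (X Y : SmoothSec D W) (x : W) :
      ev x (G X Y) = S.ambientMetric t₀ x (X.1 x) (Y.1 x) := 
    secForm_apply (S.ambientMetric t₀) (S.ambientMetric_smooth t₀) X Y x
  have hdt : SmoothFieldOn (𝓡∂ (n + 1)) S.dt U := S.dt_smooth.mono (Set.subset_univ U)
  obtain ⟨gi, hgi, hev⟩ := exists_isGramInv (D := D) (S.ambientMetric_smooth t₀)
    (e := fun a => lift (e a)) hs (S.ambientMetric_symm t₀) fun p hp => by
      rw [hL.gram_eq (hWU p hp)]
      exact S.det_gram_frame_ne_zero he (hWU p hp)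
  have hGee (a b : Fin n) (x : W) : ev x (G (s a) (s b)) =
      (fun q : M × ℝ => S.g q.1 (e a q.1) (e b q.1)) x := by
    rw [hG]; exact hL.apply x (hWU x x.2) _ b
  have hgee (a b : Fin n) (x : W) : MDifferentiableAt (𝓡∂ (n + 1)) 𝓘(ℝ, ℝ)
      (fun y => S.g y (e a y) (e b y)) (x : M × ℝ).1 :=
    mdiffAt_of_contMDiffOn he.isOpen (S.g_smooth U _ _ he.isOpen (he.smooth a) (he.smooth b))
      (hWU x x.2)
  have hbr (a b : Fin n) (x : W) : mlieBracket (𝓡∂ (n + 1)) (e a) (e b) (x : M × ℝ).1 ∈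
      spatial S.time (x : M × ℝ).1 :=
    S.spatialDist.lie_mem U _ _ he.isOpen (he.smooth a) (he.smooth b)
      (fun y hy => S.frame_mem he a hy) (fun y hy => S.frame_mem he b hy) _ (hWU x x.2)
  have hTe (a b : Fin n) (x : W) : ev x (G ⁅T, s a⁆ (s b)) =
      S.g (x : M × ℝ).1 (mlieBracket (𝓡∂ (n + 1)) S.dt (e a) (x : M × ℝ).1)
        (e b (x : M × ℝ).1) := by
    rw [hG, SmoothSec.lie_apply hT (hs a),
      mlieBracket_lift he.isOpen hdt (he.smooth a) (hWU x x.2)]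
    exact hL.apply x (hWU x x.2) _ b
  have hRic (a b : Fin n) (x : W) : ev x (frameRic G gi s a b) =
      ric (𝓡∂ (n + 1)) S.g e a b (x : M × ℝ).1 :=
    (ev_frameRic hs hev x a b).trans (hL.ric_eq (hWU x x.2) a b)
  have hScal (x : W) : ev x (frameScal G gi s) = scal (𝓡∂ (n + 1)) S.g e (x : M × ℝ).1 :=
    (ev_frameScal hs hev x).trans (hL.scal_eq (hWU x x.2))
  have hHess (a b : Fin n) (x : W) : ev x (frameHess G gi s φ a b) =
      hess (𝓡∂ (n + 1)) S.g e S.φ a b (x : M × ℝ).1 :=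
    (ev_frameHess (Φ := fun q : M × ℝ => S.φ q.1) hs hev hφ x a b).trans
      (hL.hess_eq (hWU x x.2) S.φ a b)
  have hLap (x : W) : ev x (frameLap G gi s φ) = lap (𝓡∂ (n + 1)) S.g e S.φ (x : M × ℝ).1 :=
    (ev_frameLap (Φ := fun q : M × ℝ => S.φ q.1) hs hev hφ x).trans
      (hL.lap_eq (hWU x x.2) S.φ)
  have hGrad (x : W) : ev x (frameGradSq gi s φ) =
      gradSq (𝓡∂ (n + 1)) S.g e S.φ (x : M × ℝ).1 :=
    (ev_frameGradSq (g := S.ambientMetric t₀) (Φ := fun q : M × ℝ => S.φ q.1) hs hev hφ x).trans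
      (hL.gradSq_eq (hWU x x.2) S.φ)
  have Gsymm (X Y : SmoothSec D W) : G X Y = G Y X := ext_ev fun x => by
    rw [hG, hG, ambientMetric_symm]
  refine ⟨s, gi, T, V, u, v, φ, ρ, wi, ?_, fun x => ?_⟩
  swap
  · simp only [map_add, map_sub, map_mul, hφ, hv, hu, hlam, ambientPotential]
  exact {
    symm := Gsymm
    gram := hgi
    span := fun X => by
      obtain ⟨gi', hgi', -⟩ := exists_isGramInv (D := D) (S.ambientMetric_smooth t₀)
        (IsFrameOn.sec_apply (D := D) (U := W) hF) (S.ambientMetric_symm t₀)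
        fun p hp => S.det_gram_ambient_ne_zero t₀ hF hp
      have hX := hgi'.sec_span (D := D) (U := W) hF X
      have : ambientFrame s T V = IsFrameOn.sec (D := D) (U := W) hF := by
        funext a
        rcases a with a | a
        · rfl
        · fin_cases a <;> rfl
      rw [this]; exact hX
    e_T := fun a => ext_ev fun x => by
      rw [hG, map_zero, ambientMetric_symm, hT, hs,
        S.ambientMetric_lift t₀ (S.frame_mem he a (hWU x x.2)), S.g_dt]
    T_T := ext_ev fun x => by rw [hG, hT, S.ambientMetric_dt_dt, map_neg]; rfl
    closed := fun Z => ext_ev fun x => by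
      rw [hG, hV, ambientMetric_vertField, ev_lie (secOut_apply Z x).symm hu, ← secOut_apply]
      rfl
    e_u := fun a => ext_ev fun x => by
      rw [ev_lie (hs a x) hu, map_zero]
      exact S.du_lift_of_mem t₀ (S.frame_mem he a (hWU x x.2))
    T_u := ext_ev fun x => by
      rw [ev_lie (hT x) hu]
      exact S.du_lift_dt t₀ x
    V_u := ext_ev fun x => by
      rw [ev_lie (hV x) hu, map_zero]
      exact S.du_vertField t₀ x
    wi_mul := ext_ev fun x => by
      rw [map_mul, hwi, map_sub, map_mul, map_one, hlam, hu]
      exact inv_mul_cancel₀ (S.one_sub_pos t₀ x).ne'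
    const := fun X => ext_ev fun x => by
      rw [ev_lie (F := fun _ => lam) (secOut_apply X x).symm hlam, map_zero]
      simp [along, mvfderiv_const]
    lie_V_e := fun a => SmoothSec.ext' fun x => by
      rw [SmoothSec.lie_apply hV (hs a)]
      exact mlieBracket_lineField_lift he.isOpen (he.smooth a) (hWU x x.2)
    lie_V_T := SmoothSec.ext' fun x => by
      rw [SmoothSec.lie_apply hV hT]
      exact mlieBracket_lineField_lift isOpen_univ S.dt_smooth (Set.mem_univ _)
    V_gram := fun a b => ext_ev fun x => by
      rw [ev_lie (F := fun q : M × ℝ => S.g q.1 (e a q.1) (e b q.1)) (hV x) (hGee a b),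
        map_zero]
      exact along_lineField_comp_fst (hgee a b x)
    V_ρ := ext_ev fun x => by
      rw [ev_lie (F := fun q : M × ℝ => S.weightedScal q.1) (hV x) hρ, map_zero]
      exact along_lineField_comp_fst (S.weightedScal_smooth.mdifferentiableAt (by simp))
    V_φ := ext_ev fun x => by
      rw [ev_lie (F := fun q : M × ℝ => S.φ q.1) (hV x) hφ, map_zero]
      exact along_lineField_comp_fst (S.φ_smooth.mdifferentiableAt (by simp))
    V_v := ext_ev fun x => by
      rw [ev_lie (hV x) hv, map_one]
      exact dv_vertField _
    e_v := fun a => ext_ev fun x => by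
      rw [ev_lie (hs a x) hv, map_zero]
      exact dv_lift _ _
    T_v := ext_ev fun x => by
      rw [ev_lie (hT x) hv, map_zero]
      exact dv_lift _ _
    lie_e_e_T := fun a b => ext_ev fun x => by
      rw [hG, SmoothSec.lie_apply (hs a) (hs b), hT,
        mlieBracket_lift he.isOpen (he.smooth a) (he.smooth b) (hWU x x.2), ambientMetric_symm,
        S.ambientMetric_lift t₀ (hbr a b x), S.g_dt, map_zero]
    flow_g := fun a b => ext_ev fun x => by
      have h := S.flow_g e U he _ (hWU x x.2) a b
      rw [Gsymm (s a) ⁅T, s b⁆, map_sub, map_sub,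
        ev_lie (F := fun q : M × ℝ => S.g q.1 (e a q.1) (e b q.1)) (hT x) (hGee a b),
        along_lift S.dt (fun y => S.g y (e a y) (e b y)), hTe, hTe, map_mul, map_neg, map_ofNat,
        map_sub, map_add, map_mul, hRic a b x, hHess a b x, hGee, hlam, ← h, lieDerivForm,
        S.g_symm _ (e a _)]
    flow_φ := ext_ev fun x => by
      have h := S.flow_φ e U he _ (hWU x x.2)
      rw [ev_lie (F := fun q : M × ℝ => S.φ q.1) (hT x) hφ, along_lift S.dt S.φ, h,
        map_neg, map_sub, map_add, map_mul, map_natCast, hlam, hScal x, hLap x, Fintype.card_fin]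
    ρ_eq := ext_ev fun x => by
      simp only [map_sub, map_add, map_mul, map_natCast, map_ofNat]
      rw [hlam, hScal x, hLap x, hGrad x, hρ, hφ]
      exact S.weightedScal_eq he (hWU x x.2) }

end GradientRicciFlowSpacetime

end AmbientEquations

/-! ### Assembly of the ambient half-space. -/

section HalfSpace

variable {n : ℕ} {M : Type*} [TopologicalSpace M] [ChartedSpace (EuclideanHalfSpace (n + 1)) M]
  [IsManifold (𝓡∂ (n + 1)) ∞ M] {lam : ℝ}

namespace GradientRicciFlowSpacetime

variable (S : GradientRicciFlowSpacetime n M lam) (t₀ : ℝ)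

/-- The vertical field is geodesic. -/
lemma koszul_vertField (Z : VField (prodModel n) (M × ℝ)) {U : Set (M × ℝ)} (hU : IsOpen U)
    (hZ : SmoothFieldOn (prodModel n) Z U) {p : M × ℝ} (hp : p ∈ U) :
    koszul (prodModel n) (S.ambientMetric t₀) vertField vertField Z p = 0 := by
  have hV : SmoothFieldOn (prodModel n) (vertField (M := M)) U := smoothFieldOn_lineField U
  have hVu : along (prodModel n) vertField (S.u t₀) = fun _ => 0 :=
    funext fun q => S.du_vertField t₀ q
  have h1 : (fun q => S.ambientMetric t₀ q (vertField q) (Z q)) = along (prodModel n) Z (S.u t₀) :=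
    funext fun q => S.ambientMetric_vertField t₀ q (Z q)
  have h2 : (fun q => S.ambientMetric t₀ q (vertField q) (vertField q)) = fun _ => 0 :=
    funext fun q => (S.ambientMetric_vertField t₀ q _).trans (S.du_vertField t₀ q)
  have h3 : S.ambientMetric t₀ p (mlieBracket (prodModel n) vertField Z p) (vertField p) =
      along (prodModel n) (mlieBracket (prodModel n) vertField Z) (S.u t₀) p := by
    rw [ambientMetric_symm, ambientMetric_vertField]; rfl
  have h4 := along_lieBracket hU hV hZ (S.u_smooth t₀).contMDiffOn hp
  have h5 (X : VField (prodModel n) (M × ℝ)) : along (prodModel n) X (fun _ => (0 : ℝ)) p = 0 := by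
    simp [along, mvfderiv_const]
  rw [hVu, h5, sub_zero] at h4
  -- The Koszul expression reduces to `V(Zu) - [V, Z]u = Z(Vu)`, which is zero.
  rw [koszul, h1, h2, h5, h3, h4]
  simp

lemma exists_ambient_nhd {U : Set (M × ℝ)} (hU : IsOpen U) {p : M × ℝ} (hp : p ∈ U) :
    ∃ W : TopologicalSpace.Opens (M × ℝ), p ∈ W ∧ (W : Set (M × ℝ)) ⊆ U ∧
      ∃ (s : Fin n → SmoothSec (fullDist (prodModel n) (M × ℝ)) W)
        (gi : Matrix (Fin n) (Fin n) (SmoothFun (prodModel n) W))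
        (T V : SmoothSec (fullDist (prodModel n) (M × ℝ)) W)
        (u v φ ρ wi : SmoothFun (prodModel n) W),
        IsAmbient (secForm (S.ambientMetric t₀) (S.ambientMetric_smooth t₀) _ W) s gi T V u v φ ρ
          (algebraMap ℝ _ lam) wi ∧
        ∀ x : W, ev x (φ - v + algebraMap ℝ _ lam * u * v) = S.ambientPotential t₀ x := by
  obtain ⟨e, U₀, he, hp₀⟩ := S.exists_frame p.1
  exact ⟨⟨U ∩ Prod.fst ⁻¹' U₀, hU.inter (he.isOpen.preimage continuous_fst)⟩, ⟨hp, hp₀⟩,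
    Set.inter_subset_left, S.exists_isAmbient t₀ he _ fun q hq => hq.2⟩

theorem ambient_wP_eq_zero {e : Fin (n + 2) → VField (prodModel n) (M × ℝ)} {U : Set (M × ℝ)}
    (he : IsFrameOn (prodModel n) (fun _ => ⊤) e U) {p : M × ℝ} (hp : p ∈ U) (a b : Fin (n + 2)) :
    wP (prodModel n) (S.ambientMetric t₀) e (S.ambientPotential t₀) lam a b p = 0 := by
  obtain ⟨W, hpW, hWU, s, gi, T, V, u, v, φ, ρ, wi, hA, hΦ⟩ := S.exists_ambient_nhd t₀ he.isOpen hp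
  have he' := he.mono W.2 hWU
  -- The given frame is arbitrary; its components of `P` are values of the invariant form, which is
  -- computed with the adapted frame on the smaller set `W`.
  have h := wP_eq_ev (D := fullDist (prodModel n) (M × ℝ)) (U := W) (S.ambientMetric_smooth t₀)
    (S.ambientMetric_symm t₀) he' (fun q hq => S.det_gram_ambient_ne_zero t₀ he' hq) hΦ lam
    hA.frames ⟨p, hpW⟩ a b
  rw [hA.wPForm_eq_zero] at h
  simpa using h

theorem ambient_wF_eq_zero {e : Fin (n + 2) → VField (prodModel n) (M × ℝ)} {U : Set (M × ℝ)}
    (he : IsFrameOn (prodModel n) (fun _ => ⊤) e U) {p : M × ℝ} (hp : p ∈ U) :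
    wF (prodModel n) (S.ambientMetric t₀) e (S.ambientPotential t₀) lam p = 0 := by
  obtain ⟨W, hpW, hWU, s, gi, T, V, u, v, φ, ρ, wi, hA, hΦ⟩ := S.exists_ambient_nhd t₀ he.isOpen hp
  have he' := he.mono W.2 hWU
  have h := wF_eq_ev (D := fullDist (prodModel n) (M × ℝ)) (U := W) (S.ambientMetric_smooth t₀)
    (S.ambientMetric_symm t₀) he' (fun q hq => S.det_gram_ambient_ne_zero t₀ he' hq) hΦ lam
    hA.frames ⟨p, hpW⟩
  have h0 := hA.wF_eq_zero hA.frames.isLeviCivita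
  have hc : ((Fintype.card (Fin (n + 2)) : ℕ) : SmoothFun (prodModel n) W) =
      (Fintype.card (Fin n) : SmoothFun (prodModel n) W) + 2 := by
    simp
  rw [hc, h0, map_zero] at h
  exact h

/-- The ambient space of a gradient Ricci flow spacetime is a global weighted ambient
half-space. -/
theorem isGlobalAmbientHalfSpace :
    S.IsGlobalAmbientHalfSpace t₀ (S.ambientMetric t₀) (S.ambientPotential t₀) where
  half_space p := uCoord_nonpos_iff lam t₀ (S.time p.1)
  metric_smooth := S.ambientMetric_smooth t₀
  metric_symm := S.ambientMetric_symm t₀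
  signature := S.ambientMetric_signature t₀
  potential_smooth := S.ambientPotential_smooth t₀
  metric_invariant := S.ambientMetric_vertShift t₀
  potential_homogeneous := S.ambientPotential_dilation t₀
  metric_initial p _ X Y hX hY := by
    rw [ambientMetric_apply, hX, hY]; simp
  potential_initial p hp := by
    simp [ambientPotential, u, hp, uCoord_self]
  straight p _ U Z hU hp hZ := S.koszul_vertField t₀ Z hU hZ hp
  wP_eq_zero _ _ he _ hp a b := S.ambient_wP_eq_zero t₀ he hp a b
  wF_eq_zero _ _ he _ hp := S.ambient_wF_eq_zero t₀ he hp

end GradientRicciFlowSpacetime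

end HalfSpace

end RicciAmbient

end

theorem theorem1p5 {n : ℕ} {M : Type*} [TopologicalSpace M]
    [ChartedSpace (EuclideanHalfSpace (n + 1)) M] [IsManifold (𝓡∂ (n + 1)) ∞ M] {lam : ℝ}
    (S : RicciAmbient.GradientRicciFlowSpacetime n M lam) (t₀ : ℝ) :
    S.IsGlobalAmbientHalfSpace t₀ (S.ambientMetric t₀) (S.ambientPotential t₀) :=
  S.isGlobalAmbientHalfSpace t₀
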